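/- **Theorem 3.** Let $(X_i,Z_i,Y_i,N_i)$, $i=1,2,\dots$, be independent and identically distributed. Here $X_i(t)\in\mathbb R^p$, $Z_i(t)\in\mathbb R^q$, $Y_i(t)\in\mathbb R$ are stochastic processes, with $(X_i,Y_i)$ a measurable process (jointly measurable in time and in its own $\sigma$-algebra), and $N_i(t)=\sum_{j=1}^{L_i}I(T_{ij}\le t)$ counts the $L_i<\infty$ observation times $T_{ij}\in[0,1]$ of $(X_i,Y_i)$; $(X,Z,Y,N)$ stands for a generic subject. For every $t\in[0,1]$ let $X(t),Y(t)$ be square-integrable, $Z(t)$ integrable, and $$E\{Y(t)\mid X(t),Z(t)\}=X(t)^T\beta_0(t)+Z(t)^T\gamma_0(t),\qquad E\{Z(t)\mid X(t)\}=E\{Z(t)\}\quad\text{(orthogonality)}.$$ Write $\tilde X(t)=X(t)-E\,X(t)$, $\tilde Y(t)=Y(t)-E\,Y(t)$, $\varepsilon(t)=\tilde Y(t)-\tilde X(t)^T\beta_0(t)$, $\sigma\{t,\tilde X(t)\}^2=\mathrm{var}\{\tilde Y(t)\mid\tilde X(t)\}$, $\alpha(t)=E\{Z(t)\}^T\gamma_0(t)$.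 Assume: (A5) $N_i$ is independent of $(X_i,Y_i)$; $E\{dN_i(t)\}=\lambda(t)\,dt$ with $\lambda$ twice continuously differentiable on $[0,1]$; and distinct observations of a subject have a bounded joint intensity: for some $C$ and all Borel sets $B,B'$, $E\,\#\{(j,k):j\ne k,\ T_{ij}\in B,\ T_{ik}\in B'\}\le C|B||B'|$. (A6) $\beta_0$ and $\alpha$ are twice continuously differentiable on $[0,1]$; $E\,X(t)$ is continuous on $[0,1]$; $E\{\tilde X(t_1)\tilde X(s_1)^T\}$ is twice continuously differentiable on $[0,1]^2$; $E\{\tilde X(t)\tilde X(t)^T\}\lambda(t)$ is positive definite for all $t\in[0,1]$; $E[\tilde X(t)\tilde X(t)^T\sigma\{t,\tilde X(t)\}^2]$ is finite and continuous on $[0,1]$; $\sup_{t\in[0,1]}E\{\varepsilon(t)^2\}<\infty$ and $\sup_{t\in[0,1]}E\{\|\tilde X(t)\|^r|\varepsilon(t)|^r\}<\infty$ for some $r>2$. (A7) $K\ge 0$ is a measurable symmetric function with $\int K(z)\,dz=1$, $\int zK(z)\,dz=0$, $\int z^2K(z)\,dz<\infty$, $\int K(z)^2dz<\infty$, and moreover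 $\int|z|^3K(z)\,dz<\infty$ and $\int z^2K(z)^2dz<\infty$ (both automatic if $K$ has bounded support). (A8) $h=h_n>0$, $nh\to\infty$ and $nh^5\to0$. Fix $t\in(0,1)$, let $K_h(u)=K(u/h)/h$, and for each $n$ let $\{\hat\alpha_v(t),\hat\beta_v(t),\hat{\dot\alpha}_v(t),\hat{\dot\beta}_v(t)\}$, with $\hat\beta_v(t)$ measurable, almost surely minimize, over $a_0,a_1\in\mathbb R$ and $b_0,b_1\in\mathbb R^p$, $$\sum_{i=1}^n\int K_h(t_1-t)\left[Y_i(t_1)-\{a_0+X_i(t_1)^Tb_0\}-\{a_1+X_i(t_1)^Tb_1\}(t_1-t)\right]^2dN_i(t_1).$$ Then, as $n\to\infty$, $$\sqrt{nh}\,\{\hat\beta_v(t)-\beta_0(t)\}\ \xrightarrow{d}\ N\{0,\;A(t)^{-1}\Sigma(t)A(t)^{-1}\},$$ where $$A(t)=E\{\tilde X(t)\tilde X(t)^T\}\lambda(t),\qquad \Sigma(t)=\Big\{\int K(z)^2dz\Big\}\,E\big[\tilde X(t)\tilde X(t)^T\sigma\{t,\tilde X(t)\}^2\big]\lambda(t),$$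 and $A(t)^{-1}\Sigma(t)A(t)^{-1}$ is positive semidefinite. -/

import Mathlib

open MeasureTheory ProbabilityTheory Filter Topology
open scoped NNReal ENNReal

noncomputable section

namespace VaryingCoef

/-- `ℝ^d` with its Euclidean structure; `inner ℝ x y` is `xᵀ y`. -/
abbrev Vec (d : ℕ) : Type := EuclideanSpace ℝ (Fin d)

/-- Raw data of the longitudinal study. For subject `i`: the covariate processes `X i`
(observed synchronously with the response) and `Z i`, the response process `Y i`, the number
`L i` of observation times of `(X i, Y i)` and the times `T i 0, …, T i (L i - 1)` themselves.
Time runs through `[0, 1]`; values of the processes at other times play no role. -/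
structure Study (Ω : Type*) (p q : ℕ) where
  X : ℕ → ℝ → Ω → Vec p
  Z : ℕ → ℝ → Ω → Vec q
  Y : ℕ → ℝ → Ω → ℝ
  L : ℕ → Ω → ℕ
  T : ℕ → ℕ → Ω → ℝ

namespace Study

variable {Ω : Type*} {p q : ℕ}

/-- The counting process `N_i(t) = ∑_{j < L_i} 1(T_ij ≤ t)`. -/
def N (D : Study Ω p q) (i : ℕ) (t : ℝ) (ω : Ω) : ℕ :=
  ((Finset.range (D.L i ω)).filter (fun j => D.T i j ω ≤ t)).card

/-- The integral `∫ g(s) dN_i(s)`, that is `∑_{j < L_i} g(T_ij)`. -/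
def integralN (D : Study Ω p q) (i : ℕ) (ω : Ω) (g : ℝ → ℝ) : ℝ :=
  ∑ j ∈ Finset.range (D.L i ω), g (D.T i j ω)

open Classical in
/-- The number of ordered pairs of different observations of subject `i` with the first one made
at a time in `A` and the second one at a time in `B`. -/
def pairCount (D : Study Ω p q) (i : ℕ) (A B : Set ℝ) (ω : Ω) : ℕ :=
  ((Finset.range (D.L i ω) ×ˢ Finset.range (D.L i ω)).filter
    (fun jk => jk.1 ≠ jk.2 ∧ D.T i jk.1 ω ∈ A ∧ D.T i jk.2 ω ∈ B)).card

/-- The path of `(X_i, Y_i)`, as a point of the product space. -/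
def pathXY (D : Study Ω p q) (i : ℕ) (ω : Ω) : ℝ → Vec p × ℝ :=
  fun s => (D.X i s ω, D.Y i s ω)

/-- The path of `N_i`. -/
def pathN (D : Study Ω p q) (i : ℕ) (ω : Ω) : ℝ → ℕ := fun s => D.N i s ω

/-- The path of `(X_i, Z_i, Y_i, N_i)`. -/
def path (D : Study Ω p q) (i : ℕ) (ω : Ω) : ℝ → Vec p × Vec q × ℝ × ℕ :=
  fun s => (D.X i s ω, D.Z i s ω, D.Y i s ω, D.N i s ω)

variable [MeasurableSpace Ω]

/-- The subjects are independent and identically distributed, the observation times lie in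
`[0, 1]`, and everything is measurable. The field `measurable_process` says that `(X_i, Y_i)` is
a measurable process: `(s, ω) ↦ (X_i(s, ω), Y_i(s, ω))` is jointly measurable with respect to
the Borel `σ`-algebra in `s` and the `σ`-algebra generated by the process itself in `ω` (which
is automatic, for example, for one-sidedly continuous paths). -/
structure IsIIDSample (D : Study Ω p q) (P : Measure Ω) : Prop where
  measurable_X : ∀ i s, Measurable (D.X i s)
  measurable_Z : ∀ i s, Measurable (D.Z i s)
  measurable_Y : ∀ i s, Measurable (D.Y i s)
  measurable_L : ∀ i, Measurable (D.L i)
  measurable_T : ∀ i j, Measurable (D.T i j)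
  measurable_process : ∀ i,
    Measurable[MeasurableSpace.prod (inferInstance : MeasurableSpace ℝ)
        (MeasurableSpace.comap (D.pathXY i) MeasurableSpace.pi)]
      (fun z : ℝ × Ω => (D.X i z.1 z.2, D.Y i z.1 z.2))
  times_mem : ∀ i, ∀ᵐ ω ∂P, ∀ j < D.L i ω, D.T i j ω ∈ Set.Icc (0 : ℝ) 1
  indep : iIndepFun (fun i => D.path i) P
  identDistrib : ∀ i, IdentDistrib (D.path i) (D.path 0) P P

/-- The varying-coefficient model
`E{Y(t) ∣ X(t), Z(t)} = X(t)ᵀ β₀(t) + Z(t)ᵀ γ₀(t)` for `t ∈ [0, 1]`,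
with `X(t)` and `Y(t)` square-integrable and `Z(t)` integrable. -/
structure Model (D : Study Ω p q) (P : Measure Ω) (β₀ : ℝ → Vec p) (γ₀ : ℝ → Vec q) :
    Prop where
  memLp_X : ∀ t ∈ Set.Icc (0 : ℝ) 1, MemLp (D.X 0 t) 2 P
  memLp_Y : ∀ t ∈ Set.Icc (0 : ℝ) 1, MemLp (D.Y 0 t) 2 P
  integrable_Z : ∀ t ∈ Set.Icc (0 : ℝ) 1, Integrable (D.Z 0 t) P
  condExp_eq : ∀ t ∈ Set.Icc (0 : ℝ) 1,
    P[D.Y 0 t | MeasurableSpace.comap (fun ω => (D.X 0 t ω, D.Z 0 t ω)) inferInstance]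
      =ᵐ[P] fun ω => inner ℝ (D.X 0 t ω) (β₀ t) + inner ℝ (D.Z 0 t ω) (γ₀ t)

/-- Orthogonality: `E{Z(t) ∣ X(t)} = E{Z(t)}` for `t ∈ [0, 1]`. -/
def Orthogonal (D : Study Ω p q) (P : Measure Ω) : Prop :=
  ∀ t ∈ Set.Icc (0 : ℝ) 1,
    P[D.Z 0 t | MeasurableSpace.comap (D.X 0 t) inferInstance]
      =ᵐ[P] fun _ => ∫ ω, D.Z 0 t ω ∂P

/-- `X̃(t) = X(t) - E X(t)`. -/
def Xc (D : Study Ω p q) (P : Measure Ω) (t : ℝ) (ω : Ω) : Vec p :=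
  D.X 0 t ω - ∫ ω', D.X 0 t ω' ∂P

/-- `Ỹ(t) = Y(t) - E Y(t)`. -/
def Yc (D : Study Ω p q) (P : Measure Ω) (t : ℝ) (ω : Ω) : ℝ :=
  D.Y 0 t ω - ∫ ω', D.Y 0 t ω' ∂P

/-- `σ{t, X̃(t)}² = var{Ỹ(t) ∣ X̃(t)}`. -/
def condVariance (D : Study Ω p q) (P : Measure Ω) (t : ℝ) : Ω → ℝ :=
  condVar (MeasurableSpace.comap (D.Xc P t) inferInstance) (D.Yc P t) P

/-- The residual `ε(t) = Ỹ(t) - X̃(t)ᵀ β₀(t)`. -/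
def resid (D : Study Ω p q) (P : Measure Ω) (β₀ : ℝ → Vec p) (t : ℝ) (ω : Ω) : ℝ :=
  D.Yc P t ω - inner ℝ (D.Xc P t ω) (β₀ t)

/-- The intercept `α(t) = E{Z(t)}ᵀ γ₀(t)`. -/
def intercept (D : Study Ω p q) (P : Measure Ω) (γ₀ : ℝ → Vec q) (t : ℝ) : ℝ :=
  inner ℝ (∫ ω, D.Z 0 t ω ∂P) (γ₀ t)

/-- `A(t) = E{X̃(t) X̃(t)ᵀ} lam(t)`. -/
def matA (D : Study Ω p q) (P : Measure Ω) (lam : ℝ → ℝ) (t : ℝ) : Matrix (Fin p) (Fin p) ℝ :=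
  Matrix.of fun k l => (∫ ω, D.Xc P t ω k * D.Xc P t ω l ∂P) * lam t

/-- `Σ(t) = {∫ K(z)² dz} E[X̃(t) X̃(t)ᵀ σ{t, X̃(t)}²] lam(t)`. -/
def matS (D : Study Ω p q) (P : Measure Ω) (lam K : ℝ → ℝ) (t : ℝ) :
    Matrix (Fin p) (Fin p) ℝ :=
  Matrix.of fun k l =>
    (∫ z, K z ^ 2) * (∫ ω, D.Xc P t ω k * D.Xc P t ω l * D.condVariance P t ω ∂P) * lam t

/-- Condition on the observation process: `N_i` is independent of `(X_i, Y_i)`, it has the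
intensity `lam`, a twice continuously differentiable function on `[0, 1]`, and different
observations of a subject have a bounded joint intensity. -/
structure ObservationCond (D : Study Ω p q) (P : Measure Ω) (lam : ℝ → ℝ) : Prop where
  indep : ∀ i, IndepFun (D.pathN i) (D.pathXY i) P
  contDiff_lam : ContDiffOn ℝ 2 lam (Set.Icc 0 1)
  intensity : ∀ t ∈ Set.Icc (0 : ℝ) 1,
    ∫⁻ ω, (D.N 0 t ω : ℝ≥0∞) ∂P = ENNReal.ofReal (∫ s in (0 : ℝ)..t, lam s)
  joint_intensity : ∃ C : ℝ≥0, ∀ A B : Set ℝ, MeasurableSet A → MeasurableSet B →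
    ∫⁻ ω, (D.pairCount 0 A B ω : ℝ≥0∞) ∂P ≤ C * volume A * volume B

/-- Smoothness, identifiability and moment condition. -/
structure RegularityCond (D : Study Ω p q) (P : Measure Ω) (lam : ℝ → ℝ) (β₀ : ℝ → Vec p)
    (γ₀ : ℝ → Vec q) : Prop where
  contDiff_beta : ContDiffOn ℝ 2 β₀ (Set.Icc 0 1)
  contDiff_intercept : ContDiffOn ℝ 2 (D.intercept P γ₀) (Set.Icc 0 1)
  continuous_mean : ContinuousOn (fun t => ∫ ω, D.X 0 t ω ∂P) (Set.Icc 0 1)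
  contDiff_cov : ∀ k l, ContDiffOn ℝ 2
    (fun u : ℝ × ℝ => ∫ ω, D.Xc P u.1 ω k * D.Xc P u.2 ω l ∂P) (Set.Icc 0 1 ×ˢ Set.Icc 0 1)
  posDef : ∀ t ∈ Set.Icc (0 : ℝ) 1, (D.matA P lam t).PosDef
  integrable_var : ∀ t ∈ Set.Icc (0 : ℝ) 1, ∀ k l,
    Integrable (fun ω => D.Xc P t ω k * D.Xc P t ω l * D.condVariance P t ω) P
  continuous_var : ∀ k l, ContinuousOn
    (fun t => ∫ ω, D.Xc P t ω k * D.Xc P t ω l * D.condVariance P t ω ∂P) (Set.Icc 0 1)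
  bounded_resid : ∃ C : ℝ, ∀ t ∈ Set.Icc (0 : ℝ) 1, ∫ ω, D.resid P β₀ t ω ^ 2 ∂P ≤ C
  lyapunov : ∃ r C : ℝ, 2 < r ∧ ∀ t ∈ Set.Icc (0 : ℝ) 1,
    ∫⁻ ω, ENNReal.ofReal ((‖D.Xc P t ω‖ * |D.resid P β₀ t ω|) ^ r) ∂P ≤ ENNReal.ofReal C

/-- The weighted least squares criterion of the local linear fit at `t`, from the first `n`
subjects, with bandwidth `h`, at the intercept values `a₀, a₁` and the slope values `b₀, b₁`:
`∑_{i<n} ∫ K_h(s-t) {Y_i(s) - (a₀ + X_i(s)ᵀ b₀) - (a₁ + X_i(s)ᵀ b₁) (s-t)}² dN_i(s)`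
with `K_h(u) = K(u/h)/h`. -/
def criterion (D : Study Ω p q) (K : ℝ → ℝ) (h t : ℝ) (n : ℕ) (ω : Ω)
    (θ : (ℝ × Vec p) × (ℝ × Vec p)) : ℝ :=
  ∑ i ∈ Finset.range n, D.integralN i ω fun s =>
    K ((s - t) / h) / h *
      (D.Y i s ω - (θ.1.1 + inner ℝ (D.X i s ω) θ.1.2)
        - (θ.2.1 + inner ℝ (D.X i s ω) θ.2.2) * (s - t)) ^ 2

end Study

/-- Condition on the kernel. The last two fields hold for every kernel of bounded support which
satisfies the others. -/
structure KernelCond (K : ℝ → ℝ) : Prop where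
  measurable : Measurable K
  nonneg : ∀ z, 0 ≤ K z
  symm : ∀ z, K (-z) = K z
  integrable : Integrable K
  integral_eq_one : ∫ z, K z = 1
  first_moment : ∫ z, z * K z = 0
  second_moment : Integrable fun z => z ^ 2 * K z
  sq_integrable : Integrable fun z => K z ^ 2
  third_moment : Integrable fun z => |z| ^ 3 * K z
  sq_second_moment : Integrable fun z => z ^ 2 * K z ^ 2

/-- Condition on the bandwidths: `n h_n → ∞` and `n h_n⁵ → 0`. -/
structure BandwidthCond (h : ℕ → ℝ) : Prop where
  pos : ∀ n, 0 < h n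
  tendsto_atTop : Tendsto (fun n : ℕ => (n : ℝ) * h n) atTop atTop
  tendsto_zero : Tendsto (fun n : ℕ => (n : ℝ) * h n ^ 5) atTop (𝓝 0)

end VaryingCoef

end

/-! The minimizer solves normal equations. With covariates centred at `E X(t)`, time measured in
units of `h`, and the true value with its first-order Taylor coefficients subtracted, they read `G_n
x = S_n + B_n`. Here the slope part of `x` is `√(nh) (β̂ - β₀(t))`, `G_n` is a Gram matrix averaged
over subjects, `S_n` is a normalized sum of design times residual, and `B_n` comes from the
second-order Taylor remainder (`exists_gram_mulVec_sub_score_le`).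

Orthogonality enters once: conditionally on `X(s)` alone, the term `Z(s)ᵀγ₀(s)` averages to the
intercept `α(s)`. Hence the residual `ε(s)` has conditional mean zero given `X(s)`, and the score is
centred.

`G_n` converges in `L¹` to the Kronecker product of the block matrix `diag(λ, A)` with the moment
matrix of `K`, which is diagonal because `∫ z K = 0`. The slope rows of the limit therefore involve
`A` and the slope error only. `B_n` has `L¹` size `O(√(nh⁵))` and vanishes. In the score, `X(s) - E
X(t)` is `X̃(s)` plus the change of the mean. The first part obeys a central limit theorem with
covariance `Σ`; the second has a second moment tending to zero. So `√(nh) (β̂ - β₀)` behaves like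
`A⁻¹` times an asymptotically `N(0, Σ)` vector.

The probabilistic engine is a point process with an independent mark (`IsMarked`): the observation
times of a subject, marked by the path of `(X, Y)`. By Campbell's formula a sum over the points in a
window of width `h` has expectation of order `h`; by the bounded joint intensity, pairs of different
points contribute only order `h²`. Dependence within a subject thus disappears from the limit.
Truncation of kernel and marks gives the law of large numbers
`tendsto_integral_abs_average_kernelSum_sub` and, through Lindeberg's condition, the central limit
theorem `tendsto_integral_cexp_kernelSum`.

Everything is assembled on characteristic functions. `abs_mulVec_sub_le` replaces `G_n` by its limit
without inverting `G_n`, so uniqueness of the minimizer plays no role.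
`tendsto_integral_cexp_of_abs_sub_le` shows that the resulting errors, small in probability, do not
change the limit. -/

noncomputable section

namespace VaryingCoef

/-! ### Lindeberg's theorem and a weak law for arrays with independent rows. -/

section Probability

/-- Telescoping: the factors are exchanged one at a time, all the others having modulus at most one.
-/
lemma norm_prod_sub_pow_le (n : ℕ) (a : ℕ → ℂ) (w : ℂ) (ha : ∀ i, ‖a i‖ ≤ 1) (hw : ‖w‖ ≤ 1) :
    ‖∏ i ∈ Finset.range n, a i - w ^ n‖ ≤ ∑ i ∈ Finset.range n, ‖a i - w‖ := by
  induction n with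
  | zero => simp
  | succ n ih =>
    rw [Finset.prod_range_succ, Finset.sum_range_succ, pow_succ]
    have e : (∏ i ∈ Finset.range n, a i) * a n - w ^ n * w
        = ((∏ i ∈ Finset.range n, a i) - w ^ n) * a n + w ^ n * (a n - w) := by ring
    rw [e]
    refine (norm_add_le _ _).trans (add_le_add ?_ ?_)
    · rw [norm_mul]
      exact (mul_le_of_le_one_right (norm_nonneg _) (ha n)).trans ih
    · rw [norm_mul, norm_pow]
      exact mul_le_of_le_one_left (norm_nonneg _) (pow_le_one₀ (norm_nonneg _) hw)

/-- Taylor's cubic remainder serves for `|y| ≤ 1`, the triangle inequality for `|y| > 1`. The form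
`y² min(1, |y|)` is the one on which Lindeberg's truncation acts; the constant is not sharp. -/
lemma norm_cexp_mul_I_sub_le (y : ℝ) :
    ‖Complex.exp (y * Complex.I) - (1 + y * Complex.I - (y ^ 2 / 2 : ℝ))‖
      ≤ 4 * (y ^ 2 * min 1 |y|) := by
  rcases le_or_gt |y| 1 with hy | hy
  · have h1 : ‖(y : ℂ) * Complex.I‖ ≤ 1 := by simpa using hy
    have h2 := Complex.exp_bound h1 (n := 3) (by norm_num)
    have e : ∑ m ∈ Finset.range 3, ((y : ℂ) * Complex.I) ^ m / (m.factorial : ℂ)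
        = 1 + y * Complex.I - (y ^ 2 / 2 : ℝ) := by
      simp [Finset.sum_range_succ, Nat.factorial, mul_pow]
      ring
    rw [e] at h2
    refine h2.trans ?_
    rw [min_eq_right hy]
    have e2 : ‖(y : ℂ) * Complex.I‖ = |y| := by simp
    rw [e2]
    have : y ^ 2 * |y| = |y| ^ 3 := by rw [← sq_abs]; ring
    rw [this]
    have h3 : 0 ≤ |y| ^ 3 := by positivity
    norm_num [Nat.factorial]
    nlinarith
  · rw [min_eq_left hy.le]
    have h1 : ‖Complex.exp (y * Complex.I)‖ = 1 := Complex.norm_exp_ofReal_mul_I y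
    have h2 : ‖(1 + y * Complex.I - (y ^ 2 / 2 : ℝ) : ℂ)‖ ≤ 1 + |y| + y ^ 2 / 2 := by
      refine (norm_sub_le _ _).trans (add_le_add ((norm_add_le _ _).trans ?_) ?_)
      · simp
      · rw [Complex.norm_real, Real.norm_of_nonneg (by positivity)]
    refine (norm_sub_le _ _).trans ?_
    rw [h1]
    have h4 : |y| ^ 2 = y ^ 2 := sq_abs y
    nlinarith

variable {Ω : Type*} [MeasurableSpace Ω] {P : Measure Ω} [IsProbabilityMeasure P]

/-- The remainder is split at `|ζ| = δ b`: below this level the minimum yields a factor `δ`, above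
it the Lindeberg integral is left. With `b = √n` the error per summand is a small multiple of `1/n`,
so that `n` summands can be afforded. -/
lemma norm_integral_cexp_sub_le {ζ : Ω → ℝ} (hL2 : MemLp ζ 2 P) (h0 : ∫ ω, ζ ω ∂P = 0)
    {v δ η b : ℝ} (hδ : 0 < δ) (hb : 0 < b) (hv : |∫ ω, ζ ω ^ 2 ∂P - v| ≤ η)
    (hlin : ∫ ω, {ω | δ ^ 2 * b ^ 2 < ζ ω ^ 2}.indicator (fun ω => ζ ω ^ 2) ω ∂P ≤ η) :
    ‖∫ ω, Complex.exp ((b⁻¹ * ζ ω : ℝ) * Complex.I) ∂P - (1 - (v / (2 * b ^ 2) : ℝ))‖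
      ≤ (4 * (δ * (v + η) + η) + η) / b ^ 2 := by
  have hi : Integrable ζ P := hL2.integrable (by norm_num)
  have hi2 : Integrable (fun ω => ζ ω ^ 2) P := hL2.integrable_sq
  have hset : NullMeasurableSet {ω | δ ^ 2 * b ^ 2 < ζ ω ^ 2} P :=
    nullMeasurableSet_lt aemeasurable_const (hi.aemeasurable.pow_const 2)
  have hii : Integrable ({ω | δ ^ 2 * b ^ 2 < ζ ω ^ 2}.indicator (fun ω => ζ ω ^ 2)) P :=
    hi2.indicator₀ hset
  have hexp : Integrable (fun ω => Complex.exp ((b⁻¹ * ζ ω : ℝ) * Complex.I)) P := by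
    refine Integrable.of_bound (C := 1) ?_ (ae_of_all _ fun ω => ?_)
    · have := hi.aemeasurable
      exact (by fun_prop : AEMeasurable
        (fun ω => Complex.exp ((b⁻¹ * ζ ω : ℝ) * Complex.I)) P).aestronglyMeasurable
    · exact (Complex.norm_exp_ofReal_mul_I _).le
  have hI1 : Integrable (fun ω => (1 : ℂ) + (b⁻¹ * ζ ω : ℝ) * Complex.I
      - (((b⁻¹ * ζ ω) ^ 2 / 2 : ℝ) : ℂ)) P := by
    refine ((integrable_const _).add ?_).sub ?_
    · exact ((hi.const_mul b⁻¹).ofReal (𝕜 := ℂ)).mul_const _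
    · simp only [mul_pow]
      exact (((hi2.const_mul _).div_const 2).ofReal (𝕜 := ℂ))
  have hint : ∫ ω, ((1 : ℂ) + (b⁻¹ * ζ ω : ℝ) * Complex.I
      - (((b⁻¹ * ζ ω) ^ 2 / 2 : ℝ) : ℂ)) ∂P
      = 1 - (((∫ ω, ζ ω ^ 2 ∂P) / (2 * b ^ 2) : ℝ) : ℂ) := by
    rw [integral_sub, integral_add, integral_mul_const, integral_complex_ofReal,
      integral_complex_ofReal, integral_const_mul, h0]
    · simp only [mul_pow]
      rw [integral_div, integral_const_mul]
      simp
      field_simp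
    · exact integrable_const _
    · exact ((hi.const_mul b⁻¹).ofReal (𝕜 := ℂ)).mul_const _
    · exact (integrable_const _).add (((hi.const_mul b⁻¹).ofReal (𝕜 := ℂ)).mul_const _)
    · simp only [mul_pow]
      exact (((hi2.const_mul _).div_const 2).ofReal (𝕜 := ℂ))
  have h1 : ‖∫ ω, Complex.exp ((b⁻¹ * ζ ω : ℝ) * Complex.I) ∂P
      - (1 - (((∫ ω, ζ ω ^ 2 ∂P) / (2 * b ^ 2) : ℝ) : ℂ))‖
      ≤ 4 * (δ * (v + η) + η) / b ^ 2 := by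
    rw [← hint, ← integral_sub hexp hI1]
    have hmaj : Integrable (fun ω => 4 / b ^ 2 * (δ * ζ ω ^ 2
        + {ω | δ ^ 2 * b ^ 2 < ζ ω ^ 2}.indicator (fun ω => ζ ω ^ 2) ω)) P :=
      ((hi2.const_mul δ).add hii).const_mul _
    refine (norm_integral_le_of_norm_le hmaj (ae_of_all _ fun ω => ?_)).trans ?_
    · refine (norm_cexp_mul_I_sub_le _).trans ?_
      have e : 4 * ((b⁻¹ * ζ ω) ^ 2 * min 1 |b⁻¹ * ζ ω|)
          = 4 / b ^ 2 * (ζ ω ^ 2 * min 1 |b⁻¹ * ζ ω|) := by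
        rw [mul_pow]; field_simp
      rw [e]
      refine mul_le_mul_of_nonneg_left ?_ (by positivity)
      by_cases hω : δ ^ 2 * b ^ 2 < ζ ω ^ 2
      · rw [Set.indicator_of_mem (show ω ∈ {ω | δ ^ 2 * b ^ 2 < ζ ω ^ 2} from hω)]
        have : ζ ω ^ 2 * min 1 |b⁻¹ * ζ ω| ≤ ζ ω ^ 2 :=
          mul_le_of_le_one_right (sq_nonneg _) (min_le_left _ _)
        have h2 : 0 ≤ δ * ζ ω ^ 2 := by positivity
        linarith
      · rw [Set.indicator_of_notMem (show ω ∉ {ω | δ ^ 2 * b ^ 2 < ζ ω ^ 2} from hω), add_zero,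
          mul_comm δ]
        refine mul_le_mul_of_nonneg_left ((min_le_right _ _).trans ?_) (sq_nonneg _)
        rw [not_lt, ← mul_pow] at hω
        have := abs_le_of_sq_le_sq hω (by positivity)
        rw [abs_mul, abs_of_pos (inv_pos.2 hb), inv_mul_le_iff₀ hb, mul_comm b]
        exact this
    · rw [integral_const_mul, integral_add (hi2.const_mul δ) hii, integral_const_mul]
      have h3 : ∫ ω, ζ ω ^ 2 ∂P ≤ v + η := by linarith [(abs_le.1 hv).2]
      have h4 : δ * ∫ ω, ζ ω ^ 2 ∂P ≤ δ * (v + η) := mul_le_mul_of_nonneg_left h3 hδ.le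
      rw [div_mul_eq_mul_div]
      gcongr
  have h2 : ‖(1 - (((∫ ω, ζ ω ^ 2 ∂P) / (2 * b ^ 2) : ℝ) : ℂ)) - (1 - (v / (2 * b ^ 2) : ℝ))‖
      ≤ η / b ^ 2 := by
    have e : (1 - (((∫ ω, ζ ω ^ 2 ∂P) / (2 * b ^ 2) : ℝ) : ℂ)) - (1 - (v / (2 * b ^ 2) : ℝ))
        = ((-((∫ ω, ζ ω ^ 2 ∂P) - v) / (2 * b ^ 2) : ℝ) : ℂ) := by
      push_cast; ring
    rw [e, Complex.norm_real, Real.norm_eq_abs, abs_div, abs_neg,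
      abs_of_pos (show (0 : ℝ) < 2 * b ^ 2 by positivity)]
    have hη : 0 ≤ η := (abs_nonneg _).trans hv
    rw [div_le_div_iff₀ (by positivity) (by positivity)]
    nlinarith [sq_nonneg b, mul_nonneg hη (sq_nonneg b), mul_le_mul_of_nonneg_right hv (sq_nonneg b)]
  calc _ ≤ _ := norm_sub_le_norm_sub_add_norm_sub _
        (1 - (((∫ ω, ζ ω ^ 2 ∂P) / (2 * b ^ 2) : ℝ) : ℂ)) _
    _ ≤ 4 * (δ * (v + η) + η) / b ^ 2 + η / b ^ 2 := add_le_add h1 h2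
    _ = _ := by ring

/-- **Lindeberg's central limit theorem** for arrays with independent rows, in terms of
characteristic functions; the Lindeberg condition is uniform over the row. -/
theorem tendsto_integral_cexp_of_lindeberg {ζ : ℕ → ℕ → Ω → ℝ} {v : ℝ} (hv0 : 0 ≤ v)
    (hind : ∀ n, iIndepFun (ζ n) P) (hL2 : ∀ n i, MemLp (ζ n i) 2 P)
    (h0 : ∀ n i, ∫ ω, ζ n i ω ∂P = 0)
    (hv : ∀ η > 0, ∀ᶠ n in atTop, ∀ i, |∫ ω, ζ n i ω ^ 2 ∂P - v| ≤ η)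
    (hlin : ∀ η > 0, ∀ c > 0, ∀ᶠ n : ℕ in atTop, ∀ i,
      ∫ ω, {ω | c * n < ζ n i ω ^ 2}.indicator (fun ω => ζ n i ω ^ 2) ω ∂P ≤ η) :
    Tendsto (fun n : ℕ => ∫ ω, Complex.exp
      ((((√(n : ℝ))⁻¹ * ∑ i ∈ Finset.range n, ζ n i ω : ℝ) : ℂ) * Complex.I) ∂P) atTop
      (𝓝 (Complex.exp ((-v / 2 : ℝ) : ℂ))) := by
  rw [Metric.tendsto_atTop']
  intro ε hε
  -- The total error is `4 δ (v + η) + 5 η + v² / (4 n)`; the choices of `η`, `δ` and of a large `n`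
  -- bound the three parts by `ε/5`, `ε/4` and `ε/4`.
  set η : ℝ := min 1 (ε / 20) with hη
  have hη0 : 0 < η := by positivity
  set δ : ℝ := ε / (20 * (v + 1)) with hδ
  have hδ0 : 0 < δ := by positivity
  obtain ⟨n₁, hn₁⟩ := eventually_atTop.1 ((hv η hη0).and ((hlin η hη0 (δ ^ 2) (by positivity))))
  obtain ⟨n₂, hn₂⟩ := exists_nat_gt (max v (v ^ 2 / ε + 1))
  refine ⟨max n₁ n₂, fun n hn => ?_⟩
  obtain ⟨hvn, hln⟩ := hn₁ n ((le_max_left _ _).trans hn.le)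
  have hnn : max v (v ^ 2 / ε + 1) < (n : ℝ) :=
    hn₂.trans (by exact_mod_cast (le_max_right n₁ n₂).trans_lt hn)
  have hnv : v < n := (le_max_left _ _).trans_lt hnn
  have hnv2 : v ^ 2 / ε < n := by linarith [(le_max_right v (v ^ 2 / ε + 1)).trans_lt hnn]
  have hnpos : (0 : ℝ) < n := hv0.trans_lt hnv
  set b : ℝ := √(n : ℝ)
  have hb : 0 < b := Real.sqrt_pos.2 hnpos
  have hb2 : b ^ 2 = n := Real.sq_sqrt hnpos.le
  set φ : ℕ → ℂ := fun i => ∫ ω, Complex.exp ((b⁻¹ * ζ n i ω : ℝ) * Complex.I) ∂P with hφ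
  set w : ℂ := Complex.exp ((-(v / (2 * n)) : ℝ) : ℂ) with hw
  have hprod : ∫ ω, Complex.exp
      (((b⁻¹ * ∑ i ∈ Finset.range n, ζ n i ω : ℝ) : ℂ) * Complex.I) ∂P
      = ∏ i ∈ Finset.range n, φ i := by
    have hind' : iIndepFun (fun i : Fin n => ζ n i) P :=
      (hind n).precomp (g := fun i : Fin n => (i : ℕ)) Fin.val_injective
    have := hind'.integral_fun_prod_comp
      (f := fun _ x => Complex.exp ((b⁻¹ * x : ℝ) * Complex.I))
      (fun i => (hL2 n i).aestronglyMeasurable.aemeasurable)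
      (fun i => by fun_prop)
    rw [Finset.prod_range, ← this]
    refine integral_congr_ae (ae_of_all _ fun ω => ?_)
    simp only [← Complex.exp_sum, Finset.sum_range]
    push_cast
    rw [Finset.mul_sum, Finset.sum_mul]
  have hwn : w ^ n = Complex.exp ((-v / 2 : ℝ) : ℂ) := by
    rw [hw, ← Complex.exp_nat_mul]
    congr 1
    push_cast
    have : (n : ℂ) ≠ 0 := by exact_mod_cast hnpos.ne'
    field_simp
  have hφ1 : ∀ i, ‖φ i‖ ≤ 1 := fun i => by
    refine (norm_integral_le_of_norm_le_const (C := 1) (ae_of_all _ fun ω => ?_)).trans (by simp)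
    exact (Complex.norm_exp_ofReal_mul_I _).le
  have hw1 : ‖w‖ ≤ 1 := by
    rw [hw, Complex.norm_exp_ofReal, Real.exp_le_one_iff]
    have : 0 ≤ v / (2 * n) := by positivity
    linarith
  have hwb : ‖(1 - (v / (2 * b ^ 2) : ℝ) : ℂ) - w‖ ≤ (v ^ 2 / (4 * n)) / n := by
    have hx : |(-(v / (2 * n)))| ≤ 1 := by
      rw [abs_neg, abs_of_nonneg (by positivity), div_le_one (by positivity)]
      linarith
    have h1 := Real.abs_exp_sub_one_sub_id_le hx
    have e : (1 - (v / (2 * b ^ 2) : ℝ) : ℂ) - w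
        = ((-(Real.exp (-(v / (2 * n))) - 1 - -(v / (2 * n))) : ℝ) : ℂ) := by
      rw [hw, hb2]; push_cast; ring
    rw [e, Complex.norm_real, Real.norm_eq_abs, abs_neg]
    refine h1.trans (le_of_eq ?_)
    field_simp
    norm_num
  have hterm : ∀ i, ‖φ i - w‖ ≤ ((4 * (δ * (v + η) + η) + η) + v ^ 2 / (4 * n)) / n := fun i => by
    have h1 := norm_integral_cexp_sub_le (hL2 n i) (h0 n i) hδ0 hb (hvn i)
      (by rw [hb2]; exact hln i)
    refine (norm_sub_le_norm_sub_add_norm_sub _ (1 - (v / (2 * b ^ 2) : ℝ) : ℂ) _).trans ?_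
    rw [add_div]
    refine add_le_add ?_ hwb
    rw [← hb2]
    exact h1
  rw [dist_eq_norm, hprod, ← hwn]
  refine (norm_prod_sub_pow_le n φ w hφ1 hw1).trans_lt ?_
  calc ∑ i ∈ Finset.range n, ‖φ i - w‖
      ≤ ∑ i ∈ Finset.range n, ((4 * (δ * (v + η) + η) + η) + v ^ 2 / (4 * n)) / n :=
        Finset.sum_le_sum fun i _ => hterm i
    _ = (4 * (δ * (v + η) + η) + η) + v ^ 2 / (4 * n) := by
        rw [Finset.sum_const, Finset.card_range, nsmul_eq_mul]; field_simp
    _ < ε := by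
        have h1 : δ * (v + η) ≤ ε / 20 := by
          calc δ * (v + η) ≤ δ * (v + 1) := by gcongr; exact min_le_left _ _
            _ = ε / 20 := by rw [hδ]; field_simp
        have h2 : η ≤ ε / 20 := min_le_right _ _
        have h3 : v ^ 2 / (4 * n) < ε / 4 := by
          rw [div_lt_iff₀ hε] at hnv2
          rw [div_lt_div_iff₀ (by positivity) (by norm_num)]
          linarith
        linarith

lemma integral_abs_le_sqrt_integral_sq {Y : Ω → ℝ} (hY : MemLp Y 2 P) :
    ∫ ω, |Y ω| ∂P ≤ √(∫ ω, Y ω ^ 2 ∂P) := by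
  refine Real.le_sqrt_of_sq_le ?_
  have h1 : MemLp (fun ω => |Y ω|) 2 P := hY.abs
  have h2 := variance_nonneg (fun ω => |Y ω|) P
  rw [variance_eq_sub h1] at h2
  have e : ∫ ω, ((fun ω => |Y ω|) ^ 2) ω ∂P = ∫ ω, Y ω ^ 2 ∂P := by
    refine integral_congr_ae (ae_of_all _ fun ω => ?_)
    simp
  rw [e] at h2
  linarith

lemma integral_sum_sq_eq {ζ : ℕ → Ω → ℝ} (hind : iIndepFun ζ P) (hL2 : ∀ i, MemLp (ζ i) 2 P)
    (h0 : ∀ i, ∫ ω, ζ i ω ∂P = 0) (n : ℕ) :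
    ∫ ω, (∑ i ∈ Finset.range n, ζ i ω) ^ 2 ∂P
      = ∑ i ∈ Finset.range n, ∫ ω, ζ i ω ^ 2 ∂P := by
  have hs : MemLp (fun ω => ∑ i ∈ Finset.range n, ζ i ω) 2 P := memLp_finsetSum _ fun i _ => hL2 i
  have hm : ∫ ω, ∑ i ∈ Finset.range n, ζ i ω ∂P = 0 := by
    rw [integral_finsetSum _ fun i _ => (hL2 i).integrable (by norm_num)]
    simp [h0]
  rw [← variance_of_integral_eq_zero hs.aestronglyMeasurable.aemeasurable hm]
  have := IndepFun.variance_sum (μ := P) (X := ζ) (s := Finset.range n) (fun i _ => hL2 i)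
    (fun i _ j _ hij => hind.indepFun hij)
  have e : (∑ i ∈ Finset.range n, ζ i) = fun ω => ∑ i ∈ Finset.range n, ζ i ω := by
    ext ω; simp
  rw [e] at this
  rw [this]
  exact Finset.sum_congr rfl fun i _ =>
    variance_of_integral_eq_zero (hL2 i).aestronglyMeasurable.aemeasurable (h0 i)

/-- A weak law of large numbers, in `L¹`, for arrays with independent rows whose entries are close
in `L¹` to square-integrable ones with second moments of smaller order than the row length. -/
theorem tendsto_integral_abs_average_sub {ξ : ℕ → ℕ → Ω → ℝ} {l : ℝ}
    (hint : ∀ n i, Integrable (ξ n i) P)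
    (happrox : ∀ η > 0, ∃ ξ' : ℕ → ℕ → Ω → ℝ, (∀ n, iIndepFun (ξ' n) P) ∧
      (∀ n i, MemLp (ξ' n i) 2 P) ∧ ∀ᶠ n : ℕ in atTop, ∀ i,
        ∫ ω, |ξ n i ω - ξ' n i ω| ∂P ≤ η ∧ |∫ ω, ξ n i ω ∂P - l| ≤ η ∧
          ∫ ω, ξ' n i ω ^ 2 ∂P ≤ η * n) :
    Tendsto (fun n : ℕ => ∫ ω, |(n : ℝ)⁻¹ * ∑ i ∈ Finset.range n, ξ n i ω - l| ∂P) atTop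
      (𝓝 0) := by
  rw [Metric.tendsto_atTop']
  intro ε hε
  -- The square is for the fluctuations: a second moment `n · (η n)` of the centred sum gives a
  -- first moment at most `n √η ≤ n ε / 8`. Approximation, fluctuation and the two errors of the
  -- means add up to `ε / 2`.
  set η : ℝ := min (ε / 8) ((ε / 8) ^ 2) with hη
  have hη0 : 0 < η := by positivity
  obtain ⟨ξ', hind, hL2, hev⟩ := happrox η hη0
  obtain ⟨n₁, hn₁⟩ := eventually_atTop.1 hev
  refine ⟨n₁, fun n hn => ?_⟩
  have hnpos : (0 : ℝ) < n := by exact_mod_cast (Nat.zero_le _).trans_lt hn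
  have H := hn₁ n hn.le
  rw [Real.dist_eq, sub_zero, abs_of_nonneg (integral_nonneg fun _ => abs_nonneg _)]
  set m : ℕ → ℝ := fun i => ∫ ω, ξ' n i ω ∂P
  have hint' : ∀ i, Integrable (ξ' n i) P := fun i => (hL2 n i).integrable (by norm_num)
  set S : Ω → ℝ := fun ω => ∑ i ∈ Finset.range n, (ξ' n i ω - m i)
  have hcL2 : ∀ i, MemLp (fun ω => ξ' n i ω - m i) 2 P := fun i => (hL2 n i).sub (memLp_const _)
  have hSL2 : MemLp S 2 P := memLp_finsetSum _ fun i _ => hcL2 i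
  have hcind : iIndepFun (fun i ω => ξ' n i ω - m i) P :=
    (hind n).comp (fun i x => x - m i) fun i => measurable_id.sub_const _
  have hc0 : ∀ i, ∫ ω, (ξ' n i ω - m i) ∂P = 0 := fun i => by
    rw [integral_sub (hint' i) (integrable_const _)]; simp [m]
  have hS2 : ∫ ω, S ω ^ 2 ∂P ≤ n * (η * n) := by
    rw [integral_sum_sq_eq hcind hcL2 hc0 n]
    refine (Finset.sum_le_sum fun i _ => ?_).trans (b := ∑ i ∈ Finset.range n, η * n) (by simp)
    rw [← variance_eq_integral (hL2 n i).aestronglyMeasurable.aemeasurable]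
    exact (variance_le_expectation_sq (hL2 n i).aestronglyMeasurable).trans (H i).2.2
  have hS1 : ∫ ω, |S ω| ∂P ≤ n * (ε / 8) := by
    refine (integral_abs_le_sqrt_integral_sq hSL2).trans ?_
    rw [Real.sqrt_le_iff]
    refine ⟨by positivity, hS2.trans ?_⟩
    have : η ≤ (ε / 8) ^ 2 := min_le_right _ _
    calc n * (η * n) = (n : ℝ) ^ 2 * η := by ring
      _ ≤ (n : ℝ) ^ 2 * (ε / 8) ^ 2 := by gcongr
      _ = _ := by ring
  have hm : ∀ i, |m i - l| ≤ 2 * (ε / 8) := fun i => by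
    have h1 : |m i - ∫ ω, ξ n i ω ∂P| ≤ η := by
      rw [abs_sub_comm, ← integral_sub (hint n i) (hint' i)]
      exact (abs_integral_le_integral_abs).trans (H i).1
    have h2 : η ≤ ε / 8 := min_le_left _ _
    have := abs_sub_le (m i) (∫ ω, ξ n i ω ∂P) l
    linarith [(H i).2.1]
  have hpt : ∀ ω, |(n : ℝ)⁻¹ * ∑ i ∈ Finset.range n, ξ n i ω - l|
      ≤ (n : ℝ)⁻¹ * (∑ i ∈ Finset.range n, |ξ n i ω - ξ' n i ω| + |S ω|) + 2 * (ε / 8) := by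
    intro ω
    have e : (n : ℝ)⁻¹ * ∑ i ∈ Finset.range n, ξ n i ω - l
        = (n : ℝ)⁻¹ * (∑ i ∈ Finset.range n, (ξ n i ω - ξ' n i ω) + S ω)
          + (n : ℝ)⁻¹ * ∑ i ∈ Finset.range n, (m i - l) := by
      simp only [S, Finset.sum_sub_distrib, Finset.sum_const, Finset.card_range, nsmul_eq_mul]
      field_simp
      ring
    rw [e]
    refine (abs_add_le _ _).trans (add_le_add ?_ ?_)
    · rw [abs_mul, abs_of_pos (inv_pos.2 hnpos)]
      gcongr
      exact (abs_add_le _ _).trans (add_le_add (Finset.abs_sum_le_sum_abs _ _) le_rfl)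
    · rw [abs_mul, abs_of_pos (inv_pos.2 hnpos), inv_mul_le_iff₀ hnpos]
      refine (Finset.abs_sum_le_sum_abs _ _).trans ((Finset.sum_le_sum fun i _ => hm i).trans ?_)
      simp
  have hd : ∀ i, Integrable (fun ω => |ξ n i ω - ξ' n i ω|) P :=
    fun i => ((hint n i).sub (hint' i)).abs
  have hSi : Integrable (fun ω => |S ω|) P := (hSL2.integrable (by norm_num)).abs
  have hsum : Integrable (fun ω => ∑ i ∈ Finset.range n, |ξ n i ω - ξ' n i ω|) P :=
    integrable_finsetSum _ fun i _ => hd i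
  have hl : Integrable (fun ω => |(n : ℝ)⁻¹ * ∑ i ∈ Finset.range n, ξ n i ω - l|) P :=
    (((integrable_finsetSum _ fun i _ => hint n i).const_mul _).sub (integrable_const _)).abs
  have hmono := integral_mono hl
    (((hsum.add hSi).const_mul ((n : ℝ)⁻¹)).add (integrable_const (2 * (ε / 8)))) hpt
  refine hmono.trans_lt ?_
  have hval : ∫ ω, ((n : ℝ)⁻¹ * (∑ i ∈ Finset.range n, |ξ n i ω - ξ' n i ω| + |S ω|)
      + 2 * (ε / 8)) ∂P
      = (n : ℝ)⁻¹ * (∑ i ∈ Finset.range n, ∫ ω, |ξ n i ω - ξ' n i ω| ∂P + ∫ ω, |S ω| ∂P)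
        + 2 * (ε / 8) := by
    have hc : Integrable (fun ω => (n : ℝ)⁻¹ *
        (∑ i ∈ Finset.range n, |ξ n i ω - ξ' n i ω| + |S ω|)) P := (hsum.add hSi).const_mul _
    rw [integral_add hc (integrable_const _), integral_const_mul,
      integral_add hsum hSi, integral_finsetSum _ fun i _ => hd i]
    simp
  have hle : (n : ℝ)⁻¹ * (∑ i ∈ Finset.range n, ∫ ω, |ξ n i ω - ξ' n i ω| ∂P + ∫ ω, |S ω| ∂P)
      ≤ ε / 8 + ε / 8 := by
    rw [inv_mul_le_iff₀ hnpos, mul_add]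
    refine add_le_add ((Finset.sum_le_sum fun i _ => (H i).1.trans (min_le_left _ _)).trans ?_) hS1
    simp
  calc _ = _ := hval
    _ < ε := by linarith

end Probability

/-! ### Point measures, Campbell's formula and marked point processes. -/

section PointProcess

/-- The point measure of the points `τ 0, …, τ (n - 1)`. -/
def pointMeasure (n : ℕ) (τ : ℕ → ℝ) : Measure ℝ :=
  ∑ j ∈ Finset.range n, Measure.dirac (τ j)

/-- The point measure of the pairs of points with different indices. -/
def pairMeasure (n : ℕ) (τ : ℕ → ℝ) : Measure (ℝ × ℝ) :=
  ∑ j ∈ Finset.range n, ∑ k ∈ (Finset.range n).erase j, Measure.dirac (τ j, τ k)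

instance (n : ℕ) (τ : ℕ → ℝ) : IsFiniteMeasure (pointMeasure n τ) := by
  unfold pointMeasure; infer_instance

instance (n : ℕ) (τ : ℕ → ℝ) : IsFiniteMeasure (pairMeasure n τ) := by
  unfold pairMeasure; infer_instance

lemma lintegral_pointMeasure (n : ℕ) (τ : ℕ → ℝ) {g : ℝ → ℝ≥0∞} (hg : Measurable g) :
    ∫⁻ s, g s ∂(pointMeasure n τ) = ∑ j ∈ Finset.range n, g (τ j) := by
  rw [pointMeasure, lintegral_finsetSum_measure]
  exact Finset.sum_congr rfl fun j _ => lintegral_dirac' _ hg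

lemma lintegral_pairMeasure (n : ℕ) (τ : ℕ → ℝ) {g : ℝ × ℝ → ℝ≥0∞} (hg : Measurable g) :
    ∫⁻ s, g s ∂(pairMeasure n τ)
      = ∑ j ∈ Finset.range n, ∑ k ∈ (Finset.range n).erase j, g (τ j, τ k) := by
  simp only [pairMeasure, lintegral_finsetSum_measure]
  exact Finset.sum_congr rfl fun j _ => Finset.sum_congr rfl fun k _ => lintegral_dirac' _ hg

lemma pointMeasure_apply (n : ℕ) (τ : ℕ → ℝ) {B : Set ℝ} (hB : MeasurableSet B) :
    pointMeasure n τ B = ∑ j ∈ Finset.range n, B.indicator 1 (τ j) := by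
  rw [← lintegral_indicator_one hB, lintegral_pointMeasure _ _ (measurable_one.indicator hB)]

/-- The pairs with equal indices lie on the diagonal, which a rectangle meets above `A ∩ B`.
Consequently the pair measure is a function of the point measure, and inherits its measurability and
independence. -/
lemma pairMeasure_prod_add (n : ℕ) (τ : ℕ → ℝ) {A B : Set ℝ} (hA : MeasurableSet A)
    (hB : MeasurableSet B) :
    pairMeasure n τ (A ×ˢ B) + pointMeasure n τ (A ∩ B)
      = pointMeasure n τ A * pointMeasure n τ B := by
  rw [← lintegral_indicator_one (hA.prod hB),
    lintegral_pairMeasure _ _ (measurable_one.indicator (hA.prod hB)),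
    pointMeasure_apply _ _ hA, pointMeasure_apply _ _ hB, pointMeasure_apply _ _ (hA.inter hB),
    Finset.sum_mul_sum, ← Finset.sum_add_distrib]
  refine Finset.sum_congr rfl fun j hj => ?_
  rw [← Finset.add_sum_erase _ _ hj, add_comm]
  congr 1
  · by_cases h1 : τ j ∈ A <;> by_cases h2 : τ j ∈ B <;> simp [h1, h2]
  · refine Finset.sum_congr rfl fun k _ => ?_
    by_cases h1 : τ j ∈ A <;> by_cases h2 : τ k ∈ B <;> simp [h1, h2]

lemma pairMeasure_prod (n : ℕ) (τ : ℕ → ℝ) {A B : Set ℝ} (hA : MeasurableSet A)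
    (hB : MeasurableSet B) :
    pairMeasure n τ (A ×ˢ B)
      = pointMeasure n τ A * pointMeasure n τ B - pointMeasure n τ (A ∩ B) := by
  rw [← pairMeasure_prod_add n τ hA hB]
  exact (ENNReal.add_sub_cancel_right (measure_ne_top _ _)).symm

/-- Half-lines are a generating π-system, and they are the sets whose mass is a value of the
counting process. The total mass is the supremum of their masses. -/
lemma measurable_pointMeasure {Ω : Type*} [MeasurableSpace Ω] {L : Ω → ℕ} {T : ℕ → Ω → ℝ}
    (h : ∀ x, Measurable fun ω => pointMeasure (L ω) (fun j => T j ω) (Set.Iic x)) :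
    Measurable fun ω => pointMeasure (L ω) (fun j => T j ω) := by
  refine Measurable.measure_of_isPiSystem (borel_eq_generateFrom_Iic ℝ ▸ BorelSpace.measurable_eq)
    isPiSystem_Iic ?_ ?_
  · rintro _ ⟨x, rfl⟩
    exact h x
  · have e : (Set.univ : Set ℝ) = ⋃ n : ℕ, Set.Iic (n : ℝ) := by
      ext x
      simpa using exists_nat_ge x
    have hmono : Monotone fun n : ℕ => Set.Iic (n : ℝ) :=
      fun a b hab => Set.Iic_subset_Iic.2 (by exact_mod_cast hab)
    simp only [e, hmono.measure_iUnion]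
    exact Measurable.iSup fun n => h n

lemma measurable_pairMeasure {Ω : Type*} [MeasurableSpace Ω] {L : Ω → ℕ} {T : ℕ → Ω → ℝ}
    (h : Measurable fun ω => pointMeasure (L ω) (fun j => T j ω)) :
    Measurable fun ω => pairMeasure (L ω) (fun j => T j ω) := by
  have key : ∀ A B : Set ℝ, MeasurableSet A → MeasurableSet B →
      Measurable fun ω => pairMeasure (L ω) (fun j => T j ω) (A ×ˢ B) := fun A B hA hB => by
    simp only [pairMeasure_prod _ _ hA hB]
    exact (((Measure.measurable_coe hA).comp h).mul ((Measure.measurable_coe hB).comp h)).sub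
      ((Measure.measurable_coe (hA.inter hB)).comp h)
  refine Measurable.measure_of_isPiSystem generateFrom_prod.symm isPiSystem_prod ?_ ?_
  · rintro _ ⟨A, hA, B, hB, rfl⟩
    exact key A B hA hB
  · rw [← Set.univ_prod_univ]
    exact key _ _ .univ .univ

/-- Attaching the mark to every point gives one random measure on time × mark from which all sums
over marked points can be recovered; independence between subjects is expressed through it. -/
lemma measurable_map_mk {Ω α E : Type*} [MeasurableSpace Ω] [MeasurableSpace α]
    [MeasurableSpace E] {M : Ω → Measure α} [∀ ω, IsFiniteMeasure (M ω)] {U : Ω → E}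
    (hM : Measurable M) (hU : Measurable U) :
    Measurable fun ω => (M ω).map (fun x => (x, U ω)) := by
  have : ∀ ω, IsFiniteMeasure ((M ω).map (fun x => (x, U ω))) := fun ω => inferInstance
  have key : ∀ (S : Set α) (F : Set E), MeasurableSet S → MeasurableSet F →
      Measurable fun ω => (M ω).map (fun x => (x, U ω)) (S ×ˢ F) := fun S F hS hF => by
    have e : ∀ ω, (M ω).map (fun x => (x, U ω)) (S ×ˢ F)
        = M ω S * F.indicator 1 (U ω) := fun ω => by
      rw [Measure.map_apply (by fun_prop) (hS.prod hF)]
      by_cases h : U ω ∈ F <;> simp [h]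
    simp only [e]
    exact ((Measure.measurable_coe hS).comp hM).mul ((measurable_one.indicator hF).comp hU)
  refine Measurable.measure_of_isPiSystem generateFrom_prod.symm isPiSystem_prod ?_ ?_
  · rintro _ ⟨A, hA, B, hB, rfl⟩
    exact key A B hA hB
  · rw [← Set.univ_prod_univ]
    exact key _ _ .univ .univ

/-- Campbell's formula for a random measure and an independent random element. -/
theorem lintegral_lintegral_of_indepFun {Ω α E : Type*} [MeasurableSpace Ω] {P : Measure Ω}
    [IsProbabilityMeasure P] [MeasurableSpace α] [MeasurableSpace E] {M : Ω → Measure α}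
    [∀ ω, IsFiniteMeasure (M ω)] {U : Ω → E} (hM : Measurable M) (hU : Measurable U)
    (hind : IndepFun M U P) [IsFiniteMeasure (P.bind M)] {g : α → E → ℝ≥0∞}
    (hg : Measurable fun z : α × E => g z.1 z.2) :
    ∫⁻ ω, ∫⁻ x, g x (U ω) ∂(M ω) ∂P = ∫⁻ x, ∫⁻ ω, g x (U ω) ∂P ∂(P.bind M) := by
  have hm := measurable_map_mk hM hU
  have : IsProbabilityMeasure (P.map U) := Measure.isProbabilityMeasure_map hU.aemeasurable
  -- Independence means that the mean measure of the marked points is a product measure; rectangles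
  -- suffice to check this.
  have key : (P.bind M).prod (P.map U) = P.bind fun ω => (M ω).map (fun x => (x, U ω)) := by
    refine Measure.prod_eq fun S F hS hF => ?_
    rw [Measure.bind_apply (hS.prod hF) hm.aemeasurable, Measure.bind_apply hS hM.aemeasurable,
      Measure.map_apply hU hF]
    have e : ∀ ω, (M ω).map (fun x => (x, U ω)) (S ×ˢ F)
        = M ω S * F.indicator 1 (U ω) := fun ω => by
      rw [Measure.map_apply (by fun_prop) (hS.prod hF)]
      by_cases h : U ω ∈ F <;> simp [h]
    simp only [e]
    have hi : IndepFun (fun ω => M ω S) (fun ω => F.indicator (1 : E → ℝ≥0∞) (U ω)) P :=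
      hind.comp (φ := fun μ : Measure α => μ S) (ψ := F.indicator (1 : E → ℝ≥0∞))
        (Measure.measurable_coe hS) (measurable_one.indicator hF)
    have := lintegral_mul_eq_lintegral_mul_lintegral_of_indepFun
      ((Measure.measurable_coe hS).comp hM) ((measurable_one.indicator hF).comp hU) hi
    simp only [Pi.mul_apply, Function.comp_apply] at this
    rw [this]
    congr 1
    rw [← lintegral_indicator_one (hU hF)]
    rfl
  calc ∫⁻ ω, ∫⁻ x, g x (U ω) ∂(M ω) ∂P
      = ∫⁻ ω, ∫⁻ z, g z.1 z.2 ∂((M ω).map (fun x => (x, U ω))) ∂P := by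
        refine lintegral_congr fun ω => ?_
        rw [lintegral_map hg (by fun_prop)]
    _ = ∫⁻ z, g z.1 z.2 ∂((P.bind M).prod (P.map U)) := by
        rw [key, Measure.lintegral_bind hm.aemeasurable hg.aemeasurable]
    _ = ∫⁻ x, ∫⁻ u, g x u ∂(P.map U) ∂(P.bind M) := lintegral_prod _ hg.aemeasurable
    _ = _ := by
        refine lintegral_congr fun x => ?_
        exact lintegral_map (hg.comp (by fun_prop : Measurable fun u => (x, u))) hU

/-- One variable at a time: for fixed `B` the rectangle bound is an inequality between measures in
the first variable, so `A` can be replaced by the function `a`; the measure weighted by `a` is then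
compared in the second variable. -/
lemma lintegral_mul_le_of_prod_le {κ : Measure (ℝ × ℝ)} {C : ℝ≥0} {I : Set ℝ}
    (hκ : ∀ A B : Set ℝ, MeasurableSet A → MeasurableSet B →
      κ (A ×ˢ B) ≤ C * volume (A ∩ I) * volume B)
    {a b : ℝ → ℝ≥0∞} (ha : Measurable a) (hb : Measurable b) :
    ∫⁻ z, a z.1 * b z.2 ∂κ ≤ C * (∫⁻ s in I, a s) * ∫⁻ s, b s := by
  have h1 : ∀ B, MeasurableSet B → ∫⁻ z in Set.univ ×ˢ B, a z.1 ∂κ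
      ≤ C * (∫⁻ s in I, a s) * volume B := fun B hB => by
    have hle : (κ.restrict (Set.univ ×ˢ B)).map Prod.fst
        ≤ (C * volume B) • volume.restrict I := by
      refine Measure.le_iff.2 fun A hA => ?_
      rw [Measure.map_apply measurable_fst hA, Measure.restrict_apply (measurable_fst hA),
        Measure.smul_apply, Measure.restrict_apply hA, smul_eq_mul]
      have e : (Prod.fst ⁻¹' A ∩ Set.univ ×ˢ B : Set (ℝ × ℝ)) = A ×ˢ B := by
        ext z; simp
      rw [e]
      exact (hκ A B hA hB).trans (le_of_eq (by ring))
    calc ∫⁻ z in Set.univ ×ˢ B, a z.1 ∂κ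
        = ∫⁻ s, a s ∂((κ.restrict (Set.univ ×ˢ B)).map Prod.fst) :=
          (lintegral_map ha measurable_fst).symm
      _ ≤ ∫⁻ s, a s ∂((C * volume B) • volume.restrict I) := lintegral_mono' hle le_rfl
      _ = _ := by rw [lintegral_smul_measure, smul_eq_mul]; ring
  have hle : (κ.withDensity fun z => a z.1).map Prod.snd
      ≤ (C * ∫⁻ s in I, a s) • volume := by
    refine Measure.le_iff.2 fun B hB => ?_
    rw [Measure.map_apply measurable_snd hB, withDensity_apply _ (measurable_snd hB),
      Measure.smul_apply, smul_eq_mul, ← Set.univ_prod]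
    exact h1 B hB
  calc ∫⁻ z, a z.1 * b z.2 ∂κ
      = ∫⁻ z, b z.2 ∂(κ.withDensity fun z => a z.1) :=
        (lintegral_withDensity_eq_lintegral_mul _ (by fun_prop) (by fun_prop)).symm
    _ = ∫⁻ s, b s ∂((κ.withDensity fun z => a z.1).map Prod.snd) :=
        (lintegral_map hb measurable_snd).symm
    _ ≤ ∫⁻ s, b s ∂((C * ∫⁻ s in I, a s) • volume) := lintegral_mono' hle le_rfl
    _ = _ := by rw [lintegral_smul_measure, smul_eq_mul]

/-- A marked point process on `[0, 1]`: a random element `U` of `E` and, independently of it,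
random points with the intensity `ℓ` and a joint intensity bounded by `C`. -/
structure IsMarked {Ω E : Type*} [MeasurableSpace Ω] [MeasurableSpace E] (P : Measure Ω)
    (U : Ω → E) (L : Ω → ℕ) (T : ℕ → Ω → ℝ) (ℓ : ℝ → ℝ) (C : ℝ≥0) : Prop where
  measurable_mark : Measurable U
  measurable_points : Measurable fun ω => pointMeasure (L ω) (fun j => T j ω)
  campbell : ∀ g : ℝ → E → ℝ≥0∞, Measurable (fun z : ℝ × E => g z.1 z.2) →
    ∫⁻ ω, ∑ j ∈ Finset.range (L ω), g (T j ω) (U ω) ∂P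
      = ∫⁻ s in Set.Icc (0 : ℝ) 1, ENNReal.ofReal (ℓ s) * ∫⁻ ω, g s (U ω) ∂P
  pair_le : ∀ (a : ℝ → E → ℝ≥0∞) (b : ℝ → ℝ≥0∞), Measurable (fun z : ℝ × E => a z.1 z.2) →
    Measurable b →
    ∫⁻ ω, ∑ j ∈ Finset.range (L ω), ∑ k ∈ (Finset.range (L ω)).erase j,
        a (T j ω) (U ω) * b (T k ω) ∂P
      ≤ C * (∫⁻ s in Set.Icc (0 : ℝ) 1, ∫⁻ ω, a s (U ω) ∂P) * ∫⁻ s, b s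

/-- The counts up to times in `[0, 1]` determine the mean measure on the whole line, because almost
surely there are no points elsewhere. The independent mark is then brought in by Campbell's formula,
applied to the points and to the pairs; for the pairs only an upper bound of the mean measure is
known. -/
theorem isMarked_of_indepFun {Ω E : Type*} [MeasurableSpace Ω] [MeasurableSpace E]
    {P : Measure Ω} [IsProbabilityMeasure P] {U : Ω → E} {L : Ω → ℕ} {T : ℕ → Ω → ℝ}
    {ℓ : ℝ → ℝ} {C : ℝ≥0} (hℓ : ContinuousOn ℓ (Set.Icc 0 1))
    (hℓ0 : ∀ s ∈ Set.Icc (0 : ℝ) 1, 0 ≤ ℓ s) (hU : Measurable U)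
    (hM : Measurable fun ω => pointMeasure (L ω) (fun j => T j ω))
    (hind : IndepFun (fun ω => pointMeasure (L ω) (fun j => T j ω)) U P)
    (hind2 : IndepFun (fun ω => pairMeasure (L ω) (fun j => T j ω)) U P)
    (hT : ∀ᵐ ω ∂P, ∀ j < L ω, T j ω ∈ Set.Icc (0 : ℝ) 1)
    (hint : ∀ x ∈ Set.Icc (0 : ℝ) 1,
      ∫⁻ ω, pointMeasure (L ω) (fun j => T j ω) (Set.Iic x) ∂P
        = ENNReal.ofReal (∫ s in (0 : ℝ)..x, ℓ s))
    (hpair : ∀ A B : Set ℝ, MeasurableSet A → MeasurableSet B →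
      ∫⁻ ω, pairMeasure (L ω) (fun j => T j ω) (A ×ˢ B) ∂P ≤ C * volume A * volume B) :
    IsMarked P U L T ℓ C := by
  have hM2 := measurable_pairMeasure hM
  have hinter : ∀ A : Set ℝ, MeasurableSet A →
      ∀ᵐ ω ∂P, pointMeasure (L ω) (fun j => T j ω) A
        = pointMeasure (L ω) (fun j => T j ω) (A ∩ Set.Icc 0 1) := fun A hA => by
    filter_upwards [hT] with ω hω
    rw [pointMeasure_apply _ _ hA, pointMeasure_apply _ _ (hA.inter measurableSet_Icc)]
    refine Finset.sum_congr rfl fun j hj => ?_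
    have := hω j (Finset.mem_range.1 hj)
    by_cases h : T j ω ∈ A <;> simp [Set.indicator, h, this.1, this.2]
  have huniv : (P.bind fun ω => pointMeasure (L ω) (fun j => T j ω)) Set.univ
      = ENNReal.ofReal (∫ s in (0 : ℝ)..1, ℓ s) := by
    rw [Measure.bind_apply .univ hM.aemeasurable, ← hint 1 (by simp)]
    refine lintegral_congr_ae ?_
    filter_upwards [hinter _ .univ, hinter _ (measurableSet_Iic (a := (1 : ℝ)))] with ω h1 h2
    rw [h1, h2]
    congr 1
    ext x; simp
  have hfin : IsFiniteMeasure (P.bind fun ω => pointMeasure (L ω) (fun j => T j ω)) :=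
    ⟨by rw [huniv]; exact ENNReal.ofReal_lt_top⟩
  have hloc : ∀ x ∈ Set.Icc (0 : ℝ) 1, ENNReal.ofReal (∫ s in (0 : ℝ)..x, ℓ s)
      = ∫⁻ s in Set.Icc (0 : ℝ) x, ENNReal.ofReal (ℓ s) := fun x hx => by
    have hsub : Set.Icc (0 : ℝ) x ⊆ Set.Icc 0 1 := Set.Icc_subset_Icc le_rfl hx.2
    rw [intervalIntegral.integral_of_le hx.1, ← integral_Icc_eq_integral_Ioc,
      ofReal_integral_eq_lintegral_ofReal]
    · exact (hℓ.mono hsub).integrableOn_Icc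
    · exact (ae_restrict_iff' measurableSet_Icc).2 (ae_of_all _ fun s hs => hℓ0 s (hsub hs))
  have hκ : (P.bind fun ω => pointMeasure (L ω) (fun j => T j ω))
      = (volume.restrict (Set.Icc (0 : ℝ) 1)).withDensity fun s => ENNReal.ofReal (ℓ s) := by
    refine Measure.ext_of_Iic _ _ fun x => ?_
    rw [Measure.bind_apply measurableSet_Iic hM.aemeasurable,
      withDensity_apply _ measurableSet_Iic, Measure.restrict_restrict measurableSet_Iic]
    rcases lt_or_ge x 0 with hx | hx
    · have e : Set.Iic x ∩ Set.Icc 0 1 = ∅ := by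
        ext y; simp; intro h1 h2; linarith
      rw [e, Measure.restrict_empty, lintegral_zero_measure]
      refine (lintegral_congr_ae (hinter _ measurableSet_Iic)).trans ?_
      simp [e]
    · have e : Set.Iic x ∩ Set.Icc 0 1 = Set.Icc 0 (min x 1) := by
        ext y; simp; tauto
      have hmem : min x 1 ∈ Set.Icc (0 : ℝ) 1 := ⟨le_min hx zero_le_one, min_le_right _ _⟩
      rw [e, ← hloc _ hmem, ← hint _ hmem]
      refine lintegral_congr_ae ?_
      filter_upwards [hinter _ (measurableSet_Iic (a := x)),
        hinter _ (measurableSet_Iic (a := min x 1))] with ω h1 h2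
      rw [h1, h2]
      congr 1
      ext y; simp; tauto
  have hprod : ∀ A B : Set ℝ, MeasurableSet A → MeasurableSet B →
      (P.bind fun ω => pairMeasure (L ω) (fun j => T j ω)) (A ×ˢ B)
        ≤ C * volume (A ∩ Set.Icc 0 1) * volume (B ∩ Set.Icc 0 1) := fun A B hA hB => by
    rw [Measure.bind_apply (hA.prod hB) hM2.aemeasurable]
    refine le_trans (le_of_eq ?_)
      (hpair (A ∩ Set.Icc 0 1) (B ∩ Set.Icc 0 1) (hA.inter measurableSet_Icc)
        (hB.inter measurableSet_Icc))
    refine lintegral_congr_ae ?_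
    filter_upwards [hinter A hA, hinter B hB, hinter _ (hA.inter hB)] with ω h1 h2 h3
    rw [pairMeasure_prod _ _ hA hB, pairMeasure_prod _ _ (hA.inter measurableSet_Icc)
        (hB.inter measurableSet_Icc), ← Set.inter_inter_distrib_right, ← h1, ← h2, ← h3]
  have hfin2 : IsFiniteMeasure (P.bind fun ω => pairMeasure (L ω) (fun j => T j ω)) := by
    refine ⟨?_⟩
    rw [← Set.univ_prod_univ]
    refine (hprod _ _ .univ .univ).trans_lt ?_
    simp
  refine ⟨hU, hM, fun g hg => ?_, fun a b ha hb => ?_⟩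
  · have h := lintegral_lintegral_of_indepFun hM hU hind hg
    have hE : Measurable fun s => ∫⁻ ω, g s (U ω) ∂P :=
      (hg.comp (measurable_id.prodMap hU)).lintegral_prod_right'
    rw [hκ, lintegral_withDensity_eq_lintegral_mul₀ ?_ hE.aemeasurable] at h
    · refine Eq.trans ?_ h
      refine lintegral_congr fun ω => ?_
      exact (lintegral_pointMeasure _ _
        (hg.comp (by fun_prop : Measurable fun s => (s, U ω)))).symm
    · exact (hℓ.aemeasurable measurableSet_Icc).ennreal_ofReal
  · have hab : Measurable fun z : (ℝ × ℝ) × E => a z.1.1 z.2 * b z.1.2 :=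
      (ha.comp (by fun_prop : Measurable fun z : (ℝ × ℝ) × E => (z.1.1, z.2))).mul
        (hb.comp (by fun_prop))
    have h := lintegral_lintegral_of_indepFun hM2 hU hind2
      (g := fun x u => a x.1 u * b x.2) hab
    have hE : Measurable fun s => ∫⁻ ω, a s (U ω) ∂P :=
      (ha.comp (measurable_id.prodMap hU)).lintegral_prod_right'
    have e1 : ∀ x : ℝ × ℝ, ∫⁻ ω, a x.1 (U ω) * b x.2 ∂P = (∫⁻ ω, a x.1 (U ω) ∂P) * b x.2 :=
      fun x => lintegral_mul_const _
        (ha.comp (by fun_prop : Measurable fun ω => (x.1, U ω)))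
    simp only [e1] at h
    calc _ = ∫⁻ ω, ∫⁻ x, a x.1 (U ω) * b x.2 ∂(pairMeasure (L ω) (fun j => T j ω)) ∂P := by
          refine lintegral_congr fun ω => ?_
          rw [lintegral_pairMeasure]
          exact hab.comp (by fun_prop : Measurable fun x => (x, U ω))
      _ ≤ _ := by
          rw [h]
          refine lintegral_mul_le_of_prod_le (fun A B hA hB => (hprod A B hA hB).trans ?_) hE hb
          gcongr
          exact Set.inter_subset_left

end PointProcess

/-! ### Independence of sums over marked points. -/

section PointProcess

lemma pointMeasure_eq_inter {n : ℕ} {τ : ℕ → ℝ} {I : Set ℝ} (hI : MeasurableSet I)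
    (hτ : ∀ j < n, τ j ∈ I) {A : Set ℝ} (hA : MeasurableSet A) :
    pointMeasure n τ A = pointMeasure n τ (A ∩ I) := by
  rw [pointMeasure_apply _ _ hA, pointMeasure_apply _ _ (hA.inter hI)]
  refine Finset.sum_congr rfl fun j hj => ?_
  have := hτ j (Finset.mem_range.1 hj)
  by_cases h : τ j ∈ A <;> simp [Set.indicator, h, this]

lemma isCountablySpanning_Iic : IsCountablySpanning (Set.range (Set.Iic : ℝ → Set ℝ)) := by
  refine ⟨fun n : ℕ => Set.Iic (n : ℝ), fun n => ⟨n, rfl⟩, ?_⟩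
  ext x
  simpa using exists_nat_ge x

lemma ext_of_Iic_prod_Iic (μ ν : Measure (ℝ × ℝ)) [IsFiniteMeasure μ]
    (h : ∀ a b, μ (Set.Iic a ×ˢ Set.Iic b) = ν (Set.Iic a ×ˢ Set.Iic b)) : μ = ν := by
  have hgen : MeasurableSpace.generateFrom (Set.range (Set.Iic : ℝ → Set ℝ))
      = (inferInstance : MeasurableSpace ℝ) :=
    (borel_eq_generateFrom_Iic ℝ ▸ BorelSpace.measurable_eq).symm
  refine ext_of_generate_finite _ (generateFrom_eq_prod hgen hgen isCountablySpanning_Iic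
    isCountablySpanning_Iic).symm (isPiSystem_Iic.prod isPiSystem_Iic) ?_ ?_
  · rintro _ ⟨_, ⟨a, rfl⟩, _, ⟨b, rfl⟩, rfl⟩
    exact h a b
  · have e : (Set.univ : Set (ℝ × ℝ)) = ⋃ n : ℕ, Set.Iic (n : ℝ) ×ˢ Set.Iic (n : ℝ) := by
      ext x
      simpa [Prod.le_def] using (exists_nat_ge (max x.1 x.2)).imp fun n hn => max_le_iff.1 hn
    have hmono : Monotone fun n : ℕ => Set.Iic (n : ℝ) ×ˢ Set.Iic (n : ℝ) := fun a b hab =>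
      Set.prod_mono (Set.Iic_subset_Iic.2 (by exact_mod_cast hab))
        (Set.Iic_subset_Iic.2 (by exact_mod_cast hab))
    rw [e, hmono.measure_iUnion, hmono.measure_iUnion]
    exact iSup_congr fun n => h _ _

/-- Each sum is the difference of the integrals of the positive and the negative part of `g i`
against the marked point measure, both finite since there are finitely many points. So it is a
measurable function of that measure. -/
lemma iIndepFun_sum_of_marked {Ω E : Type*} [MeasurableSpace Ω] [MeasurableSpace E]
    {P : Measure Ω} {U : ℕ → Ω → E} {L : ℕ → Ω → ℕ} {T : ℕ → ℕ → Ω → ℝ}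
    (h : iIndepFun (fun i ω => (pointMeasure (L i ω) (fun j => T i j ω)).map
      (fun s => (s, U i ω))) P)
    {g : ℕ → ℝ → E → ℝ} (hg : ∀ i, Measurable fun z : ℝ × E => g i z.1 z.2) :
    iIndepFun (fun i ω => ∑ j ∈ Finset.range (L i ω), g i (T i j ω) (U i ω)) P := by
  have h2 := h.comp (fun i (μ : Measure (ℝ × E)) =>
      (∫⁻ z, ENNReal.ofReal (g i z.1 z.2) ∂μ).toReal
        - (∫⁻ z, ENNReal.ofReal (-g i z.1 z.2) ∂μ).toReal) fun i =>
    ((Measure.measurable_lintegral (hg i).ennreal_ofReal).ennreal_toReal).sub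
      ((Measure.measurable_lintegral (hg i).neg.ennreal_ofReal).ennreal_toReal)
  have e : ∀ (f : ℝ × E → ℝ), Measurable f → ∀ i ω,
      (∫⁻ z, ENNReal.ofReal (f z) ∂((pointMeasure (L i ω) (fun j => T i j ω)).map
        (fun s => (s, U i ω)))).toReal
      = ∑ j ∈ Finset.range (L i ω), max (f (T i j ω, U i ω)) 0 := fun f hf i ω => by
    rw [lintegral_map hf.ennreal_ofReal (by fun_prop), lintegral_pointMeasure]
    · rw [ENNReal.toReal_sum fun _ _ => ENNReal.ofReal_ne_top]
      exact Finset.sum_congr rfl fun j _ => by rw [ENNReal.toReal_ofReal']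
    · exact hf.ennreal_ofReal.comp (by fun_prop)
  convert! h2 using 3 with i ω
  simp only [Function.comp_apply]
  rw [e _ (hg i), e (fun z => -g i z.1 z.2) (hg i).neg, ← Finset.sum_sub_distrib]
  exact Finset.sum_congr rfl fun j _ => (max_zero_sub_eq_self _).symm

end PointProcess

/-! ### The observation times of a subject as a marked point process. -/

namespace Study

variable {Ω : Type*} {p q : ℕ}

lemma pointMeasure_Iic (D : Study Ω p q) (i : ℕ) (x : ℝ) (ω : Ω) :
    pointMeasure (D.L i ω) (fun j => D.T i j ω) (Set.Iic x) = (D.N i x ω : ℝ≥0∞) := by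
  rw [pointMeasure_apply _ _ measurableSet_Iic, N, Finset.card_filter, Nat.cast_sum]
  refine Finset.sum_congr rfl fun j _ => ?_
  by_cases h : D.T i j ω ≤ x <;> simp [h]

lemma pairMeasure_eq_pairCount (D : Study Ω p q) (i : ℕ) (ω : Ω) {A B : Set ℝ}
    (hA : MeasurableSet A) (hB : MeasurableSet B) :
    pairMeasure (D.L i ω) (fun j => D.T i j ω) (A ×ˢ B) = (D.pairCount i A B ω : ℝ≥0∞) := by
  classical
  rw [← lintegral_indicator_one (hA.prod hB),
    lintegral_pairMeasure _ _ (measurable_one.indicator (hA.prod hB)), pairCount,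
    Finset.card_filter, Finset.sum_product, Nat.cast_sum]
  refine Finset.sum_congr rfl fun j hj => ?_
  rw [Nat.cast_sum, ← Finset.add_sum_erase (Finset.range (D.L i ω)) _ hj]
  simp only [ne_eq, not_true_eq_false, false_and, if_false, Nat.cast_zero, zero_add]
  refine Finset.sum_congr rfl fun k hk => ?_
  have hjk : j ≠ k := (Finset.ne_of_mem_erase hk).symm
  by_cases h1 : D.T i j ω ∈ A <;> by_cases h2 : D.T i k ω ∈ B <;> simp [h1, h2, hjk]

/-- The independence assumptions concern the path of `N`, not the enumeration `T i j` of the times.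
Unlike the labelled times, the point measure depends on `N` only. -/
lemma measurable_pointMeasure_comap_pathN (D : Study Ω p q) (i : ℕ) :
    Measurable[MeasurableSpace.comap (D.pathN i) MeasurableSpace.pi]
      fun ω => pointMeasure (D.L i ω) (fun j => D.T i j ω) := by
  let _ : MeasurableSpace Ω := MeasurableSpace.comap (D.pathN i) MeasurableSpace.pi
  refine measurable_pointMeasure fun x => ?_
  simp only [pointMeasure_Iic]
  have h : Measurable (D.pathN i) := comap_measurable _
  exact (measurable_from_top (f := fun k : ℕ => (k : ℝ≥0∞))).comp ((measurable_pi_apply x).comp h)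

lemma measurable_marked_comap_path (D : Study Ω p q) (i : ℕ) :
    Measurable[MeasurableSpace.comap (D.path i) MeasurableSpace.pi]
      fun ω => (pointMeasure (D.L i ω) (fun j => D.T i j ω)).map
        (fun s => (s, D.pathXY i ω)) := by
  let _ : MeasurableSpace Ω := MeasurableSpace.comap (D.path i) MeasurableSpace.pi
  have h : Measurable (D.path i) := comap_measurable _
  have hs : ∀ s, Measurable fun ω => D.path i ω s := fun s => (measurable_pi_apply s).comp h
  refine measurable_map_mk (measurable_pointMeasure fun x => ?_) (measurable_pi_lambda _ fun s => ?_)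
  · simp only [pointMeasure_Iic]
    exact (measurable_from_top (f := fun k : ℕ => (k : ℝ≥0∞))).comp (hs x).snd.snd.snd
  · exact (hs s).fst.prodMk (hs s).snd.snd.fst

variable [MeasurableSpace Ω]

lemma IsIIDSample.measurable_pathXY {D : Study Ω p q} {P : Measure Ω} (hD : D.IsIIDSample P)
    (i : ℕ) : Measurable (D.pathXY i) :=
  measurable_pi_lambda _ fun s => (hD.measurable_X i s).prodMk (hD.measurable_Y i s)

lemma IsIIDSample.measurable_N {D : Study Ω p q} {P : Measure Ω} (hD : D.IsIIDSample P)
    (i : ℕ) (x : ℝ) : Measurable (D.N i x) := by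
  have e : D.N i x = fun ω => ∑ j ∈ Finset.range (D.L i ω), if D.T i j ω ≤ x then 1 else 0 := by
    ext ω
    rw [N, Finset.card_filter]
  rw [e]
  have h1 : Measurable fun z : Ω × ℕ =>
      ∑ j ∈ Finset.range z.2, if D.T i j z.1 ≤ x then 1 else 0 := by
    refine measurable_from_prod_countable_left fun n => ?_
    exact Finset.measurable_fun_sum (Finset.range n) fun j _ =>
      Measurable.ite (measurableSet_le (hD.measurable_T i j) measurable_const)
        measurable_const measurable_const
  exact h1.comp (measurable_id.prodMk (hD.measurable_L i))

lemma IsIIDSample.measurable_path {D : Study Ω p q} {P : Measure Ω} (hD : D.IsIIDSample P)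
    (i : ℕ) : Measurable (D.path i) :=
  measurable_pi_lambda _ fun s => (hD.measurable_X i s).prodMk ((hD.measurable_Z i s).prodMk
    ((hD.measurable_Y i s).prodMk (hD.measurable_N i s)))

lemma IsIIDSample.iIndepFun_marked {D : Study Ω p q} {P : Measure Ω} (hD : D.IsIIDSample P) :
    iIndepFun (fun i ω => (pointMeasure (D.L i ω) (fun j => D.T i j ω)).map
      (fun s => (s, D.pathXY i ω))) P := by
  have h := hD.indep
  rw [iIndepFun_iff_iIndep] at h ⊢
  exact iIndep_of_iIndep_of_le h fun i =>
    (D.measurable_marked_comap_path i).comap_le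

theorem IsIIDSample.isMarked {D : Study Ω p q} {P : Measure Ω} [IsProbabilityMeasure P]
    (hD : D.IsIIDSample P) {lam : ℝ → ℝ} (hobs : D.ObservationCond P lam)
    (hlam : ∀ s ∈ Set.Icc (0 : ℝ) 1, 0 ≤ lam s) :
    ∃ C : ℝ≥0, ∀ i, IsMarked P (D.pathXY i) (D.L i) (D.T i) lam C := by
  obtain ⟨C, hC⟩ := hobs.joint_intensity
  refine ⟨C, fun i => ?_⟩
  have hMi : ∀ i, Measurable fun ω => pointMeasure (D.L i ω) (fun j => D.T i j ω) := fun i =>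
    measurable_pointMeasure fun x => by
      simp only [pointMeasure_Iic]
      exact (measurable_from_top (f := fun k : ℕ => (k : ℝ≥0∞))).comp (hD.measurable_N i x)
  have hle : MeasurableSpace.comap (fun ω => pointMeasure (D.L i ω) (fun j => D.T i j ω))
      inferInstance ≤ MeasurableSpace.comap (D.pathN i) MeasurableSpace.pi :=
    (D.measurable_pointMeasure_comap_pathN i).comap_le
  have hle2 : MeasurableSpace.comap (fun ω => pairMeasure (D.L i ω) (fun j => D.T i j ω))
      inferInstance ≤ MeasurableSpace.comap (D.pathN i) MeasurableSpace.pi :=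
    (@measurable_pairMeasure Ω (MeasurableSpace.comap (D.pathN i) MeasurableSpace.pi) _ _
      (D.measurable_pointMeasure_comap_pathN i)).comap_le
  have hindN := hobs.indep i
  rw [IndepFun_iff_Indep] at hindN
  have hNlaw : ∀ a b, IdentDistrib (fun ω => (D.N i a ω, D.N i b ω))
      (fun ω => (D.N 0 a ω, D.N 0 b ω)) P P := fun a b =>
    (hD.identDistrib i).comp (u := fun φ : ℝ → Vec p × Vec q × ℝ × ℕ =>
      ((φ a).2.2.2, (φ b).2.2.2)) (by fun_prop)
  -- The joint intensity is assumed for subject `0` only. On a product of half-lines the mean of the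
  -- pair measure is `E{N(a) N(b) - N(min a b)}`, which the joint law of `N(a), N(b)` determines; so
  -- all subjects share it.
  have hκ : (P.bind fun ω => pairMeasure (D.L 0 ω) (fun j => D.T 0 j ω))
      = P.bind fun ω => pairMeasure (D.L i ω) (fun j => D.T i j ω) := by
    have hfin : IsFiniteMeasure (P.bind fun ω => pairMeasure (D.L 0 ω) (fun j => D.T 0 j ω)) := by
      refine ⟨?_⟩
      rw [← Set.univ_prod_univ, Measure.bind_apply (MeasurableSet.univ.prod .univ)
        (measurable_pairMeasure (hMi 0)).aemeasurable]
      refine lt_of_le_of_lt (le_of_eq ?_) (lt_of_le_of_lt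
        (hC (Set.Icc 0 1) (Set.Icc 0 1) measurableSet_Icc measurableSet_Icc)
        (by simp : (C : ℝ≥0∞) * volume (Set.Icc (0 : ℝ) 1) * volume (Set.Icc (0 : ℝ) 1) < ⊤))
      refine lintegral_congr_ae ?_
      filter_upwards [hD.times_mem 0] with ω hω
      rw [← pairMeasure_eq_pairCount _ _ _ measurableSet_Icc measurableSet_Icc,
        pairMeasure_prod _ _ .univ .univ, pairMeasure_prod _ _ measurableSet_Icc measurableSet_Icc,
        Set.inter_self, Set.inter_self, pointMeasure_eq_inter measurableSet_Icc hω .univ,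
        Set.univ_inter]
    refine ext_of_Iic_prod_Iic _ _ fun a b => ?_
    have hm : MeasurableSet (Set.Iic a ×ˢ Set.Iic b : Set (ℝ × ℝ)) :=
      measurableSet_Iic.prod measurableSet_Iic
    rw [Measure.bind_apply hm (measurable_pairMeasure (hMi 0)).aemeasurable,
      Measure.bind_apply hm (measurable_pairMeasure (hMi i)).aemeasurable]
    simp only [pairMeasure_prod _ _ measurableSet_Iic measurableSet_Iic, Set.Iic_inter_Iic,
      pointMeasure_Iic]
    rcases le_total a b with hab | hab
    · rw [min_eq_left hab]
      exact (((hNlaw a b).comp (u := fun z : ℕ × ℕ => (z.1 : ℝ≥0∞) * z.2 - z.1)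
        (measurable_of_countable _)).lintegral_eq).symm
    · rw [min_eq_right hab]
      exact (((hNlaw a b).comp (u := fun z : ℕ × ℕ => (z.1 : ℝ≥0∞) * z.2 - z.2)
        (measurable_of_countable _)).lintegral_eq).symm
  refine isMarked_of_indepFun hobs.contDiff_lam.continuousOn hlam (hD.measurable_pathXY i) (hMi i)
    ?_ ?_ (hD.times_mem i) (fun x hx => ?_) fun A B hA hB => ?_
  · rw [IndepFun_iff_Indep]
    exact indep_of_indep_of_le_left hindN hle
  · rw [IndepFun_iff_Indep]
    exact indep_of_indep_of_le_left hindN hle2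
  · simp only [pointMeasure_Iic]
    rw [← hobs.intensity x hx]
    exact ((hNlaw x x).comp (u := fun z : ℕ × ℕ => (z.1 : ℝ≥0∞))
      (measurable_of_countable _)).lintegral_eq
  · rw [← Measure.bind_apply (hA.prod hB) (measurable_pairMeasure (hMi i)).aemeasurable, ← hκ,
      Measure.bind_apply (hA.prod hB) (measurable_pairMeasure (hMi 0)).aemeasurable]
    simp only [pairMeasure_eq_pairCount _ _ _ hA hB]
    exact hC A B hA hB

end Study

/-! ### Averages over a shrinking window. -/

section KernelAverage

lemma lintegral_eq_mul_lintegral_add_mul {h : ℝ} (hh : 0 < h) (t : ℝ) {G : ℝ → ℝ≥0∞}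
    (hG : Measurable G) : ∫⁻ s, G s = ENNReal.ofReal h * ∫⁻ z, G (t + h * z) := by
  have h1 : ∫⁻ s, G s = ∫⁻ s, G (t + s) := (lintegral_add_left_eq_self G t).symm
  have h2 := Real.smul_map_volume_mul_left hh.ne'
  have h3 : ∫⁻ s, G (t + s) ∂(ENNReal.ofReal |h| • Measure.map (h * ·) volume)
      = ∫⁻ s, G (t + s) := by rw [h2]
  rw [h1, ← h3, lintegral_smul_measure, lintegral_map (by fun_prop) (by fun_prop), smul_eq_mul,
    abs_of_pos hh]

/-- The average of `w` over the part in `[0, 1]` of a window of width `h` about `t`, with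
weights `φ`. -/
def kernelAvg (h t : ℝ) (φ w : ℝ → ℝ≥0∞) : ℝ≥0∞ :=
  ∫⁻ z, φ z * (Set.Icc (0 : ℝ) 1).indicator w (t + h * z)

lemma kernelAvg_mono {h t : ℝ} {φ w w' : ℝ → ℝ≥0∞} (hw : ∀ s ∈ Set.Icc (0 : ℝ) 1, w s ≤ w' s) :
    kernelAvg h t φ w ≤ kernelAvg h t φ w' := by
  refine lintegral_mono fun z => mul_le_mul_right ?_ _
  by_cases hz : t + h * z ∈ Set.Icc (0 : ℝ) 1
  · simpa [hz] using hw _ hz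
  · simp [hz]

lemma kernelAvg_le {h t : ℝ} {φ w : ℝ → ℝ≥0∞} (hφ : Measurable φ) {B : ℝ≥0∞}
    (hw : ∀ s ∈ Set.Icc (0 : ℝ) 1, w s ≤ B) : kernelAvg h t φ w ≤ (∫⁻ z, φ z) * B := by
  rw [← lintegral_mul_const _ hφ]
  refine lintegral_mono fun z => ?_
  gcongr
  by_cases hz : t + h * z ∈ Set.Icc (0 : ℝ) 1
  · simpa [hz] using hw _ hz
  · simp [hz]

lemma setLIntegral_kernel_eq {h : ℝ} (hh : 0 < h) (t : ℝ) {φ w : ℝ → ℝ≥0∞} (hφ : Measurable φ)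
    (hw : Measurable w) :
    ∫⁻ s in Set.Icc (0 : ℝ) 1, φ ((s - t) / h) * w s
      = ENNReal.ofReal h * kernelAvg h t φ w := by
  rw [← lintegral_indicator measurableSet_Icc, lintegral_eq_mul_lintegral_add_mul hh t]
  · congr 1
    refine lintegral_congr fun z => ?_
    have e : (t + h * z - t) / h = z := by field_simp; ring
    by_cases hz : t + h * z ∈ Set.Icc (0 : ℝ) 1
    · simp only [Set.indicator_of_mem hz, e]
    · simp [Set.indicator_of_notMem hz]
  · exact Measurable.indicator (by fun_prop) measurableSet_Icc

/-- The weights may have unbounded support. Close to `t` the smallness of `w` is used; the part `|h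
z| ≥ δ`, where only the bound `B` is known, vanishes by dominated convergence. -/
lemma tendsto_kernelAvg_zero {h : ℕ → ℝ} (hh0 : Tendsto h atTop (𝓝 0))
    {t : ℝ} {φ w : ℝ → ℝ≥0∞} (hφ : Measurable φ) (hφi : ∫⁻ z, φ z ≠ ∞) {B : ℝ≥0}
    (hB : ∀ s ∈ Set.Icc (0 : ℝ) 1, w s ≤ B) (hw : Tendsto w (𝓝 t) (𝓝 0)) :
    Tendsto (fun n => kernelAvg (h n) t φ w) atTop (𝓝 0) := by
  rw [ENNReal.tendsto_atTop_zero]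
  intro ε hε
  obtain ⟨η, hη0, hη⟩ : ∃ η : ℝ≥0∞, 0 < η ∧ (∫⁻ z, φ z) * η ≤ ε / 2 := by
    refine ⟨ε / 2 / ((∫⁻ z, φ z) + 1), ENNReal.div_pos (ENNReal.half_pos hε.ne').ne'
      (by simp [hφi]), ?_⟩
    calc (∫⁻ z, φ z) * (ε / 2 / ((∫⁻ z, φ z) + 1))
        ≤ ((∫⁻ z, φ z) + 1) * (ε / 2 / ((∫⁻ z, φ z) + 1)) := by gcongr; exact le_self_add
      _ = ε / 2 := ENNReal.mul_div_cancel (by simp) (by simp [hφi])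
  obtain ⟨δ, hδ0, hδ⟩ := Metric.eventually_nhds_iff.1 (hw.eventually_lt_const hη0)
  have htail : Tendsto (fun n => ∫⁻ z, φ z * {z | δ ≤ |h n * z|}.indicator (fun _ => (B : ℝ≥0∞)) z)
      atTop (𝓝 (∫⁻ _ : ℝ, 0)) := by
    refine tendsto_lintegral_of_dominated_convergence (fun z => φ z * B) (fun n => ?_)
      (fun n => ae_of_all _ fun z => ?_) ?_ (ae_of_all _ fun z => ?_)
    · exact hφ.mul (measurable_const.indicator (measurableSet_le measurable_const (by fun_prop)))
    · exact mul_le_mul_right (Set.indicator_le_self' (fun _ _ => zero_le) _) _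
    · rw [lintegral_mul_const _ hφ]
      exact ENNReal.mul_ne_top hφi ENNReal.coe_ne_top
    · have h1 : Tendsto (fun n => |h n * z|) atTop (𝓝 0) := by
        have := (hh0.mul_const z).abs
        simpa using this
      refine tendsto_const_nhds.congr' ?_
      filter_upwards [h1.eventually_lt_const hδ0] with n hn
      rw [Set.indicator_of_notMem (by simpa using hn), mul_zero]
  rw [lintegral_zero] at htail
  obtain ⟨N, hN⟩ := (ENNReal.tendsto_atTop_zero.1 htail) (ε / 2) (ENNReal.half_pos hε.ne')
  refine ⟨N, fun n hn => ?_⟩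
  calc kernelAvg (h n) t φ w
      ≤ ∫⁻ z, (φ z * η + φ z * {z | δ ≤ |h n * z|}.indicator (fun _ => (B : ℝ≥0∞)) z) := by
        refine lintegral_mono fun z => ?_
        rw [← mul_add]
        gcongr
        by_cases hz : t + h n * z ∈ Set.Icc (0 : ℝ) 1
        · rw [Set.indicator_of_mem hz]
          by_cases hd : δ ≤ |h n * z|
          · rw [Set.indicator_of_mem (show z ∈ {z | δ ≤ |h n * z|} from hd)]
            exact (hB _ hz).trans le_add_self
          · refine le_add_right (hδ ?_).le
            simpa [Real.dist_eq] using hd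
        · simp [hz]
    _ = (∫⁻ z, φ z) * η
          + ∫⁻ z, φ z * {z | δ ≤ |h n * z|}.indicator (fun _ => (B : ℝ≥0∞)) z := by
        rw [lintegral_add_left (hφ.mul_const _), lintegral_mul_const _ hφ]
    _ ≤ ε / 2 + ε / 2 := add_le_add hη (hN n hn)
    _ = ε := ENNReal.add_halves ε

lemma measurable_indicator_of_continuousOn {F : Type*} [TopologicalSpace F] [Zero F]
    [MeasurableSpace F] [BorelSpace F] {g : ℝ → F} {S : Set ℝ} (hg : ContinuousOn g S)
    (hS : MeasurableSet S) : Measurable (S.indicator g) := by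
  classical
  rw [← Set.piecewise_eq_indicator]
  exact hg.measurable_piecewise continuousOn_const hS

/-- As `t` is interior, `t + h z` eventually lies in `[0, 1]` for each fixed `z`, where `g` is
continuous; the bound of `g` on the interval dominates. -/
lemma tendsto_integral_kernel {h : ℕ → ℝ} (hh0 : Tendsto h atTop (𝓝 0))
    {t : ℝ} (ht : t ∈ Set.Ioo (0 : ℝ) 1) {f g : ℝ → ℝ} (hf : Integrable f)
    (hg : ContinuousOn g (Set.Icc 0 1)) :
    Tendsto (fun n => ∫ z, f z * (Set.Icc (0 : ℝ) 1).indicator g (t + h n * z)) atTop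
      (𝓝 ((∫ z, f z) * g t)) := by
  obtain ⟨B, hB⟩ := isCompact_Icc.exists_bound_of_continuousOn hg
  have hB0 : 0 ≤ B := (norm_nonneg _).trans (hB 0 (by simp))
  have hgm := measurable_indicator_of_continuousOn hg measurableSet_Icc
  rw [← integral_mul_const]
  refine tendsto_integral_of_dominated_convergence (fun z => ‖f z‖ * B) (fun n => ?_)
    (hf.norm.mul_const _) (fun n => ae_of_all _ fun z => ?_) (ae_of_all _ fun z => ?_)
  · exact hf.aestronglyMeasurable.mul
      (hgm.comp (by fun_prop : Measurable fun z => t + h n * z)).aestronglyMeasurable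
  · rw [norm_mul]
    gcongr
    by_cases hz : t + h n * z ∈ Set.Icc (0 : ℝ) 1
    · rw [Set.indicator_of_mem hz]; exact hB _ hz
    · rw [Set.indicator_of_notMem hz]; simpa using hB0
  · refine Tendsto.const_mul _ ?_
    have h1 : Tendsto (fun n => t + h n * z) atTop (𝓝 t) := by
      simpa using (hh0.mul_const z).const_add t
    have hnhds : Set.Icc (0 : ℝ) 1 ∈ 𝓝 t := Icc_mem_nhds ht.1 ht.2
    have h2 : Tendsto (fun n => g (t + h n * z)) atTop (𝓝 (g t)) :=
      ((hg t ⟨ht.1.le, ht.2.le⟩).continuousAt hnhds).tendsto.comp h1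
    refine h2.congr' ?_
    filter_upwards [h1.eventually hnhds] with n hn
    exact (Set.indicator_of_mem (s := Set.Icc (0 : ℝ) 1) hn g).symm

end KernelAverage

/-! ### First and second moments of kernel sums. -/

lemma abs_sq_sum_sub_le (n : ℕ) (f x : ℕ → ℝ) :
    |(∑ j ∈ Finset.range n, f j * x j) ^ 2 - ∑ j ∈ Finset.range n, f j ^ 2 * x j ^ 2|
      ≤ ∑ j ∈ Finset.range n, ∑ k ∈ (Finset.range n).erase j, |f j| * x j ^ 2 * |f k| := by
  have e : (∑ j ∈ Finset.range n, f j * x j) ^ 2 - ∑ j ∈ Finset.range n, f j ^ 2 * x j ^ 2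
      = ∑ j ∈ Finset.range n, ∑ k ∈ (Finset.range n).erase j, (f j * x j) * (f k * x k) := by
    rw [sq, Finset.sum_mul_sum, ← Finset.sum_sub_distrib]
    refine Finset.sum_congr rfl fun j hj => ?_
    rw [← Finset.add_sum_erase _ _ hj]
    ring
  -- The bound `|x_j x_k| ≤ (x_j² + x_k²) / 2` and the symmetry of the double sum leave the marks at
  -- one of the two indices only, which is the form that the field `pair_le` of `IsMarked`
  -- integrates.
  have hsymm : ∑ j ∈ Finset.range n, ∑ k ∈ (Finset.range n).erase j, |f j| * x j ^ 2 * |f k|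
      = ∑ j ∈ Finset.range n, ∑ k ∈ (Finset.range n).erase j, |f k| * x k ^ 2 * |f j| := by
    refine Finset.sum_comm' fun j k => ?_
    simp only [Finset.mem_erase, Finset.mem_range]
    tauto
  have h2 : ∑ j ∈ Finset.range n, ∑ k ∈ (Finset.range n).erase j, |f j| * x j ^ 2 * |f k|
      = ∑ j ∈ Finset.range n, ∑ k ∈ (Finset.range n).erase j,
        (|f j| * x j ^ 2 * |f k| + |f k| * x k ^ 2 * |f j|) / 2 := by
    simp only [← Finset.sum_div, Finset.sum_add_distrib]
    rw [← hsymm]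
    ring
  rw [e, h2]
  refine (Finset.abs_sum_le_sum_abs _ _).trans (Finset.sum_le_sum fun j _ => ?_)
  refine (Finset.abs_sum_le_sum_abs _ _).trans (Finset.sum_le_sum fun k _ => ?_)
  have h3 : |f j * x j * (f k * x k)| = (|f j| * |f k|) * (|x j| * |x k|) := by
    simp only [abs_mul]; ring
  have h4 : (|f j| * x j ^ 2 * |f k| + |f k| * x k ^ 2 * |f j|) / 2
      = (|f j| * |f k|) * ((x j ^ 2 + x k ^ 2) / 2) := by ring
  rw [h3, h4]
  gcongr
  nlinarith [sq_nonneg (|x j| - |x k|), sq_abs (x j), sq_abs (x k)]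

namespace IsMarked

variable {Ω E : Type*} [MeasurableSpace Ω] [MeasurableSpace E] {P : Measure Ω}
  {U : Ω → E} {L : Ω → ℕ} {T : ℕ → Ω → ℝ} {ℓ : ℝ → ℝ} {C : ℝ≥0}

lemma measurable_lintegral (hM : IsMarked P U L T ℓ C) [SFinite P] {g : ℝ → E → ℝ≥0∞}
    (hg : Measurable fun z : ℝ × E => g z.1 z.2) : Measurable fun s => ∫⁻ ω, g s (U ω) ∂P :=
  (hg.comp (measurable_id.prodMap hM.measurable_mark)).lintegral_prod_right'

lemma measurable_sum (hM : IsMarked P U L T ℓ C) {g : ℝ → E → ℝ}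
    (hg : Measurable fun z : ℝ × E => g z.1 z.2) :
    Measurable fun ω => ∑ j ∈ Finset.range (L ω), g (T j ω) (U ω) := by
  have hm := measurable_map_mk hM.measurable_points hM.measurable_mark
  have e : ∀ (f : ℝ × E → ℝ), Measurable f → ∀ ω,
      (∫⁻ z, ENNReal.ofReal (f z) ∂((pointMeasure (L ω) (fun j => T j ω)).map
        (fun s => (s, U ω)))).toReal
      = ∑ j ∈ Finset.range (L ω), max (f (T j ω, U ω)) 0 := fun f hf ω => by
    rw [lintegral_map hf.ennreal_ofReal (by fun_prop), lintegral_pointMeasure]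
    · rw [ENNReal.toReal_sum fun _ _ => ENNReal.ofReal_ne_top]
      exact Finset.sum_congr rfl fun j _ => by rw [ENNReal.toReal_ofReal']
    · exact hf.ennreal_ofReal.comp (by fun_prop)
  have e2 : (fun ω => ∑ j ∈ Finset.range (L ω), g (T j ω) (U ω)) = fun ω =>
      (∫⁻ z, ENNReal.ofReal (g z.1 z.2) ∂((pointMeasure (L ω) (fun j => T j ω)).map
        (fun s => (s, U ω)))).toReal
      - (∫⁻ z, ENNReal.ofReal (-g z.1 z.2) ∂((pointMeasure (L ω) (fun j => T j ω)).map
        (fun s => (s, U ω)))).toReal := by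
    ext ω
    rw [e _ hg, e (fun z => -g z.1 z.2) hg.neg, ← Finset.sum_sub_distrib]
    exact Finset.sum_congr rfl fun j _ => (max_zero_sub_eq_self _).symm
  rw [e2]
  exact (((Measure.measurable_lintegral hg.ennreal_ofReal).comp hm).ennreal_toReal).sub
    (((Measure.measurable_lintegral hg.neg.ennreal_ofReal).comp hm).ennreal_toReal)

/-- Campbell's formula and the substitution `s = t + h z`: a point in the window costs one factor
`h`. -/
lemma lintegral_kernel_sum_le (hM : IsMarked P U L T ℓ C) [SFinite P] {Λ : ℝ} (hΛ0 : 0 ≤ Λ)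
    (hΛ : ∀ s ∈ Set.Icc (0 : ℝ) 1, ℓ s ≤ Λ) {h : ℝ} (hh : 0 < h) (t : ℝ) {φ : ℝ → ℝ≥0∞}
    (hφ : Measurable φ) {ψ : ℝ → E → ℝ≥0∞} (hψ : Measurable fun z : ℝ × E => ψ z.1 z.2) :
    ∫⁻ ω, ∑ j ∈ Finset.range (L ω), φ ((T j ω - t) / h) * ψ (T j ω) (U ω) ∂P
      ≤ ENNReal.ofReal (Λ * h) * kernelAvg h t φ fun s => ∫⁻ ω, ψ s (U ω) ∂P := by
  have hE := hM.measurable_lintegral hψ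
  rw [hM.campbell (fun s u => φ ((s - t) / h) * ψ s u)
    ((hφ.comp (by fun_prop)).mul hψ), ENNReal.ofReal_mul hΛ0, mul_assoc,
    ← setLIntegral_kernel_eq hh t hφ hE, ← lintegral_const_mul _ (by fun_prop)]
  refine setLIntegral_mono' measurableSet_Icc fun s hs => ?_
  have hs' : Measurable fun ω => ψ s (U ω) :=
    hψ.comp (measurable_const.prodMk hM.measurable_mark)
  rw [lintegral_const_mul _ hs']
  gcongr
  exact hΛ s hs

/-- Two points in the window cost two factors `h`. The mark is evaluated at the first point only, so
the second one integrates to `∫ χ`. -/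
lemma lintegral_kernel_pair_le (hM : IsMarked P U L T ℓ C) [SFinite P] {h : ℝ} (hh : 0 < h)
    (t : ℝ) {φ χ : ℝ → ℝ≥0∞} (hφ : Measurable φ) (hχ : Measurable χ) {ψ : ℝ → E → ℝ≥0∞}
    (hψ : Measurable fun z : ℝ × E => ψ z.1 z.2) :
    ∫⁻ ω, ∑ j ∈ Finset.range (L ω), ∑ k ∈ (Finset.range (L ω)).erase j,
        φ ((T j ω - t) / h) * ψ (T j ω) (U ω) * χ ((T k ω - t) / h) ∂P
      ≤ C * (ENNReal.ofReal h * kernelAvg h t φ fun s => ∫⁻ ω, ψ s (U ω) ∂P)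
        * (ENNReal.ofReal h * ∫⁻ z, χ z) := by
  have hE := hM.measurable_lintegral hψ
  refine (hM.pair_le (fun s u => φ ((s - t) / h) * ψ s u) (fun s => χ ((s - t) / h))
    ((hφ.comp (by fun_prop)).mul hψ) (hχ.comp (by fun_prop))).trans (le_of_eq ?_)
  have hχ' : Measurable fun s => χ ((s - t) / h) := hχ.comp (by fun_prop)
  rw [lintegral_eq_mul_lintegral_add_mul hh t hχ', ← setLIntegral_kernel_eq hh t hφ hE]
  congr 2
  · congr 1
    ext s
    have hs' : Measurable fun ω => ψ s (U ω) :=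
      hψ.comp (measurable_const.prodMk hM.measurable_mark)
    rw [lintegral_const_mul _ hs']
  · refine lintegral_congr fun z => ?_
    congr 1
    field_simp
    ring

/-- What separates the square of the sum from its diagonal is the contribution of pairs of different
observations: order `h²`, against order `h` for the diagonal. This is why the covariance within a
subject is absent from the limit. -/
lemma lintegral_sq_sum_sub_le (hM : IsMarked P U L T ℓ C) [SFinite P] {h : ℝ} (hh : 0 < h)
    (t : ℝ) {f : ℝ → ℝ} (hf : Measurable f) {ψ : ℝ → E → ℝ}
    (hψ : Measurable fun z : ℝ × E => ψ z.1 z.2) :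
    ∫⁻ ω, ENNReal.ofReal |(∑ j ∈ Finset.range (L ω), f ((T j ω - t) / h) * ψ (T j ω) (U ω)) ^ 2
        - ∑ j ∈ Finset.range (L ω), f ((T j ω - t) / h) ^ 2 * ψ (T j ω) (U ω) ^ 2| ∂P
      ≤ C * (ENNReal.ofReal h * kernelAvg h t (fun z => ENNReal.ofReal |f z|)
          fun s => ∫⁻ ω, ENNReal.ofReal (ψ s (U ω) ^ 2) ∂P)
        * (ENNReal.ofReal h * ∫⁻ z, ENNReal.ofReal |f z|) := by
  refine le_trans (lintegral_mono fun ω => ?_) (hM.lintegral_kernel_pair_le hh t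
    (φ := fun z => ENNReal.ofReal |f z|) (χ := fun z => ENNReal.ofReal |f z|)
    (ψ := fun s u => ENNReal.ofReal (ψ s u ^ 2)) (by fun_prop) (by fun_prop)
    (hψ.pow_const 2).ennreal_ofReal)
  refine (ENNReal.ofReal_le_ofReal (abs_sq_sum_sub_le (L ω) (fun j => f ((T j ω - t) / h))
    (fun j => ψ (T j ω) (U ω)))).trans (le_of_eq ?_)
  rw [ENNReal.ofReal_sum_of_nonneg fun j _ => Finset.sum_nonneg fun k _ => by positivity]
  refine Finset.sum_congr rfl fun j _ => ?_
  rw [ENNReal.ofReal_sum_of_nonneg fun k _ => by positivity]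
  refine Finset.sum_congr rfl fun k _ => ?_
  rw [ENNReal.ofReal_mul (by positivity), ENNReal.ofReal_mul (by positivity)]

lemma lintegral_sq_sum_le (hM : IsMarked P U L T ℓ C) [SFinite P] {Λ : ℝ} (hΛ0 : 0 ≤ Λ)
    (hΛ : ∀ s ∈ Set.Icc (0 : ℝ) 1, ℓ s ≤ Λ) {h : ℝ} (hh : 0 < h)
    (t : ℝ) {f : ℝ → ℝ} (hf : Measurable f) {ψ : ℝ → E → ℝ}
    (hψ : Measurable fun z : ℝ × E => ψ z.1 z.2) :
    ∫⁻ ω, ENNReal.ofReal ((∑ j ∈ Finset.range (L ω), f ((T j ω - t) / h) * ψ (T j ω) (U ω)) ^ 2) ∂P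
      ≤ ENNReal.ofReal (Λ * h) * kernelAvg h t (fun z => ENNReal.ofReal (f z ^ 2))
          (fun s => ∫⁻ ω, ENNReal.ofReal (ψ s (U ω) ^ 2) ∂P)
        + C * (ENNReal.ofReal h * kernelAvg h t (fun z => ENNReal.ofReal |f z|)
          fun s => ∫⁻ ω, ENNReal.ofReal (ψ s (U ω) ^ 2) ∂P)
        * (ENNReal.ofReal h * ∫⁻ z, ENNReal.ofReal |f z|) := by
  have hm1 := hM.measurable_sum (g := fun s u => f ((s - t) / h) * ψ s u)
    ((hf.comp (by fun_prop)).mul hψ)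
  have hm2 := hM.measurable_sum (g := fun s u => f ((s - t) / h) ^ 2 * ψ s u ^ 2)
    (((hf.comp (by fun_prop)).pow_const 2).mul (hψ.pow_const 2))
  refine le_trans ?_ (add_le_add (hM.lintegral_kernel_sum_le hΛ0 hΛ hh t
    (φ := fun z => ENNReal.ofReal (f z ^ 2)) (ψ := fun s u => ENNReal.ofReal (ψ s u ^ 2))
    (by fun_prop) (hψ.pow_const 2).ennreal_ofReal) (hM.lintegral_sq_sum_sub_le hh t hf hψ))
  have hm3 : Measurable fun ω => ENNReal.ofReal
      |(∑ j ∈ Finset.range (L ω), f ((T j ω - t) / h) * ψ (T j ω) (U ω)) ^ 2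
        - ∑ j ∈ Finset.range (L ω), f ((T j ω - t) / h) ^ 2 * ψ (T j ω) (U ω) ^ 2| :=
    ((hm1.pow_const 2).sub hm2).abs.ennreal_ofReal
  rw [← lintegral_add_right _ hm3]
  refine lintegral_mono fun ω => ?_
  have e : ∑ j ∈ Finset.range (L ω), ENNReal.ofReal (f ((T j ω - t) / h) ^ 2)
        * ENNReal.ofReal (ψ (T j ω) (U ω) ^ 2)
      = ENNReal.ofReal (∑ j ∈ Finset.range (L ω),
        f ((T j ω - t) / h) ^ 2 * ψ (T j ω) (U ω) ^ 2) := by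
    rw [ENNReal.ofReal_sum_of_nonneg fun j _ => by positivity]
    exact Finset.sum_congr rfl fun j _ => (ENNReal.ofReal_mul (by positivity)).symm
  rw [e, ← ENNReal.ofReal_add (Finset.sum_nonneg fun j _ => by positivity) (abs_nonneg _)]
  refine ENNReal.ofReal_le_ofReal ?_
  linarith [le_abs_self ((∑ j ∈ Finset.range (L ω), f ((T j ω - t) / h) * ψ (T j ω) (U ω)) ^ 2
        - ∑ j ∈ Finset.range (L ω), f ((T j ω - t) / h) ^ 2 * ψ (T j ω) (U ω) ^ 2)]

end IsMarked

lemma integrable_of_lintegral_abs_le {α : Type*} [MeasurableSpace α] {μ : Measure α} {Y : α → ℝ}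
    (hY : AEStronglyMeasurable Y μ) {b : ℝ} (hb : 0 ≤ b)
    (h : ∫⁻ x, ENNReal.ofReal |Y x| ∂μ ≤ ENNReal.ofReal b) :
    Integrable Y μ ∧ ∫ x, |Y x| ∂μ ≤ b := by
  refine ⟨⟨hY, ?_⟩, ?_⟩
  · rw [hasFiniteIntegral_iff_norm]
    exact h.trans_lt ENNReal.ofReal_lt_top
  · rw [integral_eq_lintegral_of_nonneg_ae (ae_of_all _ fun _ => abs_nonneg _) hY.norm]
    exact (ENNReal.toReal_mono ENNReal.ofReal_ne_top h).trans (ENNReal.toReal_ofReal hb).le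

lemma memLp_two_of_lintegral_sq_le {α : Type*} [MeasurableSpace α] {μ : Measure α} {Y : α → ℝ}
    (hY : AEStronglyMeasurable Y μ) {b : ℝ} (hb : 0 ≤ b)
    (h : ∫⁻ x, ENNReal.ofReal (Y x ^ 2) ∂μ ≤ ENNReal.ofReal b) :
    MemLp Y 2 μ ∧ ∫ x, Y x ^ 2 ∂μ ≤ b := by
  have h1 := integrable_of_lintegral_abs_le (Y := fun x => Y x ^ 2)
    (hY.aemeasurable.pow_const 2).aestronglyMeasurable hb (by simpa using h)
  exact ⟨(memLp_two_iff_integrable_sq hY).2 h1.1, by simpa using h1.2⟩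

lemma lintegral_ofReal_abs {α : Type*} [MeasurableSpace α] {μ : Measure α} {f : α → ℝ}
    (hf : Integrable f μ) :
    ∫⁻ x, ENNReal.ofReal |f x| ∂μ = ENNReal.ofReal (∫ x, |f x| ∂μ) :=
  (ofReal_integral_eq_lintegral_ofReal hf.abs (ae_of_all _ fun _ => abs_nonneg _)).symm

lemma lintegral_ofReal_sq {α : Type*} [MeasurableSpace α] {μ : Measure α} {f : α → ℝ}
    (hf : Integrable (fun x => f x ^ 2) μ) :
    ∫⁻ x, ENNReal.ofReal (f x ^ 2) ∂μ = ENNReal.ofReal (∫ x, f x ^ 2 ∂μ) :=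
  (ofReal_integral_eq_lintegral_ofReal hf (ae_of_all _ fun _ => sq_nonneg _)).symm

/-- The sum over the points of a marked point process in a window of width `h` about `t`. -/
def kernelSum {Ω E : Type*} (U : Ω → E) (L : Ω → ℕ) (T : ℕ → Ω → ℝ) (h t : ℝ) (f : ℝ → ℝ)
    (ψ : ℝ → E → ℝ) (ω : Ω) : ℝ :=
  ∑ j ∈ Finset.range (L ω), f ((T j ω - t) / h) * ψ (T j ω) (U ω)

namespace IsMarked

variable {Ω E : Type*} [MeasurableSpace Ω] [MeasurableSpace E] {P : Measure Ω}
  {U : Ω → E} {L : Ω → ℕ} {T : ℕ → Ω → ℝ} {ℓ : ℝ → ℝ} {C : ℝ≥0}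

lemma measurable_kernelSum (hM : IsMarked P U L T ℓ C) (h t : ℝ) {f : ℝ → ℝ} (hf : Measurable f)
    {ψ : ℝ → E → ℝ} (hψ : Measurable fun z : ℝ × E => ψ z.1 z.2) :
    Measurable (kernelSum U L T h t f ψ) :=
  hM.measurable_sum (g := fun s u => f ((s - t) / h) * ψ s u) ((hf.comp (by fun_prop)).mul hψ)

lemma integral_sum_of_nonneg (hM : IsMarked P U L T ℓ C) [SFinite P]
    (hℓ : ContinuousOn ℓ (Set.Icc 0 1)) (hℓ0 : ∀ s ∈ Set.Icc (0 : ℝ) 1, 0 ≤ ℓ s)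
    {g : ℝ → E → ℝ} (hg : Measurable fun z : ℝ × E => g z.1 z.2) (hg0 : ∀ s u, 0 ≤ g s u)
    (hgi : ∀ s ∈ Set.Icc (0 : ℝ) 1, Integrable (fun ω => g s (U ω)) P)
    (hsum : Integrable (fun ω => ∑ j ∈ Finset.range (L ω), g (T j ω) (U ω)) P) :
    IntegrableOn (fun s => ℓ s * ∫ ω, g s (U ω) ∂P) (Set.Icc 0 1) ∧
    ∫ ω, ∑ j ∈ Finset.range (L ω), g (T j ω) (U ω) ∂P
      = ∫ s in Set.Icc (0 : ℝ) 1, ℓ s * ∫ ω, g s (U ω) ∂P := by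
  have hnn : ∀ ω, 0 ≤ ∑ j ∈ Finset.range (L ω), g (T j ω) (U ω) :=
    fun ω => Finset.sum_nonneg fun j _ => hg0 _ _
  have h1 := hM.campbell (fun s u => ENNReal.ofReal (g s u)) hg.ennreal_ofReal
  have h2 : ∫⁻ s in Set.Icc (0 : ℝ) 1, ENNReal.ofReal (ℓ s) * ∫⁻ ω, ENNReal.ofReal (g s (U ω)) ∂P
      = ∫⁻ s in Set.Icc (0 : ℝ) 1, ENNReal.ofReal (ℓ s * ∫ ω, g s (U ω) ∂P) := by
    refine setLIntegral_congr_fun measurableSet_Icc fun s hs => ?_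
    rw [ENNReal.ofReal_mul (hℓ0 s hs), ofReal_integral_eq_lintegral_ofReal (hgi s hs)
      (ae_of_all _ fun ω => hg0 _ _)]
  have h3 : ∫⁻ ω, ENNReal.ofReal (∑ j ∈ Finset.range (L ω), g (T j ω) (U ω)) ∂P
      = ∫⁻ s in Set.Icc (0 : ℝ) 1, ENNReal.ofReal (ℓ s * ∫ ω, g s (U ω) ∂P) := by
    rw [← h2, ← h1]
    exact lintegral_congr fun ω => ENNReal.ofReal_sum_of_nonneg fun j _ => hg0 _ _
  have hm : AEStronglyMeasurable (fun s => ℓ s * ∫ ω, g s (U ω) ∂P)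
      (volume.restrict (Set.Icc 0 1)) := by
    refine (hℓ.aestronglyMeasurable measurableSet_Icc).mul ?_
    exact (StronglyMeasurable.integral_prod_right' (ν := P)
      (hg.comp (measurable_id.prodMap hM.measurable_mark)).stronglyMeasurable).aestronglyMeasurable
  have h0 : ∀ᵐ s ∂(volume.restrict (Set.Icc (0 : ℝ) 1)), 0 ≤ ℓ s * ∫ ω, g s (U ω) ∂P :=
    (ae_restrict_iff' measurableSet_Icc).2 (ae_of_all _ fun s hs =>
      mul_nonneg (hℓ0 s hs) (integral_nonneg fun ω => hg0 _ _))
  refine ⟨⟨hm, ?_⟩, ?_⟩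
  · rw [hasFiniteIntegral_iff_ofReal h0, ← h3]
    have := hsum.2
    rwa [hasFiniteIntegral_iff_ofReal (ae_of_all _ hnn)] at this
  · rw [integral_eq_lintegral_of_nonneg_ae (ae_of_all _ hnn) hsum.1, h3,
      integral_eq_lintegral_of_nonneg_ae h0 hm]

lemma integral_sum (hM : IsMarked P U L T ℓ C) [SFinite P]
    (hℓ : ContinuousOn ℓ (Set.Icc 0 1)) (hℓ0 : ∀ s ∈ Set.Icc (0 : ℝ) 1, 0 ≤ ℓ s)
    {g : ℝ → E → ℝ} (hg : Measurable fun z : ℝ × E => g z.1 z.2)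
    (hgi : ∀ s ∈ Set.Icc (0 : ℝ) 1, Integrable (fun ω => g s (U ω)) P)
    (hsum : Integrable (fun ω => ∑ j ∈ Finset.range (L ω), |g (T j ω) (U ω)|) P) :
    ∫ ω, ∑ j ∈ Finset.range (L ω), g (T j ω) (U ω) ∂P
      = ∫ s in Set.Icc (0 : ℝ) 1, ℓ s * ∫ ω, g s (U ω) ∂P := by
  have hi : ∀ (f : ℝ → ℝ), Measurable f → (∀ x, 0 ≤ f x) → (∀ x, f x ≤ |x|) →
      (∀ s ∈ Set.Icc (0 : ℝ) 1, Integrable (fun ω => f (g s (U ω))) P) ∧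
      Integrable (fun ω => ∑ j ∈ Finset.range (L ω), f (g (T j ω) (U ω))) P := by
    intro f hf hf0 hfle
    refine ⟨fun s hs => (hgi s hs).mono (hf.comp_aemeasurable
        (hgi s hs).aemeasurable).aestronglyMeasurable (ae_of_all _ fun ω => ?_),
      hsum.mono (hM.measurable_sum (g := fun s u => f (g s u))
        (hf.comp hg)).aestronglyMeasurable (ae_of_all _ fun ω => ?_)⟩
    · rw [Real.norm_of_nonneg (hf0 _)]; exact hfle _
    · rw [Real.norm_of_nonneg (Finset.sum_nonneg fun j _ => hf0 _),
        Real.norm_of_nonneg (Finset.sum_nonneg fun j _ => abs_nonneg _)]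
      exact Finset.sum_le_sum fun j _ => hfle _
  obtain ⟨p1, p2⟩ := hi (fun x => max x 0) (by fun_prop) (fun x => le_max_right _ _)
    (fun x => max_le (le_abs_self x) (abs_nonneg x))
  obtain ⟨n1, n2⟩ := hi (fun x => max (-x) 0) (by fun_prop) (fun x => le_max_right _ _)
    (fun x => max_le (neg_le_abs x) (abs_nonneg x))
  obtain ⟨p3, p4⟩ := hM.integral_sum_of_nonneg hℓ hℓ0 (g := fun s u => max (g s u) 0)
    (by fun_prop) (fun _ _ => le_max_right _ _) p1 p2
  obtain ⟨n3, n4⟩ := hM.integral_sum_of_nonneg hℓ hℓ0 (g := fun s u => max (-g s u) 0)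
    (by fun_prop) (fun _ _ => le_max_right _ _) n1 n2
  have e : ∀ x : ℝ, x = max x 0 - max (-x) 0 := fun x => (max_zero_sub_eq_self x).symm
  calc ∫ ω, ∑ j ∈ Finset.range (L ω), g (T j ω) (U ω) ∂P
      = ∫ ω, (∑ j ∈ Finset.range (L ω), max (g (T j ω) (U ω)) 0
          - ∑ j ∈ Finset.range (L ω), max (-g (T j ω) (U ω)) 0) ∂P := by
        refine integral_congr_ae (ae_of_all _ fun ω => ?_)
        simp only [← Finset.sum_sub_distrib, max_zero_sub_eq_self]
    _ = ∫ s in Set.Icc (0 : ℝ) 1, (ℓ s * ∫ ω, max (g s (U ω)) 0 ∂P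
          - ℓ s * ∫ ω, max (-g s (U ω)) 0 ∂P) := by
        rw [integral_sub p2 n2, p4, n4, ← integral_sub p3 n3]
    _ = _ := by
        refine setIntegral_congr_fun measurableSet_Icc fun s hs => ?_
        rw [← mul_sub, ← integral_sub (p1 s hs) (n1 s hs)]
        simp only [max_zero_sub_eq_self]

variable {Λ : ℝ} {h : ℝ}

lemma integral_abs_kernelSum_le (hM : IsMarked P U L T ℓ C) [SFinite P] (hΛ0 : 0 ≤ Λ)
    (hΛ : ∀ s ∈ Set.Icc (0 : ℝ) 1, ℓ s ≤ Λ) (hh : 0 < h) (t : ℝ) {f : ℝ → ℝ}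
    (hf : Measurable f) {ψ : ℝ → E → ℝ} (hψ : Measurable fun z : ℝ × E => ψ z.1 z.2)
    {c : ℝ} (hc0 : 0 ≤ c)
    (hc : kernelAvg h t (fun z => ENNReal.ofReal |f z|)
      (fun s => ∫⁻ ω, ENNReal.ofReal |ψ s (U ω)| ∂P) ≤ ENNReal.ofReal c) :
    Integrable (kernelSum U L T h t f ψ) P ∧
      ∫ ω, |kernelSum U L T h t f ψ ω| ∂P ≤ Λ * h * c := by
  refine integrable_of_lintegral_abs_le (hM.measurable_kernelSum h t hf hψ).aestronglyMeasurable
    (by positivity) ?_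
  have h1 := hM.lintegral_kernel_sum_le hΛ0 hΛ hh t (φ := fun z => ENNReal.ofReal |f z|)
    (ψ := fun s u => ENNReal.ofReal |ψ s u|) (by fun_prop) hψ.abs.ennreal_ofReal
  rw [ENNReal.ofReal_mul (by positivity)]
  refine ((lintegral_mono fun ω => ?_).trans (h1.trans (mul_le_mul_right hc _)))
  refine (ENNReal.ofReal_le_ofReal (Finset.abs_sum_le_sum_abs _ _)).trans ?_
  rw [ENNReal.ofReal_sum_of_nonneg fun j _ => abs_nonneg _]
  refine Finset.sum_le_sum fun j _ => ?_
  rw [abs_mul, ENNReal.ofReal_mul (abs_nonneg _)]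

lemma integral_abs_kernelSum_le_of_bound (hM : IsMarked P U L T ℓ C) [SFinite P] (hΛ0 : 0 ≤ Λ)
    (hΛ : ∀ s ∈ Set.Icc (0 : ℝ) 1, ℓ s ≤ Λ) (hh : 0 < h) (t : ℝ) {f : ℝ → ℝ}
    (hf : Measurable f) (hfi : Integrable f) {ψ : ℝ → E → ℝ}
    (hψ : Measurable fun z : ℝ × E => ψ z.1 z.2) {b : ℝ} (hb0 : 0 ≤ b)
    (hb : ∀ s ∈ Set.Icc (0 : ℝ) 1, ∫⁻ ω, ENNReal.ofReal |ψ s (U ω)| ∂P ≤ ENNReal.ofReal b) :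
    Integrable (kernelSum U L T h t f ψ) P ∧
      ∫ ω, |kernelSum U L T h t f ψ ω| ∂P ≤ Λ * h * ((∫ z, |f z|) * b) := by
  have h0 : 0 ≤ ∫ z, |f z| := integral_nonneg fun _ => abs_nonneg _
  refine hM.integral_abs_kernelSum_le hΛ0 hΛ hh t hf hψ (by positivity) ?_
  rw [ENNReal.ofReal_mul h0, ← lintegral_ofReal_abs hfi]
  exact kernelAvg_le (by fun_prop) hb

lemma integral_sq_kernelSum_le (hM : IsMarked P U L T ℓ C) [SFinite P] (hΛ0 : 0 ≤ Λ)
    (hΛ : ∀ s ∈ Set.Icc (0 : ℝ) 1, ℓ s ≤ Λ) (hh : 0 < h) (t : ℝ) {f : ℝ → ℝ}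
    (hf : Measurable f) (hfi : Integrable f) {ψ : ℝ → E → ℝ}
    (hψ : Measurable fun z : ℝ × E => ψ z.1 z.2)
    {c b : ℝ} (hc0 : 0 ≤ c) (hb0 : 0 ≤ b)
    (hc : kernelAvg h t (fun z => ENNReal.ofReal (f z ^ 2))
      (fun s => ∫⁻ ω, ENNReal.ofReal (ψ s (U ω) ^ 2) ∂P) ≤ ENNReal.ofReal c)
    (hb : ∀ s ∈ Set.Icc (0 : ℝ) 1, ∫⁻ ω, ENNReal.ofReal (ψ s (U ω) ^ 2) ∂P ≤ ENNReal.ofReal b) :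
    MemLp (kernelSum U L T h t f ψ) 2 P ∧
      ∫ ω, kernelSum U L T h t f ψ ω ^ 2 ∂P ≤ Λ * h * c + C * (h * ∫ z, |f z|) ^ 2 * b := by
  have h0 : 0 ≤ ∫ z, |f z| := integral_nonneg fun _ => abs_nonneg _
  refine memLp_two_of_lintegral_sq_le (hM.measurable_kernelSum h t hf hψ).aestronglyMeasurable
    (by positivity) ?_
  refine (hM.lintegral_sq_sum_le hΛ0 hΛ hh t hf hψ).trans ?_
  rw [ENNReal.ofReal_add (by positivity) (by positivity),
    ENNReal.ofReal_mul (by positivity : 0 ≤ Λ * h)]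
  refine add_le_add (mul_le_mul_right hc _) ?_
  have h1 := kernelAvg_le (h := h) (t := t) (φ := fun z => ENNReal.ofReal |f z|) (by fun_prop) hb
  rw [lintegral_ofReal_abs hfi, ← ENNReal.ofReal_mul h0] at h1
  calc _ ≤ (C : ℝ≥0∞) * (ENNReal.ofReal h * ENNReal.ofReal ((∫ z, |f z|) * b))
        * (ENNReal.ofReal h * ENNReal.ofReal (∫ z, |f z|)) := by
        rw [lintegral_ofReal_abs hfi]
        gcongr
    _ = _ := by
        rw [← ENNReal.ofReal_mul hh.le, ← ENNReal.ofReal_mul hh.le,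
          ← ENNReal.ofReal_coe_nnreal, ← ENNReal.ofReal_mul (by positivity),
          ← ENNReal.ofReal_mul (by positivity)]
        congr 1
        ring

lemma integral_abs_sq_kernelSum_sub_le (hM : IsMarked P U L T ℓ C) [SFinite P]
    (hh : 0 < h) (t : ℝ) {f : ℝ → ℝ}
    (hf : Measurable f) (hfi : Integrable f) {ψ : ℝ → E → ℝ}
    (hψ : Measurable fun z : ℝ × E => ψ z.1 z.2) {b : ℝ} (hb0 : 0 ≤ b)
    (hb : ∀ s ∈ Set.Icc (0 : ℝ) 1, ∫⁻ ω, ENNReal.ofReal (ψ s (U ω) ^ 2) ∂P ≤ ENNReal.ofReal b) :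
    Integrable (fun ω => kernelSum U L T h t f ψ ω ^ 2
        - kernelSum U L T h t (fun z => f z ^ 2) (fun s u => ψ s u ^ 2) ω) P ∧
      ∫ ω, |kernelSum U L T h t f ψ ω ^ 2
        - kernelSum U L T h t (fun z => f z ^ 2) (fun s u => ψ s u ^ 2) ω| ∂P
      ≤ C * (h * ∫ z, |f z|) ^ 2 * b := by
  have h0 : 0 ≤ ∫ z, |f z| := integral_nonneg fun _ => abs_nonneg _
  refine integrable_of_lintegral_abs_le
    (((hM.measurable_kernelSum h t hf hψ).pow_const 2).sub
      (hM.measurable_kernelSum h t (hf.pow_const 2) (hψ.pow_const 2))).aestronglyMeasurable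
    (by positivity) ?_
  refine (hM.lintegral_sq_sum_sub_le hh t hf hψ).trans ?_
  have h1 := kernelAvg_le (h := h) (t := t) (φ := fun z => ENNReal.ofReal |f z|) (by fun_prop) hb
  rw [lintegral_ofReal_abs hfi, ← ENNReal.ofReal_mul h0] at h1
  calc _ ≤ (C : ℝ≥0∞) * (ENNReal.ofReal h * ENNReal.ofReal ((∫ z, |f z|) * b))
        * (ENNReal.ofReal h * ENNReal.ofReal (∫ z, |f z|)) := by
        rw [lintegral_ofReal_abs hfi]
        gcongr
    _ = _ := by
        rw [← ENNReal.ofReal_mul hh.le, ← ENNReal.ofReal_mul hh.le,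
          ← ENNReal.ofReal_coe_nnreal, ← ENNReal.ofReal_mul (by positivity),
          ← ENNReal.ofReal_mul (by positivity)]
        congr 1
        ring

lemma integral_kernelSum (hM : IsMarked P U L T ℓ C) [SFinite P] (hΛ0 : 0 ≤ Λ)
    (hΛ : ∀ s ∈ Set.Icc (0 : ℝ) 1, ℓ s ≤ Λ) (hℓ : ContinuousOn ℓ (Set.Icc 0 1))
    (hℓ0 : ∀ s ∈ Set.Icc (0 : ℝ) 1, 0 ≤ ℓ s) (hh : 0 < h) (t : ℝ) {f : ℝ → ℝ}
    (hf : Measurable f) (hfi : Integrable f) {ψ : ℝ → E → ℝ}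
    (hψ : Measurable fun z : ℝ × E => ψ z.1 z.2) {b : ℝ} (hb0 : 0 ≤ b)
    (hb : ∀ s ∈ Set.Icc (0 : ℝ) 1, ∫⁻ ω, ENNReal.ofReal |ψ s (U ω)| ∂P ≤ ENNReal.ofReal b) :
    ∫ ω, kernelSum U L T h t f ψ ω ∂P
      = h * ∫ z, f z * (Set.Icc (0 : ℝ) 1).indicator (fun s => ℓ s * ∫ ω, ψ s (U ω) ∂P)
        (t + h * z) := by
  have habs := (hM.integral_abs_kernelSum_le_of_bound hΛ0 hΛ hh t (f := fun z => |f z|)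
    (by fun_prop) hfi.abs (ψ := fun s u => |ψ s u|) hψ.abs hb0 (by simpa using hb)).1
  have hi : ∀ s ∈ Set.Icc (0 : ℝ) 1, Integrable (fun ω => ψ s (U ω)) P := fun s hs =>
    (integrable_of_lintegral_abs_le (hψ.comp (measurable_const.prodMk
      hM.measurable_mark)).aestronglyMeasurable hb0 (hb s hs)).1
  have h1 := hM.integral_sum hℓ hℓ0 (g := fun s u => f ((s - t) / h) * ψ s u)
    ((hf.comp (by fun_prop)).mul hψ) (fun s hs => (hi s hs).const_mul _)
    (by simpa only [kernelSum, abs_mul] using! habs)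
  have h2 : ∀ G : ℝ → ℝ, ∫ s, G s = h * ∫ z, G (t + h * z) := fun G => by
    have e1 := Measure.integral_comp_mul_left (fun s => G (t + s)) h
    have e2 : ∫ s, G (t + s) = ∫ s, G s := integral_add_left_eq_self G t
    rw [e1, e2, abs_of_pos (inv_pos.2 hh), smul_eq_mul, ← mul_assoc, mul_inv_cancel₀ hh.ne',
      one_mul]
  simp only [kernelSum]
  rw [h1, ← integral_indicator measurableSet_Icc, h2]
  congr 1
  refine integral_congr_ae (ae_of_all _ fun z => ?_)
  have e : (t + h * z - t) / h = z := by field_simp; ring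
  by_cases hz : t + h * z ∈ Set.Icc (0 : ℝ) 1
  · simp only [Set.indicator_of_mem hz, e, integral_const_mul]
    ring
  · simp only [Set.indicator_of_notMem hz, mul_zero]

end IsMarked

/-- Truncation of a real number at the level `M`. -/
def trunc (M x : ℝ) : ℝ := if |x| ≤ M then x else 0

lemma measurable_trunc (M : ℝ) : Measurable (trunc M) :=
  Measurable.ite (measurableSet_le (by fun_prop) measurable_const) measurable_id measurable_const

lemma abs_trunc_le {M : ℝ} (hM : 0 ≤ M) (x : ℝ) : |trunc M x| ≤ M := by
  unfold trunc; split_ifs with h <;> simp [h, hM]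

lemma abs_trunc_le_abs (M x : ℝ) : |trunc M x| ≤ |x| := by
  unfold trunc; split_ifs <;> simp

lemma abs_sub_trunc_le_abs (M x : ℝ) : |x - trunc M x| ≤ |x| := by
  unfold trunc; split_ifs <;> simp

/-- Either the truncated value or the remainder is zero, so there is no cross term. -/
lemma sq_eq_trunc_sq_add (M x : ℝ) : x ^ 2 = trunc M x ^ 2 + (x - trunc M x) ^ 2 := by
  unfold trunc; split_ifs <;> simp

lemma sub_trunc_eventually (x : ℝ) : ∀ᶠ M : ℕ in atTop, x - trunc M x = 0 := by
  filter_upwards [eventually_ge_atTop ⌈|x|⌉₊] with M hM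
  have : |x| ≤ M := (Nat.le_ceil _).trans (by exact_mod_cast hM)
  simp [trunc, this]

lemma tendsto_integral_sub_trunc {α : Type*} [MeasurableSpace α] {μ : Measure α} {f : α → ℝ}
    (hf : Integrable f μ) :
    Tendsto (fun M : ℕ => ∫ x, |f x - trunc M (f x)| ∂μ) atTop (𝓝 0) := by
  have := tendsto_integral_of_dominated_convergence (μ := μ)
    (F := fun (M : ℕ) x => |f x - trunc M (f x)|) (f := fun _ => (0 : ℝ)) (fun x => |f x|)
    (fun M => (hf.aemeasurable.sub
      ((measurable_trunc M).comp_aemeasurable hf.aemeasurable)).abs.aestronglyMeasurable)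
    hf.abs (fun M => ae_of_all _ fun x => by simpa using abs_sub_trunc_le_abs M (f x))
    (ae_of_all _ fun x => tendsto_const_nhds.congr' (by
      filter_upwards [sub_trunc_eventually (f x)] with M hM
      simp [hM]))
  simpa using this

lemma tendsto_integral_sq_sub_trunc {α : Type*} [MeasurableSpace α] {μ : Measure α} {f : α → ℝ}
    (hfm : AEMeasurable f μ) (hf : Integrable (fun x => f x ^ 2) μ) :
    Tendsto (fun M : ℕ => ∫ x, (f x - trunc M (f x)) ^ 2 ∂μ) atTop (𝓝 0) := by
  have := tendsto_integral_of_dominated_convergence (μ := μ)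
    (F := fun (M : ℕ) x => (f x - trunc M (f x)) ^ 2) (f := fun _ => (0 : ℝ)) (fun x => f x ^ 2)
    (fun M => ((hfm.sub
      ((measurable_trunc M).comp_aemeasurable hfm)).pow_const 2).aestronglyMeasurable)
    hf (fun M => ae_of_all _ fun x => by
      rw [Real.norm_of_nonneg (sq_nonneg _)]
      exact sq_le_sq.2 (abs_sub_trunc_le_abs M (f x)))
    (ae_of_all _ fun x => tendsto_const_nhds.congr' (by
      filter_upwards [sub_trunc_eventually (f x)] with M hM
      simp [hM]))
  simpa using this

/-! ### Law of large numbers and variance bound for kernel sums. -/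

section Array

variable {Ω E : Type*} [MeasurableSpace Ω] [MeasurableSpace E] {P : Measure Ω}
  {U : ℕ → Ω → E} {L : ℕ → Ω → ℕ} {T : ℕ → ℕ → Ω → ℝ} {ℓ : ℝ → ℝ}
  {C : ℝ≥0} {Λ t : ℝ} {h : ℕ → ℝ} {f : ℝ → ℝ}

lemma iIndepFun_kernelSum (hind : iIndepFun (fun i ω =>
      (pointMeasure (L i ω) (fun j => T i j ω)).map (fun s => (s, U i ω))) P)
    (c h t : ℝ) (hf : Measurable f) {ψ : ℕ → ℝ → E → ℝ}
    (hψ : ∀ i, Measurable fun z : ℝ × E => ψ i z.1 z.2) :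
    iIndepFun (fun i ω => c * kernelSum (U i) (L i) (T i) h t f (ψ i) ω) P :=
  (iIndepFun_sum_of_marked hind (g := fun i s u => f ((s - t) / h) * ψ i s u)
    fun i => (hf.comp (by fun_prop)).mul (hψ i)).comp (fun _ x => c * x)
    fun _ => measurable_const_mul c

variable [IsProbabilityMeasure P]

/-- Law of large numbers for local averages over independent marked point processes. -/
theorem tendsto_integral_abs_average_kernelSum_sub
    (hM : ∀ i, IsMarked P (U i) (L i) (T i) ℓ C)
    (hind : iIndepFun (fun i ω =>
      (pointMeasure (L i ω) (fun j => T i j ω)).map (fun s => (s, U i ω))) P)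
    (hΛ0 : 0 ≤ Λ) (hΛ : ∀ s ∈ Set.Icc (0 : ℝ) 1, ℓ s ≤ Λ) (hℓ : ContinuousOn ℓ (Set.Icc 0 1))
    (hℓ0 : ∀ s ∈ Set.Icc (0 : ℝ) 1, 0 ≤ ℓ s) (ht : t ∈ Set.Ioo (0 : ℝ) 1)
    (hh : ∀ n, 0 < h n) (hh0 : Tendsto h atTop (𝓝 0))
    (hnh : Tendsto (fun n : ℕ => (n : ℝ) * h n) atTop atTop)
    (hf : Measurable f) (hfi : Integrable f) {V : ℕ → ℝ → E → ℝ}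
    (hV : ∀ i, Measurable fun z : ℝ × E => V i z.1 z.2) {v : ℝ → ℝ}
    (hv : ContinuousOn v (Set.Icc 0 1))
    (hVv : ∀ i, ∀ s ∈ Set.Icc (0 : ℝ) 1, ∫ ω, V i s (U i ω) ∂P = v s) {b : ℝ} (hb0 : 0 ≤ b)
    (hb : ∀ i, ∀ s ∈ Set.Icc (0 : ℝ) 1,
      ∫⁻ ω, ENNReal.ofReal |V i s (U i ω)| ∂P ≤ ENNReal.ofReal b)
    {w : ℝ → ℝ≥0∞} (hw : Tendsto w (𝓝 t) (𝓝 0)) {B : ℝ≥0}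
    (hwB : ∀ s ∈ Set.Icc (0 : ℝ) 1, w s ≤ B)
    (hVw : ∀ i, ∀ s ∈ Set.Icc (0 : ℝ) 1,
      ∫⁻ ω, ENNReal.ofReal |V i s (U i ω) - V i t (U i ω)| ∂P ≤ w s)
    (hUI : ∀ η > 0, ∃ M : ℝ, 0 ≤ M ∧ ∀ i,
      ∫⁻ ω, ENNReal.ofReal |V i t (U i ω) - trunc M (V i t (U i ω))| ∂P ≤ ENNReal.ofReal η) :
    Tendsto (fun n : ℕ => ∫ ω, |(n : ℝ)⁻¹ * ∑ i ∈ Finset.range n,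
        (h n)⁻¹ * kernelSum (U i) (L i) (T i) (h n) t f (V i) ω
        - (∫ z, f z) * (ℓ t * v t)| ∂P) atTop (𝓝 0) := by
  have hVt : ∀ i, Measurable fun z : ℝ × E => V i t z.2 := fun i =>
    (hV i).comp (measurable_const.prodMk measurable_snd)
  have hint : ∀ n i, Integrable
      (fun ω => (h n)⁻¹ * kernelSum (U i) (L i) (T i) (h n) t f (V i) ω) P := fun n i =>
    ((hM i).integral_abs_kernelSum_le_of_bound hΛ0 hΛ (hh n) t hf hfi (hV i) hb0
      (hb i)).1.const_mul _
  refine tendsto_integral_abs_average_sub hint fun η hη => ?_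
  set I : ℝ := ∫ z, |f z| with hI
  have hI0 : 0 ≤ I := integral_nonneg fun _ => abs_nonneg _
  -- Three replacements at a cost of `η / 3` each: `V` at time `s` by `V` at time `t`, this by its
  -- truncation, and `f` by its truncation. Each cost is a first moment of a kernel sum divided by
  -- `h`; the added ones in the denominators avoid division by zero.
  obtain ⟨M, hM0, hMt⟩ := hUI (η / (3 * (Λ + 1) * (I + 1))) (by positivity)
  obtain ⟨M', hM'⟩ := ((tendsto_integral_sub_trunc hfi).eventually_le_const
    (show (0 : ℝ) < η / (3 * (Λ + 1) * (M + 1)) by positivity)).exists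
  set f' : ℝ → ℝ := fun z => trunc M' (f z) with hf'
  have hf'm : Measurable f' := (measurable_trunc M').comp hf
  have hf'i : Integrable f' := hfi.mono hf'm.aestronglyMeasurable
    (ae_of_all _ fun z => abs_trunc_le_abs M' (f z))
  have hf'2 : Integrable fun z => f' z ^ 2 := by
    refine (hfi.abs.const_mul (M' : ℝ)).mono (hf'm.pow_const 2).aestronglyMeasurable
      (ae_of_all _ fun z => ?_)
    rw [norm_pow, sq, norm_mul, Real.norm_natCast, Real.norm_eq_abs, Real.norm_eq_abs, abs_abs]
    exact mul_le_mul (abs_trunc_le (by positivity) _) (abs_trunc_le_abs _ _) (abs_nonneg _)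
      (by positivity)
  set V' : ℕ → ℝ → E → ℝ := fun i _ u => trunc M (V i t u) with hV'
  have hV'm : ∀ i, Measurable fun z : ℝ × E => V' i z.1 z.2 := fun i =>
    (measurable_trunc M).comp (hVt i)
  have hV'2 : ∀ i, ∀ s ∈ Set.Icc (0 : ℝ) 1,
      ∫⁻ ω, ENNReal.ofReal (V' i s (U i ω) ^ 2) ∂P ≤ ENNReal.ofReal (M ^ 2) := fun i s _ => by
    refine (lintegral_mono (g := fun _ => ENNReal.ofReal (M ^ 2)) fun ω =>
      ENNReal.ofReal_le_ofReal ?_).trans (by simp)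
    rw [← sq_abs]
    exact pow_le_pow_left₀ (abs_nonneg _) (abs_trunc_le hM0 _) 2
  have hV'1 : ∀ i, ∀ s ∈ Set.Icc (0 : ℝ) 1,
      ∫⁻ ω, ENNReal.ofReal |V' i s (U i ω)| ∂P ≤ ENNReal.ofReal M := fun i s _ => by
    refine (lintegral_mono (g := fun _ => ENNReal.ofReal M) fun ω =>
      ENNReal.ofReal_le_ofReal (abs_trunc_le hM0 _)).trans (by simp)
  set c : ℝ := (∫ z, f' z ^ 2) * M ^ 2 with hc
  have hf'20 : 0 ≤ ∫ z, f' z ^ 2 := integral_nonneg fun _ => sq_nonneg _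
  have hc0 : 0 ≤ c := by positivity
  -- With weights and marks both bounded, the second moment of the kernel sum divided by `h` is of
  -- order `1/h`, hence `o(n)` because `n h → ∞`. The weights `f` themselves need not be
  -- square-integrable.
  have hL2 : ∀ n i, MemLp (kernelSum (U i) (L i) (T i) (h n) t f' (V' i)) 2 P ∧
      ∫ ω, kernelSum (U i) (L i) (T i) (h n) t f' (V' i) ω ^ 2 ∂P
        ≤ Λ * h n * c + C * (h n * ∫ z, |f' z|) ^ 2 * M ^ 2 := fun n i => by
    refine (hM i).integral_sq_kernelSum_le hΛ0 hΛ (hh n) t hf'm hf'i (hV'm i) hc0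
      (sq_nonneg M) ?_ (hV'2 i)
    rw [hc, ENNReal.ofReal_mul hf'20, ← lintegral_ofReal_sq hf'2]
    exact kernelAvg_le (by fun_prop) (hV'2 i)
  refine ⟨fun n i ω => (h n)⁻¹ * kernelSum (U i) (L i) (T i) (h n) t f' (V' i) ω,
    fun n => iIndepFun_kernelSum hind _ _ _ hf'm hV'm, fun n i => (hL2 n i).1.const_mul _, ?_⟩
  have hkA : ∀ᶠ n in atTop, kernelAvg (h n) t (fun z => ENNReal.ofReal |f z|) w
      ≤ ENNReal.ofReal (η / (3 * (Λ + 1))) := by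
    refine (tendsto_kernelAvg_zero hh0 (by fun_prop) ?_ hwB hw).eventually_le_const
      (ENNReal.ofReal_pos.2 (by positivity))
    rw [lintegral_ofReal_abs hfi]
    exact ENNReal.ofReal_ne_top
  have hmean := (tendsto_integral_kernel (f := f) (g := fun s => ℓ s * v s) hh0 ht hfi
    (hℓ.mul hv)).eventually
    (Metric.closedBall_mem_nhds _ hη)
  have hn1 := hnh.eventually_ge_atTop (2 * (Λ * c) / η)
  have hn2 := tendsto_natCast_atTop_atTop.eventually_ge_atTop
    (2 * (C * (∫ z, |f' z|) ^ 2 * M ^ 2) / η)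
  filter_upwards [hkA, hmean, hn1, hn2] with n hkA hmean hn1 hn2 i
  have hhn := hh n
  refine ⟨?_, ?_, ?_⟩
  · obtain ⟨a1, a2⟩ := (hM i).integral_abs_kernelSum_le hΛ0 hΛ hhn t hf
      (ψ := fun s u => V i s u - V i t u) ((hV i).sub (hVt i))
      (c := η / (3 * (Λ + 1))) (by positivity) ((kernelAvg_mono (hVw i)).trans hkA)
    obtain ⟨b1, b2⟩ := (hM i).integral_abs_kernelSum_le_of_bound hΛ0 hΛ hhn t hf hfi
      (ψ := fun s u => V i t u - V' i s u) ((hVt i).sub (hV'm i))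
      (b := η / (3 * (Λ + 1) * (I + 1))) (by positivity) (fun s _ => hMt i)
    obtain ⟨c1, c2⟩ := (hM i).integral_abs_kernelSum_le_of_bound hΛ0 hΛ hhn t
      (f := fun z => f z - f' z) (hf.sub hf'm) (hfi.sub hf'i) (hV'm i) hM0 (hV'1 i)
    have hpt : ∀ ω, |(h n)⁻¹ * kernelSum (U i) (L i) (T i) (h n) t f (V i) ω
          - (h n)⁻¹ * kernelSum (U i) (L i) (T i) (h n) t f' (V' i) ω|
        ≤ (h n)⁻¹ * (|kernelSum (U i) (L i) (T i) (h n) t f (fun s u => V i s u - V i t u) ω|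
          + |kernelSum (U i) (L i) (T i) (h n) t f (fun s u => V i t u - V' i s u) ω|
          + |kernelSum (U i) (L i) (T i) (h n) t (fun z => f z - f' z) (V' i) ω|) := fun ω => by
      have e : kernelSum (U i) (L i) (T i) (h n) t f (V i) ω
          - kernelSum (U i) (L i) (T i) (h n) t f' (V' i) ω
          = kernelSum (U i) (L i) (T i) (h n) t f (fun s u => V i s u - V i t u) ω
          + kernelSum (U i) (L i) (T i) (h n) t f (fun s u => V i t u - V' i s u) ω
          + kernelSum (U i) (L i) (T i) (h n) t (fun z => f z - f' z) (V' i) ω := by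
        simp only [kernelSum, ← Finset.sum_add_distrib, ← Finset.sum_sub_distrib]
        exact Finset.sum_congr rfl fun j _ => by ring
      rw [← mul_sub, abs_mul, abs_of_pos (inv_pos.2 hhn), e]
      gcongr
      exact abs_add_three _ _ _
    have hab : Integrable (fun ω =>
        |kernelSum (U i) (L i) (T i) (h n) t f (fun s u => V i s u - V i t u) ω|
        + |kernelSum (U i) (L i) (T i) (h n) t f (fun s u => V i t u - V' i s u) ω|) P :=
      a1.abs.add b1.abs
    have habc : Integrable (fun ω =>
        |kernelSum (U i) (L i) (T i) (h n) t f (fun s u => V i s u - V i t u) ω|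
        + |kernelSum (U i) (L i) (T i) (h n) t f (fun s u => V i t u - V' i s u) ω|
        + |kernelSum (U i) (L i) (T i) (h n) t (fun z => f z - f' z) (V' i) ω|) P :=
      hab.add c1.abs
    refine (integral_mono ((hint n i).sub ((hL2 n i).1.integrable (by norm_num) |>.const_mul _)).abs
      (habc.const_mul _) hpt).trans ?_
    rw [integral_const_mul, integral_add hab c1.abs, integral_add a1.abs b1.abs,
      inv_mul_le_iff₀ hhn]
    have q1 : Λ * (η / (3 * (Λ + 1))) ≤ η / 3 := by
      rw [mul_div_assoc', div_le_div_iff₀ (by positivity) (by positivity)]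
      nlinarith
    have q2 : Λ * (I * (η / (3 * (Λ + 1) * (I + 1)))) ≤ η / 3 := by
      rw [mul_div_assoc', mul_div_assoc', div_le_div_iff₀ (by positivity) (by positivity)]
      nlinarith [mul_nonneg hΛ0 hI0, mul_nonneg hΛ0 hη.le, mul_nonneg hI0 hη.le]
    have q3 : Λ * ((∫ z, |f z - f' z|) * M) ≤ η / 3 := by
      have : (∫ z, |f z - f' z|) * M ≤ η / (3 * (Λ + 1) * (M + 1)) * M := by gcongr
      refine (mul_le_mul_of_nonneg_left this hΛ0).trans ?_
      rw [div_mul_eq_mul_div, mul_div_assoc', div_le_div_iff₀ (by positivity) (by positivity)]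
      nlinarith [mul_nonneg hΛ0 hM0, mul_nonneg hΛ0 hη.le, mul_nonneg hM0 hη.le]
    nlinarith
  · have hval := (hM i).integral_kernelSum hΛ0 hΛ hℓ hℓ0 hhn t hf hfi (hV i) hb0 (hb i)
    have hcongr : (Set.Icc (0 : ℝ) 1).indicator (fun s => ℓ s * ∫ ω, V i s (U i ω) ∂P)
        = (Set.Icc (0 : ℝ) 1).indicator (fun s => ℓ s * v s) :=
      Set.indicator_congr fun s hs => by rw [hVv i s hs]
    rw [integral_const_mul, hval, hcongr, ← mul_assoc, inv_mul_cancel₀ hhn.ne', one_mul]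
    simpa only [Metric.mem_closedBall, Real.dist_eq] using hmean
  · simp only [mul_pow]
    rw [integral_const_mul, inv_pow, inv_mul_le_iff₀ (by positivity)]
    have h3 : ∫ ω, kernelSum (U i) (L i) (T i) (h n) t f' (V' i) ω ^ 2 ∂P
        ≤ Λ * h n * c + C * (h n * ∫ z, |f' z|) ^ 2 * M ^ 2 := (hL2 n i).2
    rw [div_le_iff₀ hη] at hn1 hn2
    have h4 : Λ * h n * c + C * (h n * ∫ z, |f' z|) ^ 2 * M ^ 2 ≤ η * n * h n ^ 2 := by
      nlinarith [sq_nonneg (h n), mul_le_mul_of_nonneg_right hn1 hhn.le,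
        mul_le_mul_of_nonneg_right hn2 (sq_nonneg (h n))]
    exact h3.trans (h4.trans (le_of_eq (by ring)))

/-- Second moment of a normalized sum of independent local averages with mean zero. -/
theorem integral_sq_normalized_kernelSum_le
    (hM : ∀ i, IsMarked P (U i) (L i) (T i) ℓ C)
    (hind : iIndepFun (fun i ω =>
      (pointMeasure (L i ω) (fun j => T i j ω)).map (fun s => (s, U i ω))) P)
    (hΛ0 : 0 ≤ Λ) (hΛ : ∀ s ∈ Set.Icc (0 : ℝ) 1, ℓ s ≤ Λ) (hℓ : ContinuousOn ℓ (Set.Icc 0 1))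
    (hℓ0 : ∀ s ∈ Set.Icc (0 : ℝ) 1, 0 ≤ ℓ s) {h : ℝ} (hh : 0 < h)
    (hf : Measurable f) (hfi : Integrable f) {ψ : ℕ → ℝ → E → ℝ}
    (hψ : ∀ i, Measurable fun z : ℝ × E => ψ i z.1 z.2)
    (hψ0 : ∀ i, ∀ s ∈ Set.Icc (0 : ℝ) 1, ∫ ω, ψ i s (U i ω) ∂P = 0) {b c : ℝ} (hb0 : 0 ≤ b)
    (hc0 : 0 ≤ c)
    (hc : ∀ i, kernelAvg h t (fun z => ENNReal.ofReal (f z ^ 2))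
      (fun s => ∫⁻ ω, ENNReal.ofReal (ψ i s (U i ω) ^ 2) ∂P) ≤ ENNReal.ofReal c)
    (hb : ∀ i, ∀ s ∈ Set.Icc (0 : ℝ) 1,
      ∫⁻ ω, ENNReal.ofReal (ψ i s (U i ω) ^ 2) ∂P ≤ ENNReal.ofReal b) :
    (∀ i, MemLp (fun ω => (√h)⁻¹ * kernelSum (U i) (L i) (T i) h t f (ψ i) ω) 2 P) ∧
    (∀ i, ∫ ω, (√h)⁻¹ * kernelSum (U i) (L i) (T i) h t f (ψ i) ω ∂P = 0) ∧
    ∀ n : ℕ, ∫ ω, ((√(n : ℝ))⁻¹ * ∑ i ∈ Finset.range n,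
      (√h)⁻¹ * kernelSum (U i) (L i) (T i) h t f (ψ i) ω) ^ 2 ∂P
      ≤ Λ * c + C * h * (∫ z, |f z|) ^ 2 * b := by
  have hL2 := fun i => (hM i).integral_sq_kernelSum_le hΛ0 hΛ hh t hf hfi (hψ i) hc0 hb0 (hc i)
    (hb i)
  have h1 : ∀ i, ∀ s ∈ Set.Icc (0 : ℝ) 1,
      ∫⁻ ω, ENNReal.ofReal |ψ i s (U i ω)| ∂P ≤ ENNReal.ofReal (1 + b) := fun i s hs => by
    refine (lintegral_mono (g := fun ω => 1 + ENNReal.ofReal (ψ i s (U i ω) ^ 2))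
      fun ω => ?_).trans ?_
    · have : |ψ i s (U i ω)| ≤ 1 + ψ i s (U i ω) ^ 2 := by
        nlinarith [sq_nonneg (|ψ i s (U i ω)| - 1), sq_abs (ψ i s (U i ω))]
      refine (ENNReal.ofReal_le_ofReal this).trans ?_
      rw [ENNReal.ofReal_add zero_le_one (sq_nonneg _), ENNReal.ofReal_one]
    · rw [lintegral_add_left measurable_const, lintegral_const, measure_univ, mul_one,
        ENNReal.ofReal_add zero_le_one hb0, ENNReal.ofReal_one]
      exact add_le_add_right (hb i s hs) _
  have hm : ∀ i, MemLp (fun ω => (√h)⁻¹ * kernelSum (U i) (L i) (T i) h t f (ψ i) ω) 2 P :=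
    fun i => (hL2 i).1.const_mul _
  have h0 : ∀ i, ∫ ω, (√h)⁻¹ * kernelSum (U i) (L i) (T i) h t f (ψ i) ω ∂P = 0 := fun i => by
    rw [integral_const_mul, (hM i).integral_kernelSum hΛ0 hΛ hℓ hℓ0 hh t hf hfi (hψ i)
      (by positivity) (h1 i)]
    have : (Set.Icc (0 : ℝ) 1).indicator (fun s => ℓ s * ∫ ω, ψ i s (U i ω) ∂P) = fun _ => 0 := by
      ext s
      by_cases hs : s ∈ Set.Icc (0 : ℝ) 1
      · rw [Set.indicator_of_mem hs, hψ0 i s hs, mul_zero]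
      · rw [Set.indicator_of_notMem hs]
    simp [this]
  refine ⟨hm, h0, fun n => ?_⟩
  simp only [mul_pow]
  rw [integral_const_mul, integral_sum_sq_eq (iIndepFun_kernelSum hind _ _ _ hf hψ) hm h0]
  have hterm : ∀ i, ∫ ω, ((√h)⁻¹ * kernelSum (U i) (L i) (T i) h t f (ψ i) ω) ^ 2 ∂P
      ≤ Λ * c + C * h * (∫ z, |f z|) ^ 2 * b := fun i => by
    simp only [mul_pow]
    rw [integral_const_mul, inv_pow, Real.sq_sqrt hh.le, inv_mul_le_iff₀ hh]
    refine (hL2 i).2.trans (le_of_eq ?_)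
    ring
  rcases Nat.eq_zero_or_pos n with rfl | hn
  · simp; positivity
  · have hn' : (0 : ℝ) < n := by exact_mod_cast hn
    rw [inv_pow, Real.sq_sqrt hn'.le, inv_mul_le_iff₀ hn']
    exact (Finset.sum_le_sum fun i _ => hterm i).trans
      (by rw [Finset.sum_const, Finset.card_range, nsmul_eq_mul])

end Array

/-! ### Lindeberg's condition and the central limit theorem for kernel sums. -/

lemma sq_sub_trunc_le {M r : ℝ} (hM : 0 < M) (hr : 2 ≤ r) (x : ℝ) :
    (x - trunc M x) ^ 2 ≤ M ^ (2 - r) * |x| ^ r := by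
  unfold trunc
  split_ifs with h
  · rw [sub_self, zero_pow two_ne_zero]
    positivity
  · push Not at h
    have hx : 0 < |x| := hM.trans h
    have h1 : |x| ^ (2 - r) ≤ M ^ (2 - r) := Real.rpow_le_rpow_of_nonpos hM h.le (by linarith)
    calc (x - 0) ^ 2 = |x| ^ (2 - r) * |x| ^ r := by
          rw [← Real.rpow_add hx, sub_add_cancel, sub_zero, ← sq_abs]
          norm_cast
      _ ≤ _ := by gcongr

lemma tendsto_rpow_natCast_two_sub {r : ℝ} (hr : 2 < r) :
    Tendsto (fun M : ℕ => (M : ℝ) ^ (2 - r)) atTop (𝓝 0) := by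
  have := (tendsto_rpow_neg_atTop (show 0 < r - 2 by linarith)).comp
    (tendsto_natCast_atTop_atTop (R := ℝ))
  simpa [Function.comp_def, neg_sub] using this

/-- Either `S ≤ 2 R`, or `D > S / 2 > a / 2` and then `S ≤ 2 D ≤ 4 D² / a`. A first moment of `R`
and a second moment of `D` thus control the tail of `S`. -/
lemma indicator_le_of_le_add {S D R a : ℝ} (ha : 0 < a) (hSD : S ≤ D + R)
    (hS : a < S) : S ≤ 2 * R + 4 * a⁻¹ * D ^ 2 := by
  by_cases h : S ≤ 2 * R
  · have : 0 ≤ 4 * a⁻¹ * D ^ 2 := by positivity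
    linarith
  · push Not at h
    have hD : a / 2 < D := by linarith
    have h2 : 2 * D ≤ 4 * a⁻¹ * D ^ 2 := by
      have : 1 ≤ 2 * a⁻¹ * D := by
        rw [mul_comm 2, mul_assoc, ← div_eq_inv_mul, le_div_iff₀ ha]; linarith
      nlinarith
    linarith

section Array

variable {Ω E : Type*} [MeasurableSpace Ω] [MeasurableSpace E] {P : Measure Ω}
  [IsProbabilityMeasure P] {ℓ : ℝ → ℝ} {C : ℝ≥0} {Λ t : ℝ} {f : ℝ → ℝ}

/-- A joint intensity controls pairs of points only, so no moment of the kernel sum above the second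
is at hand and Lyapunov's condition is out of reach. Instead the squared sum is split into a
diagonal part `D` with kernel and marks truncated, the kernel tail `R₁`, the mark tail `R₂` and the
off-diagonal part `R₃`. `D` is itself a kernel sum with bounded ingredients and has a second moment;
for the others first moments suffice. The moment of order `r` enters through `R₂`. For `a = c n` the
last summand is of order `1/(n h) + 1/n`. -/
lemma IsMarked.integral_indicator_sq_kernelSum_le {U : Ω → E} {L : Ω → ℕ} {T : ℕ → Ω → ℝ}
    (hM : IsMarked P U L T ℓ C) {h : ℝ}
    (hΛ0 : 0 ≤ Λ) (hΛ : ∀ s ∈ Set.Icc (0 : ℝ) 1, ℓ s ≤ Λ) (hh : 0 < h)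
    (hf : Measurable f) (hfi : Integrable f) (hf2 : Integrable fun z => f z ^ 2) {ψ : ℝ → E → ℝ}
    (hψ : Measurable fun z : ℝ × E => ψ z.1 z.2) {b b' r : ℝ} (hb0 : 0 ≤ b) (hb'0 : 0 ≤ b')
    (hb : ∀ s ∈ Set.Icc (0 : ℝ) 1,
      ∫⁻ ω, ENNReal.ofReal (ψ s (U ω) ^ 2) ∂P ≤ ENNReal.ofReal b) (hr : 2 ≤ r)
    (hb' : ∀ s ∈ Set.Icc (0 : ℝ) 1,
      ∫⁻ ω, ENNReal.ofReal (|ψ s (U ω)| ^ r) ∂P ≤ ENNReal.ofReal b')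
    {M : ℕ} (hM0 : 0 < M) {a : ℝ} (ha : 0 < a) :
    ∫ ω, {ω | a < ((√h)⁻¹ * kernelSum U L T h t f ψ ω) ^ 2}.indicator
      (fun ω => ((√h)⁻¹ * kernelSum U L T h t f ψ ω) ^ 2) ω ∂P
      ≤ 2 * (Λ * ((∫ z, (f z - trunc M (f z)) ^ 2) * b)
          + Λ * ((∫ z, f z ^ 2) * ((M : ℝ) ^ (2 - r) * b')) + C * h * (∫ z, |f z|) ^ 2 * b)
        + 4 * a⁻¹ * (Λ * h⁻¹ * ((∫ z, f z ^ 2) * M ^ 2 * (M ^ 2) ^ 2)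
          + C * (∫ z, f z ^ 2) ^ 2 * (M ^ 2) ^ 2) := by
  have hMr : (0 : ℝ) < M := by exact_mod_cast hM0
  set F : ℝ := ∫ z, f z ^ 2 with hF
  have hF0 : 0 ≤ F := integral_nonneg fun _ => sq_nonneg _
  set f₁ : ℝ → ℝ := fun z => trunc M (f z) ^ 2 with hf₁
  set f₂ : ℝ → ℝ := fun z => (f z - trunc M (f z)) ^ 2 with hf₂
  set ψ₁ : ℝ → E → ℝ := fun s u => trunc M (ψ s u) ^ 2 with hψ₁
  set ψ₂ : ℝ → E → ℝ := fun s u => (ψ s u - trunc M (ψ s u)) ^ 2 with hψ₂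
  have hf₁m : Measurable f₁ := ((measurable_trunc M).comp hf).pow_const 2
  have hf₂m : Measurable f₂ := (hf.sub ((measurable_trunc M).comp hf)).pow_const 2
  have hψ₁m : Measurable fun z : ℝ × E => ψ₁ z.1 z.2 :=
    ((measurable_trunc M).comp hψ).pow_const 2
  have hψ₂m : Measurable fun z : ℝ × E => ψ₂ z.1 z.2 :=
    (hψ.sub ((measurable_trunc M).comp hψ)).pow_const 2
  have hf₁0 : ∀ z, 0 ≤ f₁ z := fun z => sq_nonneg _
  have hf₁le : ∀ z, f₁ z ≤ f z ^ 2 := fun z => sq_le_sq.2 (abs_trunc_le_abs _ _)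
  have hf₁M : ∀ z, f₁ z ≤ M ^ 2 := fun z => by
    change trunc M (f z) ^ 2 ≤ _
    rw [← sq_abs (trunc M (f z))]; exact pow_le_pow_left₀ (abs_nonneg _) (abs_trunc_le hMr.le _) 2
  have hψ₁M : ∀ s u, ψ₁ s u ≤ M ^ 2 := fun s u => by
    change trunc M (ψ s u) ^ 2 ≤ _
    rw [← sq_abs (trunc M (ψ s u))]; exact pow_le_pow_left₀ (abs_nonneg _) (abs_trunc_le hMr.le _) 2
  have hf₁i : Integrable f₁ := hf2.mono hf₁m.aestronglyMeasurable (ae_of_all _ fun z => by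
    rw [Real.norm_of_nonneg (hf₁0 z), Real.norm_of_nonneg (sq_nonneg _)]; exact hf₁le z)
  have hf₂i : Integrable f₂ := hf2.mono hf₂m.aestronglyMeasurable (ae_of_all _ fun z => by
    rw [Real.norm_of_nonneg (sq_nonneg _), Real.norm_of_nonneg (sq_nonneg _)]
    exact sq_le_sq.2 (abs_sub_trunc_le_abs _ _))
  have hf₁F : ∫ z, |f₁ z| ≤ F := by
    simp only [abs_of_nonneg (hf₁0 _)]
    exact integral_mono hf₁i hf2 hf₁le
  have hf₁sq : ∀ z, f₁ z ^ 2 ≤ f z ^ 2 * M ^ 2 := fun z => by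
    rw [sq (f₁ z)]; exact mul_le_mul (hf₁le z) (hf₁M z) (hf₁0 z) (sq_nonneg _)
  have hf₁2i : Integrable fun z => f₁ z ^ 2 := (hf2.mul_const ((M : ℝ) ^ 2)).mono
    (hf₁m.pow_const 2).aestronglyMeasurable (ae_of_all _ fun z => by
      rw [Real.norm_of_nonneg (sq_nonneg _), Real.norm_of_nonneg (by positivity)]
      exact hf₁sq z)
  have hf₁2F : ∫ z, f₁ z ^ 2 ≤ F * M ^ 2 := by
    rw [hF, ← integral_mul_const]
    exact integral_mono hf₁2i (hf2.mul_const _) hf₁sq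
  -- the truncated part
  have hψ₁b : ∀ s ∈ Set.Icc (0 : ℝ) 1,
      ∫⁻ ω, ENNReal.ofReal (ψ₁ s (U ω) ^ 2) ∂P ≤ ENNReal.ofReal ((M ^ 2) ^ 2) := fun s _ => by
    refine (lintegral_mono (g := fun _ => ENNReal.ofReal (((M : ℝ) ^ 2) ^ 2)) fun ω =>
      ENNReal.ofReal_le_ofReal ?_).trans (by simp)
    exact pow_le_pow_left₀ (sq_nonneg _) (hψ₁M _ _) 2
  obtain ⟨d1, d2⟩ := hM.integral_sq_kernelSum_le hΛ0 hΛ hh t hf₁m hf₁i hψ₁m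
    (c := F * M ^ 2 * (M ^ 2) ^ 2) (b := (M ^ 2) ^ 2) (by positivity) (by positivity)
    (by
      rw [ENNReal.ofReal_mul (by positivity)]
      refine (kernelAvg_le (by fun_prop) hψ₁b).trans ?_
      rw [lintegral_ofReal_sq hf₁2i]
      gcongr) hψ₁b
  -- the remainders
  obtain ⟨p1, p2⟩ := hM.integral_abs_kernelSum_le_of_bound hΛ0 hΛ hh t hf₂m hf₂i
    (ψ := fun s u => ψ s u ^ 2) (hψ.pow_const 2) hb0 (by simpa using hb)
  have hψ₂b : ∀ s ∈ Set.Icc (0 : ℝ) 1,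
      ∫⁻ ω, ENNReal.ofReal |ψ₂ s (U ω)| ∂P ≤ ENNReal.ofReal ((M : ℝ) ^ (2 - r) * b') :=
    fun s hs => by
    rw [ENNReal.ofReal_mul (by positivity)]
    refine le_trans ?_ (mul_le_mul_right (hb' s hs) _)
    rw [← lintegral_const_mul' _ _ ENNReal.ofReal_ne_top]
    refine lintegral_mono fun ω => ?_
    rw [← ENNReal.ofReal_mul (by positivity)]
    refine ENNReal.ofReal_le_ofReal ?_
    rw [abs_of_nonneg (sq_nonneg _)]
    exact sq_sub_trunc_le hMr hr _
  obtain ⟨q1, q2⟩ := hM.integral_abs_kernelSum_le_of_bound hΛ0 hΛ hh t hf₁m hf₁i hψ₂m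
    (by positivity) hψ₂b
  obtain ⟨e1, e2⟩ := hM.integral_abs_sq_kernelSum_sub_le hh t hf hfi hψ hb0 hb
  set S : Ω → ℝ := fun ω => ((√h)⁻¹ * kernelSum U L T h t f ψ ω) ^ 2 with hS
  set D : Ω → ℝ := fun ω => h⁻¹ * kernelSum U L T h t f₁ ψ₁ ω with hDdef
  set R₁ : Ω → ℝ := kernelSum U L T h t f₂ (fun s u => ψ s u ^ 2) with hR₁
  set R₂ : Ω → ℝ := kernelSum U L T h t f₁ ψ₂ with hR₂
  set R₃ : Ω → ℝ := fun ω => kernelSum U L T h t f ψ ω ^ 2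
    - kernelSum U L T h t (fun z => f z ^ 2) (fun s u => ψ s u ^ 2) ω with hR₃
  have hdec : ∀ ω, S ω ≤ D ω + h⁻¹ * (|R₁ ω| + |R₂ ω| + |R₃ ω|) := fun ω => by
    have hsum : kernelSum U L T h t (fun z => f z ^ 2) (fun s u => ψ s u ^ 2) ω
        = kernelSum U L T h t f₁ ψ₁ ω + R₁ ω + R₂ ω := by
      simp only [kernelSum, hR₁, hR₂, ← Finset.sum_add_distrib]
      refine Finset.sum_congr rfl fun j _ => ?_
      have a1 := sq_eq_trunc_sq_add M (f ((T j ω - t) / h))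
      have a2 := sq_eq_trunc_sq_add M (ψ (T j ω) (U ω))
      simp only [hf₁, hf₂, hψ₁, hψ₂]
      rw [a1]
      nth_rewrite 1 [a2]
      rw [a2]
      ring
    have hS' : S ω = h⁻¹ * (kernelSum U L T h t f₁ ψ₁ ω + R₁ ω + R₂ ω + R₃ ω) := by
      rw [← hsum, hR₃, hS]
      simp only [mul_pow, inv_pow, Real.sq_sqrt hh.le]
      ring
    rw [hS', hDdef, ← mul_add]
    have := le_abs_self (R₁ ω)
    have := le_abs_self (R₂ ω)
    have := le_abs_self (R₃ ω)
    exact mul_le_mul_of_nonneg_left (by linarith) (inv_pos.2 hh).le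
  have hi12 : Integrable (fun ω => |R₁ ω| + |R₂ ω|) P := p1.abs.add q1.abs
  have hi : Integrable (fun ω => |R₁ ω| + |R₂ ω| + |R₃ ω|) P := hi12.add e1.abs
  have hRi : Integrable (fun ω => 2 * (h⁻¹ * (|R₁ ω| + |R₂ ω| + |R₃ ω|))) P :=
    (hi.const_mul _).const_mul _
  have hD2 : Integrable (fun ω => D ω ^ 2) P := by
    simp only [hDdef, mul_pow]
    exact ((memLp_two_iff_integrable_sq d1.1).1 d1).const_mul _
  have hDi : Integrable (fun ω => 4 * a⁻¹ * D ω ^ 2) P := hD2.const_mul _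
  have hpt : ∀ ω, {ω | a < S ω}.indicator S ω
      ≤ 2 * (h⁻¹ * (|R₁ ω| + |R₂ ω| + |R₃ ω|)) + 4 * a⁻¹ * D ω ^ 2 := fun ω => by
    by_cases hω : a < S ω
    · rw [Set.indicator_of_mem (by exact hω)]
      exact indicator_le_of_le_add ha (hdec ω) hω
    · rw [Set.indicator_of_notMem (by exact hω)]
      positivity
  refine (integral_mono_of_nonneg (ae_of_all _ fun ω => Set.indicator_nonneg
    (fun _ _ => sq_nonneg _) _) (hRi.add hDi) (ae_of_all _ hpt)).trans ?_
  have hsum := integral_add hRi hDi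
  refine hsum.le.trans ?_
  rw [integral_const_mul, integral_const_mul, integral_const_mul, integral_add hi12 e1.abs,
    integral_add p1.abs q1.abs]
  have hDval : ∫ ω, D ω ^ 2 ∂P
      ≤ Λ * h⁻¹ * (F * M ^ 2 * (M ^ 2) ^ 2) + C * F ^ 2 * (M ^ 2) ^ 2 := by
    simp only [hDdef, mul_pow]
    rw [integral_const_mul, inv_pow, inv_mul_le_iff₀ (by positivity)]
    refine d2.trans ?_
    have e : h ^ 2 * (Λ * h⁻¹ * (F * M ^ 2 * (M ^ 2) ^ 2) + C * F ^ 2 * (M ^ 2) ^ 2)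
        = Λ * h * (F * M ^ 2 * (M ^ 2) ^ 2) + C * (h * F) ^ 2 * (M ^ 2) ^ 2 := by
      field_simp
    rw [e]
    have : 0 ≤ ∫ z, |f₁ z| := integral_nonneg fun _ => abs_nonneg _
    gcongr
  have hRval : h⁻¹ * ((∫ ω, |R₁ ω| ∂P) + (∫ ω, |R₂ ω| ∂P) + ∫ ω, |R₃ ω| ∂P)
      ≤ Λ * ((∫ z, f₂ z) * b) + Λ * (F * ((M : ℝ) ^ (2 - r) * b'))
        + C * h * (∫ z, |f z|) ^ 2 * b := by
    rw [inv_mul_le_iff₀ hh]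
    have p3 : ∫ z, |f₂ z| = ∫ z, f₂ z := by
      refine integral_congr_ae (ae_of_all _ fun z => abs_of_nonneg (sq_nonneg _))
    rw [p3] at p2
    have q3 : Λ * h * ((∫ z, |f₁ z|) * ((M : ℝ) ^ (2 - r) * b'))
        ≤ Λ * h * (F * ((M : ℝ) ^ (2 - r) * b')) := by gcongr
    refine (add_le_add (add_le_add p2 (q2.trans q3)) e2).trans (le_of_eq ?_)
    ring
  gcongr

/-- Central limit theorem for kernel sums over independent marked point processes. -/
theorem tendsto_integral_cexp_kernelSum {U : ℕ → Ω → E} {L : ℕ → Ω → ℕ} {T : ℕ → ℕ → Ω → ℝ}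
    {h : ℕ → ℝ} (hM : ∀ i, IsMarked P (U i) (L i) (T i) ℓ C)
    (hind : iIndepFun (fun i ω =>
      (pointMeasure (L i ω) (fun j => T i j ω)).map (fun s => (s, U i ω))) P)
    (hΛ0 : 0 ≤ Λ) (hΛ : ∀ s ∈ Set.Icc (0 : ℝ) 1, ℓ s ≤ Λ) (hℓ : ContinuousOn ℓ (Set.Icc 0 1))
    (hℓ0 : ∀ s ∈ Set.Icc (0 : ℝ) 1, 0 ≤ ℓ s) (ht : t ∈ Set.Ioo (0 : ℝ) 1)
    (hh : ∀ n, 0 < h n) (hh0 : Tendsto h atTop (𝓝 0))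
    (hnh : Tendsto (fun n : ℕ => (n : ℝ) * h n) atTop atTop)
    (hf : Measurable f) (hfi : Integrable f) (hf2 : Integrable fun z => f z ^ 2)
    {ψ : ℕ → ℝ → E → ℝ} (hψ : ∀ i, Measurable fun z : ℝ × E => ψ i z.1 z.2)
    (hψ0 : ∀ i, ∀ s ∈ Set.Icc (0 : ℝ) 1, ∫ ω, ψ i s (U i ω) ∂P = 0)
    {v : ℝ → ℝ} (hv : ContinuousOn v (Set.Icc 0 1))
    (hψv : ∀ i, ∀ s ∈ Set.Icc (0 : ℝ) 1, ∫ ω, ψ i s (U i ω) ^ 2 ∂P = v s)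
    {b b' r : ℝ} (hb0 : 0 ≤ b) (hb'0 : 0 ≤ b')
    (hb : ∀ i, ∀ s ∈ Set.Icc (0 : ℝ) 1,
      ∫⁻ ω, ENNReal.ofReal (ψ i s (U i ω) ^ 2) ∂P ≤ ENNReal.ofReal b) (hr : 2 < r)
    (hb' : ∀ i, ∀ s ∈ Set.Icc (0 : ℝ) 1,
      ∫⁻ ω, ENNReal.ofReal (|ψ i s (U i ω)| ^ r) ∂P ≤ ENNReal.ofReal b') :
    Tendsto (fun n : ℕ => ∫ ω, Complex.exp ((((√(n : ℝ))⁻¹ * ∑ i ∈ Finset.range n,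
        (√(h n))⁻¹ * kernelSum (U i) (L i) (T i) (h n) t f (ψ i) ω : ℝ) : ℂ) * Complex.I) ∂P) atTop
      (𝓝 (Complex.exp ((-((∫ z, f z ^ 2) * (ℓ t * v t)) / 2 : ℝ) : ℂ))) := by
  have hF0 : 0 ≤ ∫ z, f z ^ 2 := integral_nonneg fun _ => sq_nonneg _
  have htI : t ∈ Set.Icc (0 : ℝ) 1 := Set.Ioo_subset_Icc_self ht
  have hA2 := fun n => integral_sq_normalized_kernelSum_le (t := t) hM hind hΛ0 hΛ hℓ hℓ0 (hh n)
    hf hfi hψ hψ0 hb0 (c := (∫ z, f z ^ 2) * b) (by positivity) (fun i => by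
      rw [ENNReal.ofReal_mul hF0, ← lintegral_ofReal_sq hf2]
      exact kernelAvg_le (by fun_prop) (hb i)) hb
  have hvt : 0 ≤ v t := by
    rw [← hψv 0 t htI]; exact integral_nonneg fun _ => sq_nonneg _
  refine tendsto_integral_cexp_of_lindeberg (mul_nonneg hF0 (mul_nonneg (hℓ0 t htI) hvt))
    (fun n => iIndepFun_kernelSum hind _ _ _ hf hψ) (fun n => (hA2 n).1) (fun n => (hA2 n).2.1)
    ?_ ?_
  -- Variance: by Campbell's formula the diagonal is an integral of `ℓ v` against `f²` over the
  -- window, which converges; the pairs contribute `O(h)`.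
  · intro η hη
    have hmean := (tendsto_integral_kernel (f := fun z => f z ^ 2) (g := fun s => ℓ s * v s) hh0 ht
      hf2 (hℓ.mul hv)).eventually (Metric.closedBall_mem_nhds _ (half_pos hη))
    have hsm : Tendsto (fun n => C * h n * (∫ z, |f z|) ^ 2 * b) atTop (𝓝 0) := by
      simpa using ((hh0.const_mul (C : ℝ)).mul_const ((∫ z, |f z|) ^ 2)).mul_const b
    filter_upwards [hmean, hsm.eventually_le_const (half_pos hη)] with n hmean hsm i
    have hhn := hh n
    obtain ⟨e1, e2⟩ := (hM i).integral_abs_sq_kernelSum_sub_le hhn t hf hfi (hψ i) hb0 (hb i)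
    have hb2 : ∀ s ∈ Set.Icc (0 : ℝ) 1,
      ∫⁻ ω, ENNReal.ofReal |ψ i s (U i ω) ^ 2| ∂P ≤ ENNReal.ofReal b := by simpa using hb i
    have hval := (hM i).integral_kernelSum hΛ0 hΛ hℓ hℓ0 hhn t (hf.pow_const 2) hf2
      (ψ := fun s u => ψ i s u ^ 2) ((hψ i).pow_const 2) hb0 hb2
    have hint := ((hM i).integral_abs_kernelSum_le_of_bound hΛ0 hΛ hhn t (hf.pow_const 2) hf2
      (ψ := fun s u => ψ i s u ^ 2) ((hψ i).pow_const 2) hb0 hb2).1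
    have hcongr : (Set.Icc (0 : ℝ) 1).indicator (fun s => ℓ s * ∫ ω, ψ i s (U i ω) ^ 2 ∂P)
        = (Set.Icc (0 : ℝ) 1).indicator (fun s => ℓ s * v s) :=
      Set.indicator_congr fun s hs => by rw [hψv i s hs]
    rw [hcongr] at hval
    have hks2 : Integrable (fun ω => kernelSum (U i) (L i) (T i) (h n) t f (ψ i) ω ^ 2) P := by
      refine (e1.add hint).congr (ae_of_all _ fun ω => ?_)
      simp
    have hdiff : |∫ ω, kernelSum (U i) (L i) (T i) (h n) t f (ψ i) ω ^ 2 ∂P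
        - h n * ∫ z, f z ^ 2 * (Set.Icc (0 : ℝ) 1).indicator (fun s => ℓ s * v s) (t + h n * z)|
        ≤ C * (h n * ∫ z, |f z|) ^ 2 * b := by
      rw [← hval, ← integral_sub hks2 hint]
      exact (abs_integral_le_integral_abs).trans e2
    simp only [mul_pow]
    rw [integral_const_mul, inv_pow, Real.sq_sqrt hhn.le]
    rw [Real.dist_eq] at hmean
    set X := ∫ ω, kernelSum (U i) (L i) (T i) (h n) t f (ψ i) ω ^ 2 ∂P
    set Y := ∫ z, f z ^ 2 * (Set.Icc (0 : ℝ) 1).indicator (fun s => ℓ s * v s) (t + h n * z)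
    have h3 : |(h n)⁻¹ * X - Y| ≤ η / 2 := by
      have : (h n)⁻¹ * X - Y = (h n)⁻¹ * (X - h n * Y) := by field_simp
      rw [this, abs_mul, abs_of_pos (inv_pos.2 hhn), inv_mul_le_iff₀ hhn]
      refine hdiff.trans (le_trans (le_of_eq ?_) (mul_le_mul_of_nonneg_left hsm hhn.le))
      ring
    calc _ ≤ |(h n)⁻¹ * X - Y| + |Y - (∫ z, f z ^ 2) * (ℓ t * v t)| := abs_sub_le _ _ _
      _ ≤ η := by linarith
  -- Lindeberg's condition: the truncation level `M` is fixed first, making the two tails contribute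
  -- at most `η / 4`; all other terms vanish as `n → ∞` for this `M`.
  · intro η hη c hc
    have hM1 : Tendsto (fun M : ℕ => Λ * ((∫ z, (f z - trunc M (f z)) ^ 2) * b)
          + Λ * ((∫ z, f z ^ 2) * ((M : ℝ) ^ (2 - r) * b'))) atTop (𝓝 0) := by
      simpa using (((tendsto_integral_sq_sub_trunc hf.aemeasurable hf2).mul_const b).const_mul
        Λ).add ((((tendsto_rpow_natCast_two_sub hr).mul_const b').const_mul
          (∫ z, f z ^ 2)).const_mul Λ)
    obtain ⟨M, hM1, hMpos⟩ := ((hM1.eventually_le_const (show (0 : ℝ) < η / 8 by positivity)).and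
      (eventually_gt_atTop 0)).exists
    have hlim : Tendsto (fun n : ℕ => 2 * (C * h n * (∫ z, |f z|) ^ 2 * b)
        + 4 * c⁻¹ * (Λ * ((∫ z, f z ^ 2) * M ^ 2 * (M ^ 2) ^ 2) * ((n : ℝ) * h n)⁻¹
          + C * (∫ z, f z ^ 2) ^ 2 * (M ^ 2) ^ 2 * (n : ℝ)⁻¹)) atTop (𝓝 0) := by
      simpa using (((((hh0.const_mul (C : ℝ)).mul_const ((∫ z, |f z|) ^ 2)).mul_const b).const_mul
        2)).add (((hnh.inv_tendsto_atTop.const_mul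
          (Λ * ((∫ z, f z ^ 2) * M ^ 2 * (M ^ 2) ^ 2))).add
          ((tendsto_inv_atTop_nhds_zero_nat (𝕜 := ℝ)).const_mul
            (C * (∫ z, f z ^ 2) ^ 2 * (M ^ 2) ^ 2))).const_mul (4 * c⁻¹))
    filter_upwards [hlim.eventually_le_const (half_pos hη), eventually_gt_atTop 0] with n hn hn0 i
    have hn' : (0 : ℝ) < n := by exact_mod_cast hn0
    refine ((hM i).integral_indicator_sq_kernelSum_le hΛ0 hΛ (hh n) hf hfi hf2 (hψ i) hb0 hb'0
      (hb i) hr.le (hb' i) hMpos (mul_pos hc hn')).trans ?_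
    have e : 4 * (c * n)⁻¹ * (Λ * (h n)⁻¹ * ((∫ z, f z ^ 2) * M ^ 2 * (M ^ 2) ^ 2)
          + C * (∫ z, f z ^ 2) ^ 2 * (M ^ 2) ^ 2)
        = 4 * c⁻¹ * (Λ * ((∫ z, f z ^ 2) * M ^ 2 * (M ^ 2) ^ 2) * ((n : ℝ) * h n)⁻¹
          + C * (∫ z, f z ^ 2) ^ 2 * (M ^ 2) ^ 2 * (n : ℝ)⁻¹) := by
      rw [mul_inv, mul_inv]; ring
    rw [e]
    linarith

end Array

/-! ### Conditional moments of the response and the residual. -/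

namespace Study

variable {Ω : Type*} [MeasurableSpace Ω] {P : Measure Ω} {p q : ℕ} {D : Study Ω p q}

/-- `(X_i, Y_i)` is a jointly measurable function of the time and the path. -/
lemma IsIIDSample.exists_eval (hD : D.IsIIDSample P) (i : ℕ) :
    ∃ Φ : ℝ × (ℝ → Vec p × ℝ) → Vec p × ℝ, Measurable Φ ∧
      ∀ s ω, Φ (s, D.pathXY i ω) = (D.X i s ω, D.Y i s ω) := by
  -- The process is measurable with respect to its own σ-algebra, which is pulled back from path
  -- space, so it factors through `(s, path)` (Doob–Dynkin). A function of the path is needed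
  -- because independence is assumed for paths.
  have hle : MeasurableSpace.prod (inferInstance : MeasurableSpace ℝ)
        (MeasurableSpace.comap (D.pathXY i) MeasurableSpace.pi)
      ≤ MeasurableSpace.comap (fun z : ℝ × Ω => (z.1, D.pathXY i z.2))
        (inferInstance : MeasurableSpace (ℝ × (ℝ → Vec p × ℝ))) := by
    refine sup_le ?_ ?_
    · rintro _ ⟨B, hB, rfl⟩
      exact ⟨Prod.fst ⁻¹' B, measurable_fst hB, rfl⟩
    · rintro _ ⟨_, ⟨B, hB, rfl⟩, rfl⟩
      exact ⟨Prod.snd ⁻¹' B, measurable_snd hB, rfl⟩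
  obtain ⟨Φ, hΦ, h⟩ := ((hD.measurable_process i).mono hle le_rfl).exists_eq_measurable_comp
  exact ⟨Φ, hΦ, fun s ω => (congrFun h (s, ω)).symm⟩

lemma IsIIDSample.identDistrib_pair (hD : D.IsIIDSample P) (i : ℕ) (s s' : ℝ) :
    IdentDistrib (fun ω => ((D.X i s ω, D.Y i s ω), (D.X i s' ω, D.Y i s' ω)))
      (fun ω => ((D.X 0 s ω, D.Y 0 s ω), (D.X 0 s' ω, D.Y 0 s' ω))) P P :=
  (hD.identDistrib i).comp (u := fun g : ℝ → Vec p × Vec q × ℝ × ℕ =>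
    (((g s).1, (g s).2.2.1), ((g s').1, (g s').2.2.1))) (by fun_prop)

variable {β₀ : ℝ → Vec p} {γ₀ : ℝ → Vec q} {lam : ℝ → ℝ} {s : ℝ}

/-- The conditional mean of the response given the covariates `X` alone. -/
lemma condExp_Y_given_X [IsProbabilityMeasure P] (hD : D.IsIIDSample P) (hmodel : D.Model P β₀ γ₀)
    (horth : D.Orthogonal P) (hs : s ∈ Set.Icc (0 : ℝ) 1) :
    P[D.Y 0 s | MeasurableSpace.comap (D.X 0 s) inferInstance]
      =ᵐ[P] fun ω => inner ℝ (D.X 0 s ω) (β₀ s) + D.intercept P γ₀ s := by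
  have hX : Integrable (D.X 0 s) P := (hmodel.memLp_X s hs).integrable (by norm_num)
  have hZ := hmodel.integrable_Z s hs
  have hXb : Integrable (fun ω => inner ℝ (D.X 0 s ω) (β₀ s)) P := hX.inner_const (𝕜 := ℝ) _
  have hZg : Integrable (fun ω => inner ℝ (D.Z 0 s ω) (γ₀ s)) P := hZ.inner_const (𝕜 := ℝ) _
  have hm'0 := ((hD.measurable_X 0 s).prodMk (hD.measurable_Z 0 s)).comap_le
  have h4 : P[fun ω => inner ℝ (D.X 0 s ω) (β₀ s) | MeasurableSpace.comap (D.X 0 s) inferInstance]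
      = fun ω => inner ℝ (D.X 0 s ω) (β₀ s) := by
    refine condExp_of_stronglyMeasurable (hD.measurable_X 0 s).comap_le ?_ hXb
    exact ((Continuous.inner continuous_id continuous_const).measurable.comp
      (comap_measurable (D.X 0 s))).stronglyMeasurable
  have hce := hmodel.condExp_eq s hs
  have hα : inner ℝ (γ₀ s) (∫ ω, D.Z 0 s ω ∂P) = D.intercept P γ₀ s := real_inner_comm _ _
  generalize D.intercept P γ₀ s = α at hα ⊢
  set m' := MeasurableSpace.comap (fun ω => (D.X 0 s ω, D.Z 0 s ω)) inferInstance with hm'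
  set m := MeasurableSpace.comap (D.X 0 s) inferInstance with hm
  have hmm' : m ≤ m' := by
    rintro _ ⟨B, hB, rfl⟩
    exact ⟨Prod.fst ⁻¹' B, measurable_fst hB, rfl⟩
  -- Tower property: the response is first conditioned on `(X, Z)`, where the model applies, and
  -- then on `X`, where orthogonality turns `Z` into its mean.
  have h1 : P[P[D.Y 0 s | m'] | m] =ᵐ[P] P[D.Y 0 s | m] := condExp_condExp_of_le hmm' hm'0
  have h2 : P[P[D.Y 0 s | m'] | m] =ᵐ[P]
      P[fun ω => inner ℝ (D.X 0 s ω) (β₀ s) + inner ℝ (D.Z 0 s ω) (γ₀ s) | m] :=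
    condExp_congr_ae hce
  have h3 := condExp_add hXb hZg m
  have h5 := ContinuousLinearMap.comp_condExp_comm (m := m) hZ (innerSL ℝ (γ₀ s))
  have h6 : P[fun ω => inner ℝ (D.Z 0 s ω) (γ₀ s) | m] =ᵐ[P] fun _ => α := by
    have e : (fun ω => inner ℝ (D.Z 0 s ω) (γ₀ s)) = (innerSL ℝ (γ₀ s)) ∘ D.Z 0 s := by
      ext ω; simp [real_inner_comm]
    rw [e]
    filter_upwards [h5, horth s hs] with ω h5 h7
    rw [← h5, Function.comp_apply, h7, innerSL_apply_apply, hα]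
  filter_upwards [h1, h2, h3, h6] with ω h1 h2 h3 h6
  rw [← h1, h2]
  refine h3.trans ?_
  rw [Pi.add_apply, h6, h4]

lemma integral_Y (hD : D.IsIIDSample P) [IsProbabilityMeasure P] (hmodel : D.Model P β₀ γ₀)
    (horth : D.Orthogonal P) (hs : s ∈ Set.Icc (0 : ℝ) 1) :
    ∫ ω, D.Y 0 s ω ∂P = inner ℝ (∫ ω, D.X 0 s ω ∂P) (β₀ s) + D.intercept P γ₀ s := by
  have hX : Integrable (D.X 0 s) P := (hmodel.memLp_X s hs).integrable (by norm_num)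
  rw [← integral_condExp (hD.measurable_X 0 s).comap_le,
    integral_congr_ae (condExp_Y_given_X hD hmodel horth hs),
    integral_add (hX.inner_const (𝕜 := ℝ) _) (integrable_const _), integral_const]
  have := integral_inner (𝕜 := ℝ) hX (β₀ s)
  rw [real_inner_comm (β₀ s), ← this, probReal_univ, one_smul]
  simp only [real_inner_comm]

/-- The means of the two sides of the regression on `X` cancel. In this form the residual involves
the uncentred data which enter the least squares criterion. -/
lemma resid_eq (hD : D.IsIIDSample P) [IsProbabilityMeasure P] (hmodel : D.Model P β₀ γ₀)
    (horth : D.Orthogonal P) (hs : s ∈ Set.Icc (0 : ℝ) 1) (ω : Ω) :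
    D.resid P β₀ s ω
      = D.Y 0 s ω - inner ℝ (D.X 0 s ω) (β₀ s) - D.intercept P γ₀ s := by
  rw [resid, Yc, Xc, integral_Y hD hmodel horth hs, inner_sub_left]
  ring

lemma measurable_Xc (hD : D.IsIIDSample P) (s : ℝ) : Measurable (D.Xc P s) :=
  (hD.measurable_X 0 s).sub_const _

lemma comap_Xc (s : ℝ) :
    MeasurableSpace.comap (D.Xc P s) inferInstance
      = MeasurableSpace.comap (D.X 0 s) inferInstance := by
  refine le_antisymm ?_ ?_
  · exact ((comap_measurable (D.X 0 s)).sub_const (∫ ω', D.X 0 s ω' ∂P)).comap_le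
  · have := ((comap_measurable (D.Xc P s)).add_const (∫ ω', D.X 0 s ω' ∂P)).comap_le
    simpa [Xc] using this

lemma memLp_Xc [IsProbabilityMeasure P] (hmodel : D.Model P β₀ γ₀)
    (hs : s ∈ Set.Icc (0 : ℝ) 1) : MemLp (D.Xc P s) 2 P :=
  (hmodel.memLp_X s hs).sub (memLp_const _)

lemma memLp_Xc_apply [IsProbabilityMeasure P] (hmodel : D.Model P β₀ γ₀)
    (hs : s ∈ Set.Icc (0 : ℝ) 1) (k : Fin p) : MemLp (fun ω => D.Xc P s ω k) 2 P :=
  (memLp_Xc hmodel hs).continuousLinearMap_comp (EuclideanSpace.proj k : Vec p →L[ℝ] ℝ)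

lemma memLp_Yc [IsProbabilityMeasure P] (hmodel : D.Model P β₀ γ₀)
    (hs : s ∈ Set.Icc (0 : ℝ) 1) : MemLp (D.Yc P s) 2 P :=
  (hmodel.memLp_Y s hs).sub (memLp_const _)

lemma memLp_resid [IsProbabilityMeasure P] (hmodel : D.Model P β₀ γ₀)
    (hs : s ∈ Set.Icc (0 : ℝ) 1) : MemLp (D.resid P β₀ s) 2 P := by
  refine (memLp_Yc hmodel hs).sub ?_
  exact (memLp_Xc hmodel hs).inner_const (𝕜 := ℝ) (β₀ s)

lemma measurable_resid (hD : D.IsIIDSample P) (s : ℝ) : Measurable (D.resid P β₀ s) :=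
  ((hD.measurable_Y 0 s).sub_const _).sub
    ((Continuous.inner continuous_id continuous_const).measurable.comp (measurable_Xc hD s))

lemma condExp_Yc [IsProbabilityMeasure P] (hD : D.IsIIDSample P) (hmodel : D.Model P β₀ γ₀)
    (horth : D.Orthogonal P) (hs : s ∈ Set.Icc (0 : ℝ) 1) :
    P[D.Yc P s | MeasurableSpace.comap (D.Xc P s) inferInstance]
      =ᵐ[P] fun ω => inner ℝ (D.Xc P s ω) (β₀ s) := by
  rw [comap_Xc]
  have hY : Integrable (D.Y 0 s) P := (hmodel.memLp_Y s hs).integrable (by norm_num)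
  have h := condExp_sub hY (integrable_const (μ := P) (∫ ω', D.Y 0 s ω' ∂P))
    (MeasurableSpace.comap (D.X 0 s) inferInstance)
  filter_upwards [h, condExp_Y_given_X hD hmodel horth hs] with ω h h1
  refine h.trans ?_
  rw [Pi.sub_apply, h1, condExp_const (hD.measurable_X 0 s).comap_le,
    integral_Y hD hmodel horth hs, Xc, inner_sub_left]
  ring

lemma condExp_resid [IsProbabilityMeasure P] (hD : D.IsIIDSample P) (hmodel : D.Model P β₀ γ₀)
    (horth : D.Orthogonal P) (hs : s ∈ Set.Icc (0 : ℝ) 1) :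
    P[D.resid P β₀ s | MeasurableSpace.comap (D.Xc P s) inferInstance] =ᵐ[P] 0 := by
  have hXi : Integrable (fun ω => inner ℝ (D.Xc P s ω) (β₀ s)) P :=
    ((memLp_Xc hmodel hs).integrable (by norm_num)).inner_const (𝕜 := ℝ) _
  have h := condExp_sub ((memLp_Yc hmodel hs).integrable (by norm_num)) hXi
    (MeasurableSpace.comap (D.Xc P s) inferInstance)
  have h4 : P[fun ω => inner ℝ (D.Xc P s ω) (β₀ s) |
      MeasurableSpace.comap (D.Xc P s) inferInstance] = fun ω => inner ℝ (D.Xc P s ω) (β₀ s) := by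
    refine condExp_of_stronglyMeasurable (measurable_Xc hD s).comap_le ?_ hXi
    exact ((Continuous.inner continuous_id continuous_const).measurable.comp
      (comap_measurable (D.Xc P s))).stronglyMeasurable
  filter_upwards [h, condExp_Yc hD hmodel horth hs] with ω h h1
  refine h.trans ?_
  rw [Pi.sub_apply, h1, h4, sub_self, Pi.zero_apply]

lemma stronglyMeasurable_comap_Xc_apply (s : ℝ) (k : Fin p) :
    StronglyMeasurable[MeasurableSpace.comap (D.Xc P s) inferInstance]
      (fun ω => D.Xc P s ω k) :=
  ((EuclideanSpace.proj k : Vec p →L[ℝ] ℝ).continuous.measurable.comp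
      (comap_measurable (D.Xc P s))).stronglyMeasurable

lemma integral_resid [IsProbabilityMeasure P] (hD : D.IsIIDSample P) (hmodel : D.Model P β₀ γ₀)
    (horth : D.Orthogonal P) (hs : s ∈ Set.Icc (0 : ℝ) 1) : ∫ ω, D.resid P β₀ s ω ∂P = 0 := by
  rw [← integral_condExp (measurable_Xc hD s).comap_le,
    integral_congr_ae (condExp_resid hD hmodel horth hs)]
  simp

lemma integral_Xc_mul_resid [IsProbabilityMeasure P] (hD : D.IsIIDSample P)
    (hmodel : D.Model P β₀ γ₀) (horth : D.Orthogonal P) (hs : s ∈ Set.Icc (0 : ℝ) 1) (k : Fin p) :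
    ∫ ω, D.Xc P s ω k * D.resid P β₀ s ω ∂P = 0 := by
  have h1 := condExp_mul_of_stronglyMeasurable_left (μ := P)
    (stronglyMeasurable_comap_Xc_apply (D := D) (P := P) s k)
    ((memLp_Xc_apply hmodel hs k).integrable_mul (memLp_resid hmodel hs))
    ((memLp_resid hmodel hs).integrable (by norm_num))
  have h2 : P[fun ω => D.Xc P s ω k * D.resid P β₀ s ω |
      MeasurableSpace.comap (D.Xc P s) inferInstance] =ᵐ[P] 0 := by
    filter_upwards [h1, condExp_resid hD hmodel horth hs] with ω h1 h3
    refine h1.trans ?_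
    rw [Pi.mul_apply, h3, Pi.zero_apply, mul_zero]
  rw [← integral_condExp (measurable_Xc hD s).comap_le, integral_congr_ae h2]
  simp

lemma integral_Xc_apply [IsProbabilityMeasure P] (hmodel : D.Model P β₀ γ₀)
    (hs : s ∈ Set.Icc (0 : ℝ) 1) (k : Fin p) : ∫ ω, D.Xc P s ω k ∂P = 0 := by
  have hX : Integrable (D.X 0 s) P := (hmodel.memLp_X s hs).integrable (by norm_num)
  have h0 : ∫ ω, D.Xc P s ω ∂P = 0 := by
    simp only [Xc]
    rw [integral_sub hX (integrable_const _)]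
    simp
  have := ContinuousLinearMap.integral_comp_comm (EuclideanSpace.proj k : Vec p →L[ℝ] ℝ)
    ((memLp_Xc hmodel hs).integrable (by norm_num))
  rw [h0] at this
  simpa using this

lemma sq_le_one_add_rpow {x r : ℝ} (hx : 0 ≤ x) (hr : 2 ≤ r) : x ^ 2 ≤ 1 + x ^ r := by
  rcases le_total x 1 with h | h
  · have : x ^ 2 ≤ 1 := pow_le_one₀ hx h
    linarith [Real.rpow_nonneg hx r]
  · have : x ^ (2 : ℝ) ≤ x ^ r := Real.rpow_le_rpow_of_exponent_le h hr
    rw [Real.rpow_two] at this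
    linarith

/-- Bound on the second moment of `X̃ ε`, uniform over time. -/
lemma exists_lintegral_sq_le [IsProbabilityMeasure P]
    (hreg : D.RegularityCond P lam β₀ γ₀) : ∃ C : ℝ, 0 ≤ C ∧ ∀ s ∈ Set.Icc (0 : ℝ) 1,
      ∫⁻ ω, ENNReal.ofReal ((‖D.Xc P s ω‖ * |D.resid P β₀ s ω|) ^ 2) ∂P ≤ ENNReal.ofReal C := by
  obtain ⟨r, C, hr, hC⟩ := hreg.lyapunov
  refine ⟨1 + max C 0, by positivity, fun s hs => ?_⟩
  refine (lintegral_mono (g := fun ω => ENNReal.ofReal 1 +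
    ENNReal.ofReal ((‖D.Xc P s ω‖ * |D.resid P β₀ s ω|) ^ r)) fun ω => ?_).trans ?_
  · beta_reduce
    rw [← ENNReal.ofReal_add zero_le_one (by positivity)]
    exact ENNReal.ofReal_le_ofReal (sq_le_one_add_rpow (by positivity) hr.le)
  · rw [lintegral_add_left measurable_const, lintegral_const, measure_univ, mul_one,
      ENNReal.ofReal_add zero_le_one (le_max_right _ _)]
    exact add_le_add le_rfl ((hC s hs).trans (ENNReal.ofReal_le_ofReal (le_max_left _ _)))

lemma abs_apply_le_norm (x : Vec p) (k : Fin p) : |x k| ≤ ‖x‖ := by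
  simpa using PiLp.norm_apply_le x k

lemma integrable_Xc_mul_Xc_mul_resid_sq [IsProbabilityMeasure P] (hD : D.IsIIDSample P)
    (hreg : D.RegularityCond P lam β₀ γ₀) (hs : s ∈ Set.Icc (0 : ℝ) 1) (k l : Fin p) :
    Integrable (fun ω => D.Xc P s ω k * D.Xc P s ω l * D.resid P β₀ s ω ^ 2) P := by
  obtain ⟨C, hC0, hC⟩ := exists_lintegral_sq_le hreg
  have hm := fun k : Fin p => (EuclideanSpace.proj k : Vec p →L[ℝ] ℝ).continuous.measurable.comp
    (measurable_Xc (P := P) hD s)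
  have hr := measurable_resid (β₀ := β₀) (P := P) hD s
  have hn : Measurable fun ω => ‖D.Xc P s ω‖ := (measurable_Xc hD s).norm
  refine (integrable_of_lintegral_abs_le (Y := fun ω => (‖D.Xc P s ω‖ * |D.resid P β₀ s ω|) ^ 2)
    ((hn.mul hr.abs).pow_const 2).aestronglyMeasurable hC0 (by simpa using hC s hs)).1.mono
    ((((hm k).mul (hm l)).mul (hr.pow_const 2)).aestronglyMeasurable) (ae_of_all _ fun ω => ?_)
  have h2 : 0 ≤ (‖D.Xc P s ω‖ * |D.resid P β₀ s ω|) ^ 2 := by positivity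
  rw [Real.norm_of_nonneg h2, norm_mul, norm_mul, norm_pow, mul_pow, sq ‖D.Xc P s ω‖,
    Real.norm_eq_abs, Real.norm_eq_abs, Real.norm_eq_abs]
  gcongr <;> exact abs_apply_le_norm _ _

/-- The conditional mean of `Ỹ` is `X̃ᵀβ₀`, so the deviation from it is `ε`. -/
lemma condVariance_ae_eq [IsProbabilityMeasure P] (hD : D.IsIIDSample P)
    (hmodel : D.Model P β₀ γ₀) (horth : D.Orthogonal P) (hs : s ∈ Set.Icc (0 : ℝ) 1) :
    D.condVariance P s =ᵐ[P]
      P[fun ω => D.resid P β₀ s ω ^ 2 | MeasurableSpace.comap (D.Xc P s) inferInstance] := by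
  refine condExp_congr_ae ?_
  filter_upwards [condExp_Yc hD hmodel horth hs] with ω h
  simp only [Pi.pow_apply, Pi.sub_apply]
  rw [h, resid]

lemma integral_Xc_mul_Xc_mul_resid_sq [IsProbabilityMeasure P] (hD : D.IsIIDSample P)
    (hmodel : D.Model P β₀ γ₀) (horth : D.Orthogonal P) (hreg : D.RegularityCond P lam β₀ γ₀)
    (hs : s ∈ Set.Icc (0 : ℝ) 1) (k l : Fin p) :
    ∫ ω, D.Xc P s ω k * D.Xc P s ω l * D.resid P β₀ s ω ^ 2 ∂P
      = ∫ ω, D.Xc P s ω k * D.Xc P s ω l * D.condVariance P s ω ∂P := by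
  have h1 := condExp_mul_of_stronglyMeasurable_left (μ := P)
    ((stronglyMeasurable_comap_Xc_apply (D := D) (P := P) s k).mul
      (stronglyMeasurable_comap_Xc_apply (D := D) (P := P) s l))
    (integrable_Xc_mul_Xc_mul_resid_sq hD hreg hs k l)
    ((memLp_resid hmodel hs).integrable_sq)
  rw [← integral_condExp (measurable_Xc hD s).comap_le]
  refine integral_congr_ae ?_
  filter_upwards [h1, condVariance_ae_eq hD hmodel horth hs] with ω h1 h2
  refine h1.trans ?_
  rw [h2]
  rfl

end Study

/-- Second order Taylor expansion about an interior point, uniformly over the interval. -/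
lemma exists_taylor_two_bound {F : Type*} [NormedAddCommGroup F] [NormedSpace ℝ F] {g : ℝ → F}
    (hg : ContDiffOn ℝ 2 g (Set.Icc 0 1)) {t : ℝ} (ht : t ∈ Set.Icc (0 : ℝ) 1) :
    ∃ (g' : F) (C : ℝ), 0 ≤ C ∧ ∀ s ∈ Set.Icc (0 : ℝ) 1,
      ‖g s - g t - (s - t) • g'‖ ≤ C * (s - t) ^ 2 := by
  set I : Set ℝ := Set.Icc 0 1 with hI
  have hu : UniqueDiffOn ℝ I := uniqueDiffOn_Icc one_pos
  have hd : DifferentiableOn ℝ g I := hg.differentiableOn (by norm_num)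
  have hg1 : ContDiffOn ℝ 1 (derivWithin g I) I := hg.derivWithin hu (by norm_num)
  have hd1 : DifferentiableOn ℝ (derivWithin g I) I := hg1.differentiableOn (by norm_num)
  have hc : ContinuousOn (derivWithin (derivWithin g I) I) I :=
    hg1.continuousOn_derivWithin hu le_rfl
  obtain ⟨C, hC⟩ := isCompact_Icc.exists_bound_of_continuousOn hc
  have hC0 : 0 ≤ C := (norm_nonneg _).trans (hC t ht)
  refine ⟨derivWithin g I t, C, hC0, fun s hs => ?_⟩
  -- The mean value inequality is used twice, first for the derivative and then for the function
  -- minus its linear part. It holds for vector values; the constant is a bound of the second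
  -- derivative, not half of it.
  have hlip : ∀ u ∈ I, ‖derivWithin g I u - derivWithin g I t‖ ≤ C * ‖u - t‖ := fun u hu' =>
    (convex_Icc 0 1).norm_image_sub_le_of_norm_derivWithin_le hd1 hC ht hu'
  have hsub : Set.uIcc t s ⊆ I := Set.uIcc_subset_Icc ht hs
  have hder : ∀ u ∈ Set.uIcc t s, HasDerivWithinAt (fun u => g u - u • derivWithin g I t)
      (derivWithin g I u - derivWithin g I t) (Set.uIcc t s) u := fun u hu' => by
    have h1 := ((hd u (hsub hu')).hasDerivWithinAt).mono hsub
    have h2 := (hasDerivWithinAt_id u (Set.uIcc t s)).smul_const (derivWithin g I t)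
    simpa using! h1.sub h2
  have := (convex_uIcc t s).norm_image_sub_le_of_norm_hasDerivWithin_le (C := C * |s - t|) hder
    (fun u hu' => (hlip u (hsub hu')).trans (by
      exact mul_le_mul_of_nonneg_left (Set.abs_sub_left_of_mem_uIcc hu') hC0)) Set.left_mem_uIcc Set.right_mem_uIcc
  rw [Real.norm_eq_abs, mul_assoc, ← sq, sq_abs] at this
  refine le_trans (le_of_eq ?_) this
  congr 1
  module

lemma integral_abs_mul_le_sqrt {Ω : Type*} [MeasurableSpace Ω] {P : Measure Ω} {f g : Ω → ℝ}
    (hf : MemLp f 2 P) (hg : MemLp g 2 P) :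
    ∫ ω, |f ω * g ω| ∂P ≤ √(∫ ω, f ω ^ 2 ∂P) * √(∫ ω, g ω ^ 2 ∂P) := by
  have h := integral_mul_norm_le_Lp_mul_Lq (p := 2) (q := 2) (f := f) (g := g) (μ := P)
    (by constructor <;> norm_num) (by simpa using hf) (by simpa using hg)
  simpa [abs_mul, Real.sqrt_eq_rpow] using h

/-! ### Perturbation of characteristic functions and of linear systems. -/

section Perturbation

lemma norm_cexp_mul_I_sub_cexp_mul_I_le (x y : ℝ) :
    ‖Complex.exp ((x : ℂ) * Complex.I) - Complex.exp ((y : ℂ) * Complex.I)‖ ≤ |x - y| := by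
  have e : Complex.exp ((x : ℂ) * Complex.I) - Complex.exp ((y : ℂ) * Complex.I)
      = Complex.exp ((y : ℂ) * Complex.I) * (Complex.exp (Complex.I * ((x - y : ℝ) : ℂ)) - 1) := by
    rw [mul_sub, ← Complex.exp_add]
    push_cast
    ring_nf
  rw [e, norm_mul, Complex.norm_exp_ofReal_mul_I, one_mul]
  exact Real.norm_exp_I_mul_ofReal_sub_one_le

/-- Characteristic functions are insensitive to perturbations which are small in probability. -/
theorem tendsto_integral_cexp_of_abs_sub_le {Ω : Type*} [MeasurableSpace Ω] {P : Measure Ω}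
    [IsProbabilityMeasure P] {x y g σ w : ℕ → Ω → ℝ} (hx : ∀ n, AEMeasurable (x n) P)
    (hy : ∀ n, AEMeasurable (y n) P) (hg : ∀ n, Integrable (g n) P)
    (hσ : ∀ n, Integrable (σ n) P) (hw : ∀ n, Integrable (w n) P) (hg0 : ∀ n ω, 0 ≤ g n ω)
    (hσ0 : ∀ n ω, 0 ≤ σ n ω) (hw0 : ∀ n ω, 0 ≤ w n ω)
    (hgt : Tendsto (fun n => ∫ ω, g n ω ∂P) atTop (𝓝 0)) {B : ℝ}
    (hσB : ∀ᶠ n in atTop, ∫ ω, σ n ω ∂P ≤ B)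
    (hwt : Tendsto (fun n => ∫ ω, w n ω ∂P) atTop (𝓝 0)) {κ c : ℝ} (hκ : 0 ≤ κ) (hc : 0 ≤ c)
    (hle : ∀ᶠ n in atTop, ∀ᵐ ω ∂P, κ * g n ω ≤ 1 / 2 →
      |x n ω - y n ω| ≤ c * (g n ω * σ n ω) + w n ω) {z : ℂ}
    (hlim : Tendsto (fun n => ∫ ω, Complex.exp ((y n ω : ℂ) * Complex.I) ∂P) atTop (𝓝 z)) :
    Tendsto (fun n => ∫ ω, Complex.exp ((x n ω : ℂ) * Complex.I) ∂P) atTop (𝓝 z) := by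
  have hint : ∀ v : Ω → ℝ, AEMeasurable v P →
      Integrable (fun ω => Complex.exp ((v ω : ℂ) * Complex.I)) P := fun v hv => by
    refine (integrable_const (1 : ℝ)).mono (by fun_prop) (ae_of_all _ fun ω => ?_)
    rw [Complex.norm_exp_ofReal_mul_I, norm_one]
  have hdiff : Tendsto (fun n => (∫ ω, Complex.exp ((x n ω : ℂ) * Complex.I) ∂P)
      - ∫ ω, Complex.exp ((y n ω : ℂ) * Complex.I) ∂P) atTop (𝓝 0) := by
    rw [Metric.tendsto_atTop']
    -- The product `g σ` need not be small in `L¹`. Where `σ ≤ R` it is at most `R g`; where `σ > R`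
    -- or `κ g > 1/2` the trivial bound `2` is absorbed by `(2/R) σ` or by `4 κ g`. The choice of
    -- `R` makes the mean of `(2/R) σ` at most `η / 4`.
    have key : ∀ η > 0, ∀ᶠ n in atTop, ‖(∫ ω, Complex.exp ((x n ω : ℂ) * Complex.I) ∂P)
      - ∫ ω, Complex.exp ((y n ω : ℂ) * Complex.I) ∂P‖ < η := fun η hη => by
      set R : ℝ := 8 * (|B| + 1) / η with hR
      have hR0 : 0 < R := by positivity
      have hsm : Tendsto (fun n => (4 * κ + c * R) * (∫ ω, g n ω ∂P) + ∫ ω, w n ω ∂P) atTop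
          (𝓝 0) := by simpa using (hgt.const_mul (4 * κ + c * R)).add hwt
      filter_upwards [hσB, hle, hsm.eventually_lt_const (half_pos hη)] with n hσB hle hsm
      rw [← integral_sub (hint _ (hx n)) (hint _ (hy n))]
      have hb1 : Integrable (fun ω => (4 * κ + c * R) * g n ω + w n ω) P :=
        ((hg n).const_mul _).add (hw n)
      have hb : Integrable (fun ω => (4 * κ + c * R) * g n ω + w n ω + 2 / R * σ n ω) P :=
        hb1.add ((hσ n).const_mul _)
      refine (norm_integral_le_of_norm_le hb ?_).trans_lt ?_
      · filter_upwards [hle] with ω hω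
        have p1 : 0 ≤ κ * g n ω := mul_nonneg hκ (hg0 n ω)
        have p2 : 0 ≤ c * R * g n ω := mul_nonneg (by positivity) (hg0 n ω)
        have p3 : 0 ≤ 2 / R * σ n ω := mul_nonneg (by positivity) (hσ0 n ω)
        have p4 := hw0 n ω
        have h2 : ‖Complex.exp ((x n ω : ℂ) * Complex.I)
            - Complex.exp ((y n ω : ℂ) * Complex.I)‖ ≤ 2 := by
          refine (norm_sub_le _ _).trans ?_
          rw [Complex.norm_exp_ofReal_mul_I, Complex.norm_exp_ofReal_mul_I]
          norm_num
        by_cases hk : κ * g n ω ≤ 1 / 2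
        · by_cases hs : σ n ω ≤ R
          · refine (norm_cexp_mul_I_sub_cexp_mul_I_le _ _).trans ((hω hk).trans ?_)
            have : c * (g n ω * σ n ω) ≤ c * (g n ω * R) :=
              mul_le_mul_of_nonneg_left (mul_le_mul_of_nonneg_left hs (hg0 n ω)) hc
            linarith
          · push Not at hs
            have : 2 ≤ 2 / R * σ n ω := by
              rw [div_mul_eq_mul_div, le_div_iff₀ hR0]; linarith
            linarith
        · push Not at hk
          linarith
      · rw [integral_add hb1 ((hσ n).const_mul _), integral_add ((hg n).const_mul _) (hw n),
          integral_const_mul, integral_const_mul]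
        have : 2 / R * ∫ ω, σ n ω ∂P ≤ η / 4 := by
          calc 2 / R * ∫ ω, σ n ω ∂P ≤ 2 / R * (|B| + 1) := by
                refine mul_le_mul_of_nonneg_left ?_ (by positivity)
                linarith [le_abs_self B]
            _ = η / 4 := by rw [hR]; field_simp; norm_num
        linarith
    intro η hη
    obtain ⟨N, hN⟩ := eventually_atTop.1 (key η hη)
    exact ⟨N, fun n hn => by simpa [dist_eq_norm] using hN n hn.le⟩
  simpa using hdiff.add hlim

/-- Perturbation of a linear system with an invertible matrix. -/
lemma abs_mulVec_sub_le {ι : Type*} [Fintype ι] [DecidableEq ι] {G G' : Matrix ι ι ℝ}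
    (hG : IsUnit G.det) {x s : ι → ℝ} (h : G'.mulVec x = s)
    (hsmall : (∑ i, ∑ j, |G⁻¹ i j|) * ∑ i, ∑ j, |G' i j - G i j| ≤ 1 / 2) (k : ι) :
    |G.mulVec x k - s k|
      ≤ 2 * (∑ i, ∑ j, |G⁻¹ i j|) * ((∑ i, ∑ j, |G' i j - G i j|) * ∑ i, |s i|) := by
  have hmul : ∀ (A : Matrix ι ι ℝ) (v : ι → ℝ),
      ∑ i, |A.mulVec v i| ≤ (∑ i, ∑ j, |A i j|) * ∑ i, |v i| := fun A v => by
    rw [Finset.sum_mul]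
    refine Finset.sum_le_sum fun i _ => (Finset.abs_sum_le_sum_abs _ _).trans ?_
    rw [Finset.sum_mul]
    refine Finset.sum_le_sum fun j _ => ?_
    rw [abs_mul]
    exact mul_le_mul_of_nonneg_left
      (Finset.single_le_sum (f := fun i => |v i|) (fun _ _ => abs_nonneg _) (Finset.mem_univ j))
      (abs_nonneg _)
  set κ := ∑ i, ∑ j, |G⁻¹ i j| with hκ
  set g := ∑ i, ∑ j, |G' i j - G i j| with hg
  have hκ0 : 0 ≤ κ := Finset.sum_nonneg fun _ _ => Finset.sum_nonneg fun _ _ => abs_nonneg _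
  have hg0 : 0 ≤ g := Finset.sum_nonneg fun _ _ => Finset.sum_nonneg fun _ _ => abs_nonneg _
  have hx0 : 0 ≤ ∑ i, |x i| := Finset.sum_nonneg fun _ _ => abs_nonneg _
  have h1 : ∀ i, G.mulVec x i - s i = -(G' - G).mulVec x i := fun i => by
    rw [Matrix.sub_mulVec, ← h, Pi.sub_apply]; ring
  have h2 : ∑ i, |(G' - G).mulVec x i| ≤ g * ∑ i, |x i| := hmul (G' - G) x
  -- Only `G` is inverted. The matrix `G'` may be singular, and `x` is any solution of its system;
  -- the smallness condition lets the term `κ g ∑ |x i|` be absorbed on the left.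
  have h3 : ∑ i, |x i| ≤ κ * ∑ i, |G.mulVec x i| := by
    have := hmul G⁻¹ (G.mulVec x)
    rwa [Matrix.mulVec_mulVec, Matrix.nonsing_inv_mul _ hG, Matrix.one_mulVec] at this
  have h4 : ∑ i, |G.mulVec x i| ≤ ∑ i, |s i| + g * ∑ i, |x i| := by
    refine le_trans ?_ (add_le_add_right h2 _)
    rw [← Finset.sum_add_distrib]
    refine Finset.sum_le_sum fun i _ => ?_
    have : G.mulVec x i = s i + -(G' - G).mulVec x i := by rw [← h1]; ring
    rw [this]
    exact (abs_add_le _ _).trans (by rw [abs_neg])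
  have h5 : ∑ i, |x i| ≤ 2 * κ * ∑ i, |s i| := by
    have := mul_le_mul_of_nonneg_left h4 hκ0
    have := mul_le_mul_of_nonneg_right hsmall hx0
    nlinarith
  rw [h1, abs_neg]
  calc |(G' - G).mulVec x k| ≤ ∑ i, |(G' - G).mulVec x i| :=
        Finset.single_le_sum (f := fun i => |(G' - G).mulVec x i|) (fun _ _ => abs_nonneg _)
          (Finset.mem_univ k)
    _ ≤ g * ∑ i, |x i| := h2
    _ ≤ g * (2 * κ * ∑ i, |s i|) := mul_le_mul_of_nonneg_left h5 hg0
    _ = _ := by ring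

end Perturbation

/-! ### Normal equations of the local linear fit. -/

section LeastSquares

variable {p : ℕ}

/-- The value of the local linear fit. -/
def fit (θ : (ℝ × Vec p) × (ℝ × Vec p)) (x : Vec p) (v : ℝ) : ℝ :=
  (θ.1.1 + inner ℝ x θ.1.2) + (θ.2.1 + inner ℝ x θ.2.2) * v

/-- The centered covariates, preceded by the constant `1`. -/
def design (m x : Vec p) : Unit ⊕ Fin p → ℝ := Sum.elim (fun _ => 1) fun l => x l - m l

lemma fit_add_smul (θ θ' : (ℝ × Vec p) × (ℝ × Vec p)) (τ : ℝ) (x : Vec p) (v : ℝ) :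
    fit (θ + τ • θ') x v = fit θ x v + τ * fit θ' x v := by
  simp only [fit, Prod.fst_add, Prod.snd_add, Prod.smul_fst, Prod.smul_snd, inner_add_right,
    inner_smul_right, smul_eq_mul]
  ring

lemma fit_sub (θ θ' : (ℝ × Vec p) × (ℝ × Vec p)) (x : Vec p) (v : ℝ) :
    fit (θ - θ') x v = fit θ x v - fit θ' x v := by
  simp only [fit, Prod.fst_sub, Prod.snd_sub, inner_sub_right]
  ring

lemma inner_eq_sum (x y : Vec p) : inner ℝ x y = ∑ l, x l * y l := by
  simp [PiLp.inner_apply, mul_comm]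

/-- Centring the covariates at `m` shifts a multiple of the slope into the intercept and leaves the
slope itself unchanged; measuring time in units of `h` multiplies the derivative coefficients by
`h`. The slope can therefore be read off in the new coordinates. -/
lemma exists_coord_fit {h : ℝ} (m : Vec p) (θ : (ℝ × Vec p) × (ℝ × Vec p)) :
    ∃ δ : (Unit ⊕ Fin p) × Fin 2 → ℝ, (∀ l, δ (Sum.inr l, 0) = θ.1.2 l) ∧
      ∀ x u, fit θ x (h * u) = ∑ kb, design m x kb.1 * u ^ (kb.2 : ℕ) * δ kb := by
  refine ⟨fun kb => if kb.2 = 0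
    then Sum.elim (fun _ => θ.1.1 + inner ℝ m θ.1.2) (fun l => θ.1.2 l) kb.1
    else h * Sum.elim (fun _ => θ.2.1 + inner ℝ m θ.2.2) (fun l => θ.2.2 l) kb.1,
    fun l => by simp, fun x u => ?_⟩
  have e : ∀ b : Vec p, inner ℝ x b = inner ℝ m b + ∑ l, (x l - m l) * b l := fun b => by
    rw [inner_eq_sum, inner_eq_sum, ← Finset.sum_add_distrib]
    exact Finset.sum_congr rfl fun l _ => by ring
  have e2 : ∀ b : Vec p, ∑ l, (x l - m l) * u * (h * b l) = h * u * ∑ l, (x l - m l) * b l :=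
    fun b => by
      rw [Finset.mul_sum]
      exact Finset.sum_congr rfl fun l _ => by ring
  rw [Fintype.sum_prod_type]
  simp only [Fin.sum_univ_two, Fintype.sum_sum_type, design, Sum.elim_inl, Sum.elim_inr,
    Finset.univ_unique, Finset.sum_singleton, Finset.sum_add_distrib, fit, e]
  simp [e2]
  ring

/-- Each new coordinate is an admissible direction of variation of the parameters, and the
first-order condition along it is one normal equation. -/
lemma exists_fit_eq_design {h : ℝ} (hh : h ≠ 0) (m : Vec p) (k : Unit ⊕ Fin p) (a : Fin 2) :
    ∃ θ : (ℝ × Vec p) × (ℝ × Vec p), ∀ x u,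
      fit θ x (h * u) = design m x k * u ^ (a : ℕ) := by
  have hs : ∀ (x : Vec p) l, inner ℝ x (EuclideanSpace.single l (1 : ℝ)) = x l := fun x l => by
    simp [EuclideanSpace.inner_single_right]
  obtain ⟨c, b, hcb⟩ : ∃ (c : ℝ) (b : Vec p), ∀ x, c + inner ℝ x b = design m x k := by
    rcases k with _ | l
    · exact ⟨1, 0, fun x => by simp [design]⟩
    · exact ⟨-m l, EuclideanSpace.single l 1, fun x => by rw [hs]; simp [design]; ring⟩
  fin_cases a
  · exact ⟨((c, b), (0, 0)), fun x u => by simp [fit, hcb]⟩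
  · refine ⟨((0, 0), (h⁻¹ * c, h⁻¹ • b)), fun x u => ?_⟩
    simp only [fit, inner_zero_right, inner_smul_right, add_zero, zero_add, ← mul_add, hcb]
    field_simp

lemma eq_zero_of_forall_mul_sq_sub_nonneg {a b : ℝ} (h : ∀ τ : ℝ, 0 ≤ a * τ ^ 2 - 2 * b * τ) :
    b = 0 := by
  by_contra hb
  -- The minimizer would be `b / a`; the denominator `|a| + 1` is never zero and still makes the
  -- value negative unless `b = 0`.
  have h1 := h (b / (|a| + 1))
  have ha : 0 < |a| + 1 := by positivity
  have hb2 : 0 < b ^ 2 := by positivity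
  have e : a * (b / (|a| + 1)) ^ 2 - 2 * b * (b / (|a| + 1))
      = b ^ 2 * (a - 2 * (|a| + 1)) / (|a| + 1) ^ 2 := by field_simp
  rw [e, le_div_iff₀ (by positivity), zero_mul] at h1
  nlinarith [le_abs_self a, abs_nonneg a]

/-- Normal equations of weighted least squares in the local linear design. -/
theorem exists_normal_equations {J : Type*} (S : Finset J) (w y u : J → ℝ) (x : J → Vec p)
    {h : ℝ} (hh : h ≠ 0) (m : Vec p) (θ₀ θ : (ℝ × Vec p) × (ℝ × Vec p))
    (hmin : IsMinOn (fun θ => ∑ j ∈ S, w j * (y j - fit θ (x j) (h * u j)) ^ 2) Set.univ θ) :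
    ∃ δ : (Unit ⊕ Fin p) × Fin 2 → ℝ, (∀ l, δ (Sum.inr l, 0) = (θ.1.2 - θ₀.1.2) l) ∧
      ∀ k : (Unit ⊕ Fin p) × Fin 2,
        ∑ l : (Unit ⊕ Fin p) × Fin 2, (∑ j ∈ S, w j * u j ^ ((k.2 : ℕ) + (l.2 : ℕ))
          * (design m (x j) k.1 * design m (x j) l.1)) * δ l
        = ∑ j ∈ S, w j * u j ^ (k.2 : ℕ) * (design m (x j) k.1
          * (y j - fit θ₀ (x j) (h * u j))) := by
  obtain ⟨δ, hδ, hfit⟩ := exists_coord_fit (h := h) m (θ - θ₀)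
  refine ⟨δ, fun l => hδ l, fun k => ?_⟩
  obtain ⟨θ', hθ'⟩ := exists_fit_eq_design hh m k.1 k.2
  -- First-order condition in the direction `θ'`: along the line through the minimizer the criterion
  -- is a quadratic polynomial which nowhere falls below its value there.
  have hzero : ∑ j ∈ S, w j * (y j - fit θ (x j) (h * u j)) * fit θ' (x j) (h * u j) = 0 := by
    refine eq_zero_of_forall_mul_sq_sub_nonneg
      (a := ∑ j ∈ S, w j * fit θ' (x j) (h * u j) ^ 2) fun τ => ?_
    have h1 := isMinOn_iff.1 hmin (θ + τ • θ') (Set.mem_univ _)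
    simp only [fit_add_smul] at h1
    rw [← sub_nonneg, ← Finset.sum_sub_distrib] at h1
    refine h1.trans (le_of_eq ?_)
    rw [Finset.mul_sum, Finset.sum_mul, Finset.sum_mul, ← Finset.sum_sub_distrib]
    exact Finset.sum_congr rfl fun j _ => by ring
  simp only [Finset.sum_mul]
  rw [Finset.sum_comm, ← sub_eq_zero, ← neg_eq_zero, ← hzero, neg_sub, ← Finset.sum_sub_distrib]
  refine Finset.sum_congr rfl fun j _ => ?_
  have e : ∑ l : (Unit ⊕ Fin p) × Fin 2, w j * u j ^ ((k.2 : ℕ) + (l.2 : ℕ))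
          * (design m (x j) k.1 * design m (x j) l.1) * δ l
        = w j * u j ^ (k.2 : ℕ) * design m (x j) k.1 * fit (θ - θ₀) (x j) (h * u j) := by
    rw [hfit, Finset.mul_sum]
    exact Finset.sum_congr rfl fun l _ => by rw [pow_add]; ring
  rw [e, hθ', fit_sub]
  ring

end LeastSquares

/-! ### Limit theorems for local sums over the subjects of the study. -/

namespace Study

variable {Ω : Type*} {p q : ℕ}

/-- The covariates and the response of subject `i` at time `s`. -/
def XY (D : Study Ω p q) (i : ℕ) (s : ℝ) (ω : Ω) : Vec p × ℝ := (D.X i s ω, D.Y i s ω)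

/-- The sum `∑_j f((T_ij - t) / h) F(T_ij, X_i(T_ij), Y_i(T_ij))` over the observation times of
subject `i`. -/
def localSum (D : Study Ω p q) (h t : ℝ) (f : ℝ → ℝ) (F : ℝ → Vec p × ℝ → ℝ) (i : ℕ) (ω : Ω) : ℝ :=
  ∑ j ∈ Finset.range (D.L i ω), f ((D.T i j ω - t) / h) * F (D.T i j ω) (D.XY i (D.T i j ω) ω)

variable [MeasurableSpace Ω] {P : Measure Ω} {D : Study Ω p q}

/-- Independent subjects, whose observation times have an intensity `ℓ ≤ Λ` and a joint
intensity bounded by `C`. -/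
structure IsSampled (D : Study Ω p q) (P : Measure Ω) (ℓ : ℝ → ℝ) (C : ℝ≥0) (Λ : ℝ) : Prop where
  iid : D.IsIIDSample P
  marked : ∀ i, IsMarked P (D.pathXY i) (D.L i) (D.T i) ℓ C
  continuousOn : ContinuousOn ℓ (Set.Icc 0 1)
  nonneg : ∀ s ∈ Set.Icc (0 : ℝ) 1, 0 ≤ ℓ s
  bound_nonneg : 0 ≤ Λ
  le_bound : ∀ s ∈ Set.Icc (0 : ℝ) 1, ℓ s ≤ Λ

lemma IsIIDSample.exists_isSampled [IsProbabilityMeasure P] (hD : D.IsIIDSample P) {lam : ℝ → ℝ}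
    (hobs : D.ObservationCond P lam) (hlam : ∀ s ∈ Set.Icc (0 : ℝ) 1, 0 ≤ lam s) :
    ∃ C Λ, D.IsSampled P lam C Λ := by
  obtain ⟨C, hC⟩ := hD.isMarked hobs hlam
  obtain ⟨Λ, hΛ⟩ := isCompact_Icc.exists_bound_of_continuousOn hobs.contDiff_lam.continuousOn
  exact ⟨C, Λ, hD, hC, hobs.contDiff_lam.continuousOn, hlam,
    (norm_nonneg _).trans (hΛ 0 (by simp)), fun s hs => (le_abs_self _).trans (hΛ s hs)⟩

lemma IsIIDSample.measurable_XY (hD : D.IsIIDSample P) (i : ℕ) (s : ℝ) : Measurable (D.XY i s) :=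
  (hD.measurable_X i s).prodMk (hD.measurable_Y i s)

lemma IsIIDSample.identDistrib_XY (hD : D.IsIIDSample P) (i : ℕ) (s s' : ℝ) :
    IdentDistrib (fun ω => (D.XY i s ω, D.XY i s' ω)) (fun ω => (D.XY 0 s ω, D.XY 0 s' ω)) P P :=
  hD.identDistrib_pair i s s'

lemma IsIIDSample.exists_kernelSum_eq (hD : D.IsIIDSample P) :
    ∃ Φ : ℕ → ℝ × (ℝ → Vec p × ℝ) → Vec p × ℝ, (∀ i, Measurable (Φ i)) ∧
      (∀ i s ω, Φ i (s, D.pathXY i ω) = D.XY i s ω) ∧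
      ∀ (h t : ℝ) (f : ℝ → ℝ) (F : ℝ → Vec p × ℝ → ℝ) (i : ℕ),
        kernelSum (D.pathXY i) (D.L i) (D.T i) h t f (fun s u => F s (Φ i (s, u)))
          = D.localSum h t f F i := by
  choose Φ hΦ h using fun i => hD.exists_eval i
  refine ⟨Φ, hΦ, h, fun a t f F i => ?_⟩
  ext ω
  simp only [kernelSum, localSum, h]
  rfl

variable {ℓ : ℝ → ℝ} {C : ℝ≥0} {Λ t : ℝ} {f : ℝ → ℝ} {F : ℝ → Vec p × ℝ → ℝ}

namespace IsSampled

lemma measurable_localSum (hS : D.IsSampled P ℓ C Λ) (h t : ℝ) (hf : Measurable f)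
    (hF : Measurable (Function.uncurry F)) (i : ℕ) : Measurable (D.localSum h t f F i) := by
  obtain ⟨Φ, hΦ, hΦe, hks⟩ := hS.iid.exists_kernelSum_eq
  rw [← hks]
  exact (hS.marked i).measurable_kernelSum h t hf
    (ψ := fun s u => F s (Φ i (s, u))) (hF.comp (measurable_fst.prodMk (hΦ i)))

lemma lintegral_XY (hS : D.IsSampled P ℓ C Λ) {G : Vec p × ℝ → ℝ≥0∞} (hG : Measurable G) (i : ℕ)
    (s : ℝ) : ∫⁻ ω, G (D.XY i s ω) ∂P = ∫⁻ ω, G (D.XY 0 s ω) ∂P :=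
  ((hS.iid.identDistrib_XY i s s).comp
    (hG.comp measurable_fst)).lintegral_eq

lemma integral_XY (hS : D.IsSampled P ℓ C Λ) {G : Vec p × ℝ → ℝ} (hG : Measurable G) (i : ℕ)
    (s : ℝ) : ∫ ω, G (D.XY i s ω) ∂P = ∫ ω, G (D.XY 0 s ω) ∂P :=
  ((hS.iid.identDistrib_XY i s s).comp
    (hG.comp measurable_fst)).integral_eq

lemma measurable_uncurry_right (hF : Measurable (Function.uncurry F)) (s : ℝ) :
    Measurable (F s) := hF.comp (measurable_const.prodMk measurable_id)

variable [IsProbabilityMeasure P]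

/-- First moment bound for local sums. -/
lemma integral_abs_localSum_le (hS : D.IsSampled P ℓ C Λ) {h : ℝ} (hh : 0 < h) (t : ℝ)
    (hf : Measurable f) (hfi : Integrable f) (hF : Measurable (Function.uncurry F)) {b : ℝ}
    (hb0 : 0 ≤ b) (hb : ∀ s ∈ Set.Icc (0 : ℝ) 1,
      ∫⁻ ω, ENNReal.ofReal |F s (D.XY 0 s ω)| ∂P ≤ ENNReal.ofReal b) (i : ℕ) :
    Integrable (D.localSum h t f F i) P ∧
      ∫ ω, |D.localSum h t f F i ω| ∂P ≤ Λ * h * ((∫ z, |f z|) * b) := by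
  obtain ⟨Φ, hΦ, hΦe, hks⟩ := hS.iid.exists_kernelSum_eq
  rw [← hks]
  refine (hS.marked i).integral_abs_kernelSum_le_of_bound hS.bound_nonneg hS.le_bound hh t hf hfi
    (ψ := fun s u => F s (Φ i (s, u))) (hF.comp (measurable_fst.prodMk (hΦ i))) hb0 fun s hs => ?_
  simp only [hΦe]
  rw [hS.lintegral_XY (measurable_uncurry_right hF s).abs.ennreal_ofReal]
  exact hb s hs

/-- Law of large numbers for local sums. -/
theorem tendsto_integral_abs_average_localSum_sub (hS : D.IsSampled P ℓ C Λ)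
    (ht : t ∈ Set.Ioo (0 : ℝ) 1) {h : ℕ → ℝ}
    (hh : ∀ n, 0 < h n) (hh0 : Tendsto h atTop (𝓝 0))
    (hnh : Tendsto (fun n : ℕ => (n : ℝ) * h n) atTop atTop)
    (hf : Measurable f) (hfi : Integrable f) (hF : Measurable (Function.uncurry F)) {v : ℝ → ℝ}
    (hv : ContinuousOn v (Set.Icc 0 1))
    (hFv : ∀ s ∈ Set.Icc (0 : ℝ) 1, ∫ ω, F s (D.XY 0 s ω) ∂P = v s) {b : ℝ} (hb0 : 0 ≤ b)
    (hb : ∀ s ∈ Set.Icc (0 : ℝ) 1,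
      ∫⁻ ω, ENNReal.ofReal |F s (D.XY 0 s ω)| ∂P ≤ ENNReal.ofReal b)
    (hcont : Tendsto (fun s => ∫⁻ ω, ENNReal.ofReal |F s (D.XY 0 s ω) - F t (D.XY 0 t ω)| ∂P)
      (𝓝 t) (𝓝 0)) :
    Tendsto (fun n : ℕ => ∫ ω, |(n : ℝ)⁻¹ * ∑ i ∈ Finset.range n,
        (h n)⁻¹ * D.localSum (h n) t f F i ω - (∫ z, f z) * (ℓ t * v t)| ∂P) atTop (𝓝 0) := by
  obtain ⟨Φ, hΦ, hΦe, hks⟩ := hS.iid.exists_kernelSum_eq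
  have hFs := fun s => measurable_uncurry_right hF s
  have hF0 : ∀ s, Measurable fun ω => F s (D.XY 0 s ω) := fun s =>
    (hFs s).comp (hS.iid.measurable_XY 0 s)
  have htI : t ∈ Set.Icc (0 : ℝ) 1 := Set.Ioo_subset_Icc_self ht
  have hint := (integrable_of_lintegral_abs_le (hF0 t).aestronglyMeasurable hb0 (hb t htI)).1
  simp only [← hks]
  refine tendsto_integral_abs_average_kernelSum_sub
    (V := fun i s u => F s (Φ i (s, u)))
    (w := fun s => (Set.Icc (0 : ℝ) 1).indicator
      (fun s => ∫⁻ ω, ENNReal.ofReal |F s (D.XY 0 s ω) - F t (D.XY 0 t ω)| ∂P) s)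
    (B := 2 * b.toNNReal) hS.marked hS.iid.iIndepFun_marked
    hS.bound_nonneg hS.le_bound hS.continuousOn hS.nonneg ht hh hh0 hnh hf hfi
    (fun i => hF.comp (measurable_fst.prodMk (hΦ i))) hv ?_ hb0 ?_ ?_ ?_ ?_ ?_
  · intro i s hs
    simp only [hΦe]
    rw [hS.integral_XY (hFs s), hFv s hs]
  · intro i s hs
    simp only [hΦe]
    rw [hS.lintegral_XY (hFs s).abs.ennreal_ofReal]
    exact hb s hs
  · refine tendsto_of_tendsto_of_tendsto_of_le_of_le tendsto_const_nhds hcont (fun s => zero_le)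
      fun s => Set.indicator_le_self _ _ s
  · intro s hs
    rw [Set.indicator_of_mem hs]
    refine (lintegral_mono (g := fun ω => ENNReal.ofReal |F s (D.XY 0 s ω)|
      + ENNReal.ofReal |F t (D.XY 0 t ω)|) fun ω => ?_).trans ?_
    · beta_reduce
      rw [← ENNReal.ofReal_add (abs_nonneg _) (abs_nonneg _)]
      exact ENNReal.ofReal_le_ofReal (abs_sub _ _)
    · rw [lintegral_add_left (hF0 s).abs.ennreal_ofReal]
      refine (add_le_add (hb s hs) (hb t htI)).trans (le_of_eq ?_)
      rw [← two_mul, ENNReal.coe_mul]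
      rfl
  · intro i s hs
    rw [Set.indicator_of_mem hs]
    simp only [hΦe]
    have hGm : Measurable fun z : (Vec p × ℝ) × (Vec p × ℝ) =>
        ENNReal.ofReal |F s z.1 - F t z.2| :=
      (((hFs s).comp measurable_fst).sub ((hFs t).comp measurable_snd)).abs.ennreal_ofReal
    exact ((hS.iid.identDistrib_XY i s t).comp hGm).lintegral_eq.le
  · intro η hη
    obtain ⟨M, hM⟩ := ((tendsto_integral_sub_trunc hint).eventually_le_const hη).exists
    refine ⟨M, by positivity, fun i => ?_⟩
    simp only [hΦe]
    have hGm : Measurable fun z => ENNReal.ofReal |F t z - trunc M (F t z)| :=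
      ((hFs t).sub ((measurable_trunc M).comp (hFs t))).abs.ennreal_ofReal
    rw [hS.lintegral_XY hGm, lintegral_ofReal_abs]
    · exact ENNReal.ofReal_le_ofReal hM
    · exact hint.sub (hint.mono ((measurable_trunc M).comp (hF0 t)).aestronglyMeasurable
        (ae_of_all _ fun ω => abs_trunc_le_abs _ _))

/-- Second moment of normalized sums of local sums with mean zero. -/
theorem integral_sq_normalized_localSum_le (hS : D.IsSampled P ℓ C Λ) {h : ℝ} (hh : 0 < h) (t : ℝ)
    (hf : Measurable f) (hfi : Integrable f) (hF : Measurable (Function.uncurry F))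
    (hF0 : ∀ s ∈ Set.Icc (0 : ℝ) 1, ∫ ω, F s (D.XY 0 s ω) ∂P = 0) {b c : ℝ} (hb0 : 0 ≤ b)
    (hc0 : 0 ≤ c) (hc : kernelAvg h t (fun z => ENNReal.ofReal (f z ^ 2))
      (fun s => ∫⁻ ω, ENNReal.ofReal (F s (D.XY 0 s ω) ^ 2) ∂P) ≤ ENNReal.ofReal c)
    (hb : ∀ s ∈ Set.Icc (0 : ℝ) 1,
      ∫⁻ ω, ENNReal.ofReal (F s (D.XY 0 s ω) ^ 2) ∂P ≤ ENNReal.ofReal b) (n : ℕ) :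
    MemLp (fun ω => (√(n : ℝ))⁻¹ * ∑ i ∈ Finset.range n, (√h)⁻¹ * D.localSum h t f F i ω) 2 P ∧
    ∫ ω, ((√(n : ℝ))⁻¹ * ∑ i ∈ Finset.range n, (√h)⁻¹ * D.localSum h t f F i ω) ^ 2 ∂P
      ≤ Λ * c + C * h * (∫ z, |f z|) ^ 2 * b := by
  obtain ⟨Φ, hΦ, hΦe, hks⟩ := hS.iid.exists_kernelSum_eq
  have hsq : ∀ i s, ∫⁻ ω, ENNReal.ofReal (F s (Φ i (s, D.pathXY i ω)) ^ 2) ∂P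
      = ∫⁻ ω, ENNReal.ofReal (F s (D.XY 0 s ω) ^ 2) ∂P := fun i s => by
    simp only [hΦe]
    exact hS.lintegral_XY ((measurable_uncurry_right hF s).pow_const 2).ennreal_ofReal i s
  obtain ⟨h1, -, h3⟩ := integral_sq_normalized_kernelSum_le (t := t)
    (ψ := fun i s u => F s (Φ i (s, u))) hS.marked
    hS.iid.iIndepFun_marked hS.bound_nonneg hS.le_bound hS.continuousOn hS.nonneg hh hf hfi
    (fun i => hF.comp (measurable_fst.prodMk (hΦ i))) (fun i s hs => by
      simp only [hΦe]
      rw [hS.integral_XY (measurable_uncurry_right hF s), hF0 s hs]) hb0 hc0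
    (fun i => by simpa only [hsq] using hc) (fun i s hs => by rw [hsq]; exact hb s hs)
  simp only [hks] at h1 h3
  exact ⟨(memLp_finsetSum _ fun i _ => h1 i).const_mul _, h3 n⟩

/-- Central limit theorem for local sums. -/
theorem tendsto_integral_cexp_localSum (hS : D.IsSampled P ℓ C Λ)
    (ht : t ∈ Set.Ioo (0 : ℝ) 1) {h : ℕ → ℝ}
    (hh : ∀ n, 0 < h n) (hh0 : Tendsto h atTop (𝓝 0))
    (hnh : Tendsto (fun n : ℕ => (n : ℝ) * h n) atTop atTop)
    (hf : Measurable f) (hfi : Integrable f) (hf2 : Integrable fun z => f z ^ 2)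
    (hF : Measurable (Function.uncurry F))
    (hF0 : ∀ s ∈ Set.Icc (0 : ℝ) 1, ∫ ω, F s (D.XY 0 s ω) ∂P = 0)
    {v : ℝ → ℝ} (hv : ContinuousOn v (Set.Icc 0 1))
    (hFv : ∀ s ∈ Set.Icc (0 : ℝ) 1, ∫ ω, F s (D.XY 0 s ω) ^ 2 ∂P = v s)
    {b b' r : ℝ} (hb0 : 0 ≤ b) (hb'0 : 0 ≤ b')
    (hb : ∀ s ∈ Set.Icc (0 : ℝ) 1,
      ∫⁻ ω, ENNReal.ofReal (F s (D.XY 0 s ω) ^ 2) ∂P ≤ ENNReal.ofReal b) (hr : 2 < r)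
    (hb' : ∀ s ∈ Set.Icc (0 : ℝ) 1,
      ∫⁻ ω, ENNReal.ofReal (|F s (D.XY 0 s ω)| ^ r) ∂P ≤ ENNReal.ofReal b') :
    Tendsto (fun n : ℕ => ∫ ω, Complex.exp ((((√(n : ℝ))⁻¹ * ∑ i ∈ Finset.range n,
        (√(h n))⁻¹ * D.localSum (h n) t f F i ω : ℝ) : ℂ) * Complex.I) ∂P) atTop
      (𝓝 (Complex.exp ((-((∫ z, f z ^ 2) * (ℓ t * v t)) / 2 : ℝ) : ℂ))) := by
  obtain ⟨Φ, hΦ, hΦe, hks⟩ := hS.iid.exists_kernelSum_eq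
  have hFs := fun s => measurable_uncurry_right hF s
  simp only [← hks]
  refine tendsto_integral_cexp_kernelSum (ψ := fun i s u => F s (Φ i (s, u))) hS.marked
    hS.iid.iIndepFun_marked hS.bound_nonneg hS.le_bound hS.continuousOn hS.nonneg ht hh hh0 hnh
    hf hfi hf2 (fun i => hF.comp (measurable_fst.prodMk (hΦ i))) ?_ hv ?_ hb0 hb'0 ?_ hr ?_
  all_goals intro i s hs; simp only [hΦe]
  · rw [hS.integral_XY (hFs s), hF0 s hs]
  · rw [hS.integral_XY ((hFs s).pow_const 2), hFv s hs]
  · rw [hS.lintegral_XY ((hFs s).pow_const 2).ennreal_ofReal]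
    exact hb s hs
  · rw [hS.lintegral_XY (G := fun z => ENNReal.ofReal (|F s z| ^ r))
      ((hFs s).abs.pow_const r).ennreal_ofReal]
    exact hb' s hs

end IsSampled

end Study

/-! ### Second moments of the covariates and their continuity in time. -/

section SecondMoments

variable {Ω : Type*} [MeasurableSpace Ω] {P : Measure Ω}

lemma integral_sub_sq {r r' : Ω → ℝ} (hr : MemLp r 2 P) (hr' : MemLp r' 2 P) :
    ∫ ω, (r ω - r' ω) ^ 2 ∂P
      = ∫ ω, r ω * r ω ∂P - 2 * ∫ ω, r ω * r' ω ∂P + ∫ ω, r' ω * r' ω ∂P := by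
  have i1 : Integrable (fun ω => r ω * r ω) P := hr.integrable_mul hr
  have i2 : Integrable (fun ω => r ω * r' ω) P := hr.integrable_mul hr'
  have i3 : Integrable (fun ω => r' ω * r' ω) P := hr'.integrable_mul hr'
  have e : ∀ ω, (r ω - r' ω) ^ 2 = r ω * r ω - 2 * (r ω * r' ω) + r' ω * r' ω := fun ω => by ring
  have i4 : Integrable (fun ω => r ω * r ω - 2 * (r ω * r' ω)) P := i1.sub (i2.const_mul 2)
  simp only [e]
  rw [integral_add i4 i3, integral_sub i1 (i2.const_mul 2), integral_const_mul]

lemma lintegral_abs_mul_sub_mul_le {f g f' g' : Ω → ℝ} (hf : MemLp f 2 P) (hg : MemLp g 2 P)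
    (hf' : MemLp f' 2 P) (hg' : MemLp g' 2 P) :
    ∫⁻ ω, ENNReal.ofReal |f ω * g ω - f' ω * g' ω| ∂P
      ≤ ENNReal.ofReal (√(∫ ω, (f ω - f' ω) ^ 2 ∂P) * √(∫ ω, g ω ^ 2 ∂P)
        + √(∫ ω, f' ω ^ 2 ∂P) * √(∫ ω, (g ω - g' ω) ^ 2 ∂P)) := by
  have hs : MemLp (fun ω => f ω - f' ω) 2 P := hf.sub hf'
  have hs' : MemLp (fun ω => g ω - g' ω) 2 P := hg.sub hg'
  have i1 : Integrable (fun ω => |(f ω - f' ω) * g ω|) P := (hs.integrable_mul hg).abs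
  have i2 : Integrable (fun ω => |f' ω * (g ω - g' ω)|) P := (hf'.integrable_mul hs').abs
  have i0 : Integrable (fun ω => f ω * g ω - f' ω * g' ω) P :=
    (hf.integrable_mul hg).sub (hf'.integrable_mul hg')
  rw [lintegral_ofReal_abs i0]
  refine ENNReal.ofReal_le_ofReal ?_
  refine (integral_mono i0.abs (i1.add i2) fun ω => ?_).trans ((integral_add i1 i2).le.trans
    (add_le_add (integral_abs_mul_le_sqrt hs hg) (integral_abs_mul_le_sqrt hf' hs')))
  have e : f ω * g ω - f' ω * g' ω = (f ω - f' ω) * g ω + f' ω * (g ω - g' ω) := by ring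
  simp only [e]
  exact abs_add_le _ _

lemma integral_const_add_mul_const_add [IsProbabilityMeasure P] {r r' : Ω → ℝ} (hr : MemLp r 2 P) (hr' : MemLp r' 2 P)
    (h0 : ∫ ω, r ω ∂P = 0) (h0' : ∫ ω, r' ω ∂P = 0) (a b : ℝ) :
    ∫ ω, (a + r ω) * (b + r' ω) ∂P = a * b + ∫ ω, r ω * r' ω ∂P := by
  have hi := hr.integrable one_le_two
  have hi' := hr'.integrable one_le_two
  have hp : Integrable (fun ω => r ω * r' ω) P := hr.integrable_mul hr'
  have e : ∀ ω, (a + r ω) * (b + r' ω) = a * b + (a * r' ω + (b * r ω + r ω * r' ω)) :=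
    fun ω => by ring
  have i1 : Integrable (fun ω => b * r ω + r ω * r' ω) P := (hi.const_mul b).add hp
  have i2 : Integrable (fun ω => a * r' ω + (b * r ω + r ω * r' ω)) P := (hi'.const_mul a).add i1
  simp only [e]
  rw [integral_add (integrable_const _) i2, integral_add (hi'.const_mul a) i1,
    integral_add (hi.const_mul b) hp, integral_const_mul a r', integral_const_mul b r,
    h0, h0']
  simp

end SecondMoments

namespace Study

variable {Ω : Type*} [MeasurableSpace Ω] {P : Measure Ω} {p q : ℕ} {D : Study Ω p q}

/-- The random part of the design vector. -/
def designXc (D : Study Ω p q) (P : Measure Ω) (s : ℝ) (ω : Ω) : Unit ⊕ Fin p → ℝ :=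
  Sum.elim (fun _ => 0) fun l => D.Xc P s ω l

/-- The covariances of the random parts of the design vectors at two times. -/
def designCov (D : Study Ω p q) (P : Measure Ω) (k l : Unit ⊕ Fin p) (s s' : ℝ) : ℝ :=
  ∫ ω, D.designXc P s ω k * D.designXc P s' ω l ∂P

/-- The mean function of the covariates. -/
def meanX (D : Study Ω p q) (P : Measure Ω) (s : ℝ) : Vec p := ∫ ω, D.X 0 s ω ∂P

lemma design_X (m : Vec p) (s : ℝ) (ω : Ω) (k : Unit ⊕ Fin p) :
    design m (D.X 0 s ω) k = design m (D.meanX P s) k + D.designXc P s ω k := by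
  rcases k with _ | l
  · simp [design, designXc]
  · simp [design, designXc, Xc, meanX]

variable {β₀ : ℝ → Vec p} {γ₀ : ℝ → Vec q} {lam : ℝ → ℝ} {s s' t : ℝ}

lemma continuousOn_designCov (hreg : D.RegularityCond P lam β₀ γ₀) (k l : Unit ⊕ Fin p) :
    ContinuousOn (fun u : ℝ × ℝ => D.designCov P k l u.1 u.2)
      (Set.Icc 0 1 ×ˢ Set.Icc 0 1) := by
  rcases k with _ | k <;> rcases l with _ | l
  · simpa [designCov, designXc] using continuousOn_const
  · simpa [designCov, designXc] using continuousOn_const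
  · simpa [designCov, designXc] using continuousOn_const
  · exact (hreg.contDiff_cov k l).continuousOn

lemma continuousOn_designCov_diag (hreg : D.RegularityCond P lam β₀ γ₀) (k l : Unit ⊕ Fin p) :
    ContinuousOn (fun s => D.designCov P k l s s) (Set.Icc 0 1) :=
  (continuousOn_designCov hreg k l).comp (f := fun s : ℝ => (s, s))
    (by fun_prop) fun _ hs => ⟨hs, hs⟩

lemma continuousOn_designCov_left (hreg : D.RegularityCond P lam β₀ γ₀) (k l : Unit ⊕ Fin p)
    (ht : t ∈ Set.Icc (0 : ℝ) 1) : ContinuousOn (fun s => D.designCov P k l s t) (Set.Icc 0 1) :=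
  (continuousOn_designCov hreg k l).comp (f := fun s : ℝ => (s, t))
    (by fun_prop) fun _ hs => ⟨hs, ht⟩

lemma continuousOn_design_meanX (hreg : D.RegularityCond P lam β₀ γ₀) (m : Vec p)
    (k : Unit ⊕ Fin p) : ContinuousOn (fun s => design m (D.meanX P s) k) (Set.Icc 0 1) := by
  rcases k with _ | k
  · exact continuousOn_const
  · exact ((EuclideanSpace.proj k : Vec p →L[ℝ] ℝ).continuous.comp_continuousOn
      hreg.continuous_mean).sub continuousOn_const

lemma continuousOn_integral_design (hreg : D.RegularityCond P lam β₀ γ₀)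
    (m : Vec p) (k l : Unit ⊕ Fin p) : ContinuousOn (fun s => design m (D.meanX P s) k *
      design m (D.meanX P s) l + D.designCov P k l s s) (Set.Icc 0 1) :=
  ((continuousOn_design_meanX hreg m k).mul (continuousOn_design_meanX hreg m l)).add
    (continuousOn_designCov_diag hreg k l)

variable [IsProbabilityMeasure P]

lemma memLp_designXc (hmodel : D.Model P β₀ γ₀) (hs : s ∈ Set.Icc (0 : ℝ) 1)
    (k : Unit ⊕ Fin p) : MemLp (fun ω => D.designXc P s ω k) 2 P := by
  rcases k with _ | l
  · exact memLp_const 0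
  · exact memLp_Xc_apply hmodel hs l

lemma integral_designXc (hmodel : D.Model P β₀ γ₀) (hs : s ∈ Set.Icc (0 : ℝ) 1)
    (k : Unit ⊕ Fin p) : ∫ ω, D.designXc P s ω k ∂P = 0 := by
  rcases k with _ | l
  · simp [designXc]
  · exact integral_Xc_apply hmodel hs l

lemma memLp_design (hmodel : D.Model P β₀ γ₀) (hs : s ∈ Set.Icc (0 : ℝ) 1) (m : Vec p)
    (k : Unit ⊕ Fin p) : MemLp (fun ω => design m (D.X 0 s ω) k) 2 P := by
  simp only [design_X (P := P)]
  exact MemLp.add (f := fun _ => design m (D.meanX P s) k) (memLp_const _)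
    (memLp_designXc hmodel hs k)

lemma integral_design_mul_design (hmodel : D.Model P β₀ γ₀) (hs : s ∈ Set.Icc (0 : ℝ) 1)
    (m : Vec p) (k l : Unit ⊕ Fin p) :
    ∫ ω, design m (D.X 0 s ω) k * design m (D.X 0 s ω) l ∂P
      = design m (D.meanX P s) k * design m (D.meanX P s) l + D.designCov P k l s s := by
  simp only [design_X (P := P)]
  exact integral_const_add_mul_const_add (memLp_designXc hmodel hs k) (memLp_designXc hmodel hs l)
    (integral_designXc hmodel hs k) (integral_designXc hmodel hs l) _ _

lemma exists_integral_sq_design_le (hmodel : D.Model P β₀ γ₀)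
    (hreg : D.RegularityCond P lam β₀ γ₀) (m : Vec p) :
    ∃ B : ℝ, 0 ≤ B ∧ ∀ k, ∀ s ∈ Set.Icc (0 : ℝ) 1,
      ∫ ω, design m (D.X 0 s ω) k ^ 2 ∂P ≤ B := by
  choose B hB using fun k : Unit ⊕ Fin p =>
    isCompact_Icc.exists_bound_of_continuousOn (continuousOn_integral_design hreg m k k)
  have hB0 : ∀ k, 0 ≤ B k := fun k => (norm_nonneg _).trans (hB k 0 (by simp))
  refine ⟨∑ k, B k, Finset.sum_nonneg fun k _ => hB0 k, fun k s hs => ?_⟩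
  simp only [sq]
  rw [integral_design_mul_design hmodel hs]
  exact (le_abs_self _).trans ((hB k s hs).trans
    (Finset.single_le_sum (fun k _ => hB0 k) (Finset.mem_univ k)))

lemma integral_sq_design_sub (hmodel : D.Model P β₀ γ₀) (hs : s ∈ Set.Icc (0 : ℝ) 1)
    (hs' : s' ∈ Set.Icc (0 : ℝ) 1) (m : Vec p) (k : Unit ⊕ Fin p) :
    ∫ ω, (design m (D.X 0 s ω) k - design m (D.X 0 s' ω) k) ^ 2 ∂P
      = (design m (D.meanX P s) k - design m (D.meanX P s') k) ^ 2
        + (D.designCov P k k s s - 2 * D.designCov P k k s s' + D.designCov P k k s' s') := by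
  have hr := memLp_designXc hmodel hs k
  have hr' := memLp_designXc hmodel hs' k
  have hd : MemLp (fun ω => D.designXc P s ω k - D.designXc P s' ω k) 2 P := hr.sub hr'
  have h0 : ∫ ω, (D.designXc P s ω k - D.designXc P s' ω k) ∂P = 0 := by
    rw [integral_sub (hr.integrable one_le_two) (hr'.integrable one_le_two),
      integral_designXc hmodel hs, integral_designXc hmodel hs', sub_zero]
  have h := integral_const_add_mul_const_add hd hd h0 h0
    (design m (D.meanX P s) k - design m (D.meanX P s') k)
    (design m (D.meanX P s) k - design m (D.meanX P s') k)
  simp only [← sq] at h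
  rw [integral_sub_sq hr hr'] at h
  simp only [designCov]
  rw [← h]
  simp only [design_X (P := P)]
  refine integral_congr_ae (ae_of_all _ fun ω => ?_)
  ring

/-- Mean-square continuity is a consequence of the continuity of the mean and of the covariance
function, the latter in both arguments; continuity of paths is not involved. -/
lemma tendsto_integral_sq_design_sub (hmodel : D.Model P β₀ γ₀)
    (hreg : D.RegularityCond P lam β₀ γ₀) (ht : t ∈ Set.Ioo (0 : ℝ) 1) (m : Vec p)
    (k : Unit ⊕ Fin p) :
    Tendsto (fun s => ∫ ω, (design m (D.X 0 s ω) k - design m (D.X 0 t ω) k) ^ 2 ∂P)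
      (𝓝 t) (𝓝 0) := by
  have htI : t ∈ Set.Icc (0 : ℝ) 1 := Set.Ioo_subset_Icc_self ht
  have hnhds : Set.Icc (0 : ℝ) 1 ∈ 𝓝 t := Icc_mem_nhds ht.1 ht.2
  have hc : ContinuousOn (fun s => (design m (D.meanX P s) k - design m (D.meanX P t) k) ^ 2
      + (D.designCov P k k s s - 2 * D.designCov P k k s t + D.designCov P k k t t))
      (Set.Icc 0 1) :=
    (((continuousOn_design_meanX hreg m k).sub continuousOn_const).pow 2).add
      (((continuousOn_designCov_diag hreg k k).sub
        ((continuousOn_designCov_left hreg k k htI).const_mul 2)).add continuousOn_const)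
  have h := (hc.continuousAt hnhds).tendsto
  have e : (design m (D.meanX P t) k - design m (D.meanX P t) k) ^ 2
      + (D.designCov P k k t t - 2 * D.designCov P k k t t + D.designCov P k k t t) = 0 := by ring
  rw [e] at h
  refine h.congr' ?_
  filter_upwards [hnhds] with s hs
  exact (integral_sq_design_sub hmodel hs htI m k).symm

lemma tendsto_lintegral_design_mul_sub (hmodel : D.Model P β₀ γ₀)
    (hreg : D.RegularityCond P lam β₀ γ₀) (ht : t ∈ Set.Ioo (0 : ℝ) 1) (m : Vec p)
    (k l : Unit ⊕ Fin p) :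
    Tendsto (fun s => ∫⁻ ω, ENNReal.ofReal |design m (D.X 0 s ω) k * design m (D.X 0 s ω) l
      - design m (D.X 0 t ω) k * design m (D.X 0 t ω) l| ∂P) (𝓝 t) (𝓝 0) := by
  obtain ⟨B, hB0, hB⟩ := exists_integral_sq_design_le hmodel hreg m
  have htI : t ∈ Set.Icc (0 : ℝ) 1 := Set.Ioo_subset_Icc_self ht
  have hnhds : Set.Icc (0 : ℝ) 1 ∈ 𝓝 t := Icc_mem_nhds ht.1 ht.2
  have hk := (tendsto_integral_sq_design_sub hmodel hreg ht m k).sqrt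
  have hl := (tendsto_integral_sq_design_sub hmodel hreg ht m l).sqrt
  have hlim := ENNReal.tendsto_ofReal ((hk.mul_const √B).add (hl.const_mul √B))
  simp only [Real.sqrt_zero, zero_mul, mul_zero, add_zero, ENNReal.ofReal_zero] at hlim
  refine tendsto_of_tendsto_of_tendsto_of_le_of_le' tendsto_const_nhds hlim
    (Eventually.of_forall fun _ => zero_le) ?_
  filter_upwards [hnhds] with s hs
  refine (lintegral_abs_mul_sub_mul_le (memLp_design hmodel hs m k) (memLp_design hmodel hs m l)
    (memLp_design hmodel htI m k) (memLp_design hmodel htI m l)).trans ?_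
  refine ENNReal.ofReal_le_ofReal ?_
  gcongr
  · exact hB l s hs
  · exact hB k t htI

lemma exists_lintegral_abs_design_mul_le (hmodel : D.Model P β₀ γ₀)
    (hreg : D.RegularityCond P lam β₀ γ₀) (m : Vec p) :
    ∃ B : ℝ, 0 ≤ B ∧ ∀ k l, ∀ s ∈ Set.Icc (0 : ℝ) 1,
      ∫⁻ ω, ENNReal.ofReal |design m (D.X 0 s ω) k * design m (D.X 0 s ω) l| ∂P
        ≤ ENNReal.ofReal B := by
  obtain ⟨B, hB0, hB⟩ := exists_integral_sq_design_le hmodel hreg m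
  refine ⟨√B * √B, by positivity, fun k l s hs => ?_⟩
  have hi : Integrable (fun ω => design m (D.X 0 s ω) k * design m (D.X 0 s ω) l) P :=
    (memLp_design hmodel hs m k).integrable_mul (memLp_design hmodel hs m l)
  rw [lintegral_ofReal_abs hi]
  refine ENNReal.ofReal_le_ofReal ((integral_abs_mul_le_sqrt (memLp_design hmodel hs m k)
    (memLp_design hmodel hs m l)).trans ?_)
  gcongr
  · exact hB k s hs
  · exact hB l s hs

lemma one_add_norm_sq_eq_sum_design (x : Vec p) : 1 + ‖x‖ ^ 2 = ∑ k, design 0 x k ^ 2 := by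
  rw [EuclideanSpace.norm_sq_eq]
  simp [design]

lemma exists_lintegral_design_mul_norm_le (hmodel : D.Model P β₀ γ₀)
    (hreg : D.RegularityCond P lam β₀ γ₀) (m : Vec p) :
    ∃ B : ℝ, 0 ≤ B ∧ ∀ k, ∀ s ∈ Set.Icc (0 : ℝ) 1,
      ∫⁻ ω, ENNReal.ofReal |(|design m (D.X 0 s ω) k| * (1 + ‖D.X 0 s ω‖))| ∂P
        ≤ ENNReal.ofReal B := by
  obtain ⟨B, hB0, hB⟩ := exists_integral_sq_design_le hmodel hreg m
  obtain ⟨B', hB'0, hB'⟩ := exists_integral_sq_design_le hmodel hreg 0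
  -- From `u v ≤ u² + v²` and `(1 + ‖x‖)² ≤ 2 (1 + ‖x‖²)`, where `1 + ‖x‖²` is the sum of the
  -- squared design coordinates centred at `0`.
  refine ⟨B + 2 * ((Fintype.card (Unit ⊕ Fin p) : ℝ) * B'), by positivity, fun k s hs => ?_⟩
  have i1 := (memLp_design hmodel hs m k).integrable_sq
  have i2 : ∀ l, Integrable (fun ω => design 0 (D.X 0 s ω) l ^ 2) P := fun l =>
    (memLp_design hmodel hs 0 l).integrable_sq
  have i3 : Integrable (fun ω => 2 * ∑ l, design 0 (D.X 0 s ω) l ^ 2) P :=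
    (integrable_finsetSum _ fun l _ => i2 l).const_mul 2
  have i4 : Integrable (fun ω => design m (D.X 0 s ω) k ^ 2
    + 2 * ∑ l, design 0 (D.X 0 s ω) l ^ 2) P := i1.add i3
  have hpt : ∀ ω, |(|design m (D.X 0 s ω) k| * (1 + ‖D.X 0 s ω‖))|
      ≤ design m (D.X 0 s ω) k ^ 2 + 2 * ∑ l, design 0 (D.X 0 s ω) l ^ 2 := fun ω => by
    rw [← one_add_norm_sq_eq_sum_design, abs_of_nonneg (by positivity),
      ← sq_abs (design m (D.X 0 s ω) k)]
    nlinarith [sq_nonneg (|design m (D.X 0 s ω) k| - (1 + ‖D.X 0 s ω‖)),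
      sq_nonneg (1 - ‖D.X 0 s ω‖), sq_nonneg (|design m (D.X 0 s ω) k|)]
  refine (lintegral_mono fun ω => ENNReal.ofReal_le_ofReal (hpt ω)).trans ?_
  rw [← ofReal_integral_eq_lintegral_ofReal i4 (ae_of_all _ fun ω => by positivity)]
  refine ENNReal.ofReal_le_ofReal ?_
  rw [integral_add i1 i3, integral_const_mul, integral_finsetSum _ fun l _ => i2 l]
  refine add_le_add (hB k s hs) (mul_le_mul_of_nonneg_left ?_ zero_le_two)
  refine (Finset.sum_le_sum fun l _ => hB' l s hs).trans (le_of_eq ?_)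
  rw [Finset.sum_const, Finset.card_univ, nsmul_eq_mul]

end Study

lemma measurable_apply {p : ℕ} (l : Fin p) : Measurable fun x : Vec p => x l :=
  (EuclideanSpace.proj l : Vec p →L[ℝ] ℝ).continuous.measurable

lemma measurable_design {p : ℕ} (m : Vec p) (k : Unit ⊕ Fin p) :
    Measurable fun x : Vec p => design m x k := by
  rcases k with _ | l
  · exact measurable_const
  · exact (measurable_apply l).sub_const _

/-! ### Score and drift, and their moments. -/

namespace Study

variable {Ω : Type*} {p q : ℕ} {D : Study Ω p q}

/-- The residual as a function of the covariates and the response. -/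
def residFn (β₀ : ℝ → Vec p) (α : ℝ → ℝ) (s : ℝ) (z : Vec p × ℝ) : ℝ :=
  z.2 - inner ℝ z.1 ((Set.Icc (0 : ℝ) 1).indicator β₀ s) - (Set.Icc (0 : ℝ) 1).indicator α s

/-- The centered covariates in the direction `d`, times the residual. -/
def scoreFn (β₀ : ℝ → Vec p) (α : ℝ → ℝ) (μ : ℝ → Vec p) (d : Fin p → ℝ) (s : ℝ)
    (z : Vec p × ℝ) : ℝ :=
  (∑ l, d l * (z.1 l - (Set.Icc (0 : ℝ) 1).indicator μ s l)) * residFn β₀ α s z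

/-- The change of the mean in the direction `d`, times the residual. -/
def driftFn (β₀ : ℝ → Vec p) (α : ℝ → ℝ) (μ : ℝ → Vec p) (d : Fin p → ℝ) (t s : ℝ)
    (z : Vec p × ℝ) : ℝ :=
  (∑ l, d l * ((Set.Icc (0 : ℝ) 1).indicator μ s l - μ t l)) * residFn β₀ α s z

/-- The design is centred at the mean at the fixed time `t`, whereas the limiting covariance
involves centring at the observation time `s`. The drift accounts for the difference. -/
lemma sum_design_mul_residFn (β₀ : ℝ → Vec p) (α : ℝ → ℝ) (μ : ℝ → Vec p) (d : Fin p → ℝ)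
    (t s : ℝ) (z : Vec p × ℝ) :
    ∑ l, d l * (design (μ t) z.1 (Sum.inr l) * residFn β₀ α s z)
      = scoreFn β₀ α μ d s z + driftFn β₀ α μ d t s z := by
  rw [scoreFn, driftFn, ← add_mul, ← Finset.sum_add_distrib, Finset.sum_mul]
  refine Finset.sum_congr rfl fun l _ => ?_
  simp only [design, Sum.elim_inr]
  ring

/-- The coefficient functions are regular on `[0, 1]` only; their cut-off makes the residual
measurable on the whole line and changes nothing at the observation times. -/
lemma measurable_residFn {β₀ : ℝ → Vec p} {α : ℝ → ℝ} (hβ : ContinuousOn β₀ (Set.Icc 0 1))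
    (hα : ContinuousOn α (Set.Icc 0 1)) : Measurable (Function.uncurry (residFn β₀ α)) := by
  have h1 := measurable_indicator_of_continuousOn hβ measurableSet_Icc
  have h2 := measurable_indicator_of_continuousOn hα measurableSet_Icc
  have h3 : Measurable fun z : ℝ × Vec p × ℝ =>
      inner ℝ z.2.1 ((Set.Icc (0 : ℝ) 1).indicator β₀ z.1) :=
    Measurable.inner (by fun_prop) (h1.comp measurable_fst)
  exact (measurable_snd.snd.sub h3).sub (h2.comp measurable_fst)

lemma measurable_scoreFn {β₀ : ℝ → Vec p} {α : ℝ → ℝ} {μ : ℝ → Vec p}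
    (hβ : ContinuousOn β₀ (Set.Icc 0 1)) (hα : ContinuousOn α (Set.Icc 0 1))
    (hμ : ContinuousOn μ (Set.Icc 0 1)) (d : Fin p → ℝ) :
    Measurable (Function.uncurry (scoreFn β₀ α μ d)) := by
  have h1 := measurable_indicator_of_continuousOn hμ measurableSet_Icc
  refine Measurable.mul ?_ (measurable_residFn hβ hα)
  refine Finset.measurable_sum _ fun l _ => Measurable.const_mul ?_ _
  exact ((measurable_apply l).comp measurable_snd.fst).sub
    ((measurable_apply l).comp (h1.comp measurable_fst))

lemma measurable_driftFn {β₀ : ℝ → Vec p} {α : ℝ → ℝ} {μ : ℝ → Vec p}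
    (hβ : ContinuousOn β₀ (Set.Icc 0 1)) (hα : ContinuousOn α (Set.Icc 0 1))
    (hμ : ContinuousOn μ (Set.Icc 0 1)) (d : Fin p → ℝ) (t : ℝ) :
    Measurable (Function.uncurry (driftFn β₀ α μ d t)) := by
  have h1 := measurable_indicator_of_continuousOn hμ measurableSet_Icc
  refine Measurable.mul ?_ (measurable_residFn hβ hα)
  refine Finset.measurable_sum _ fun l _ => Measurable.const_mul ?_ _
  exact ((measurable_apply l).comp (h1.comp measurable_fst)).sub_const _

variable [MeasurableSpace Ω] {P : Measure Ω} [IsProbabilityMeasure P]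
  {β₀ : ℝ → Vec p} {γ₀ : ℝ → Vec q} {lam : ℝ → ℝ} {s t : ℝ}

lemma residFn_XY (hD : D.IsIIDSample P) (hmodel : D.Model P β₀ γ₀) (horth : D.Orthogonal P)
    (hs : s ∈ Set.Icc (0 : ℝ) 1) (ω : Ω) :
    residFn β₀ (D.intercept P γ₀) s (D.XY 0 s ω) = D.resid P β₀ s ω := by
  rw [resid_eq hD hmodel horth hs, residFn, Set.indicator_of_mem hs, Set.indicator_of_mem hs]
  rfl

lemma scoreFn_XY (hD : D.IsIIDSample P) (hmodel : D.Model P β₀ γ₀) (horth : D.Orthogonal P)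
    (hs : s ∈ Set.Icc (0 : ℝ) 1) (d : Fin p → ℝ) (ω : Ω) :
    scoreFn β₀ (D.intercept P γ₀) (D.meanX P) d s (D.XY 0 s ω)
      = (∑ l, d l * D.Xc P s ω l) * D.resid P β₀ s ω := by
  rw [scoreFn, residFn_XY hD hmodel horth hs, Set.indicator_of_mem hs]
  rfl

lemma driftFn_XY (hD : D.IsIIDSample P) (hmodel : D.Model P β₀ γ₀) (horth : D.Orthogonal P)
    (hs : s ∈ Set.Icc (0 : ℝ) 1) (d : Fin p → ℝ) (t : ℝ) (ω : Ω) :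
    driftFn β₀ (D.intercept P γ₀) (D.meanX P) d t s (D.XY 0 s ω)
      = (∑ l, d l * (D.meanX P s l - D.meanX P t l)) * D.resid P β₀ s ω := by
  rw [driftFn, residFn_XY hD hmodel horth hs, Set.indicator_of_mem hs]

lemma integral_designXc_mul_resid (hD : D.IsIIDSample P) (hmodel : D.Model P β₀ γ₀)
    (horth : D.Orthogonal P) (hs : s ∈ Set.Icc (0 : ℝ) 1) (k : Unit ⊕ Fin p) :
    ∫ ω, D.designXc P s ω k * D.resid P β₀ s ω ∂P = 0 := by
  rcases k with _ | l
  · simp [designXc]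
  · exact integral_Xc_mul_resid hD hmodel horth hs l

lemma integral_design_mul_resid (hD : D.IsIIDSample P) (hmodel : D.Model P β₀ γ₀)
    (horth : D.Orthogonal P) (hs : s ∈ Set.Icc (0 : ℝ) 1) (m : Vec p) (k : Unit ⊕ Fin p) :
    ∫ ω, design m (D.X 0 s ω) k * D.resid P β₀ s ω ∂P = 0 := by
  have hr := memLp_resid hmodel hs
  have i1 : Integrable (fun ω => design m (D.meanX P s) k * D.resid P β₀ s ω) P :=
    (hr.integrable one_le_two).const_mul _
  have i2 : Integrable (fun ω => D.designXc P s ω k * D.resid P β₀ s ω) P :=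
    (memLp_designXc hmodel hs k).integrable_mul hr
  simp only [design_X (P := P), add_mul]
  rw [integral_add i1 i2, integral_const_mul, integral_resid hD hmodel horth hs,
    integral_designXc_mul_resid hD hmodel horth hs]
  simp

lemma integral_scoreFn (hD : D.IsIIDSample P) (hmodel : D.Model P β₀ γ₀)
    (horth : D.Orthogonal P) (hs : s ∈ Set.Icc (0 : ℝ) 1) (d : Fin p → ℝ) :
    ∫ ω, scoreFn β₀ (D.intercept P γ₀) (D.meanX P) d s (D.XY 0 s ω) ∂P = 0 := by
  have hi : ∀ l, Integrable (fun ω => d l * (D.Xc P s ω l * D.resid P β₀ s ω)) P := fun l =>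
    ((memLp_Xc_apply hmodel hs l).integrable_mul (memLp_resid hmodel hs)).const_mul _
  simp only [scoreFn_XY hD hmodel horth hs, Finset.sum_mul, mul_assoc]
  rw [integral_finsetSum _ fun l _ => hi l]
  simp [integral_const_mul, integral_Xc_mul_resid hD hmodel horth hs]

lemma integral_driftFn (hD : D.IsIIDSample P) (hmodel : D.Model P β₀ γ₀)
    (horth : D.Orthogonal P) (hs : s ∈ Set.Icc (0 : ℝ) 1) (d : Fin p → ℝ) (t : ℝ) :
    ∫ ω, driftFn β₀ (D.intercept P γ₀) (D.meanX P) d t s (D.XY 0 s ω) ∂P = 0 := by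
  simp only [driftFn_XY hD hmodel horth hs]
  rw [integral_const_mul, integral_resid hD hmodel horth hs, mul_zero]

lemma integral_sq_scoreFn (hD : D.IsIIDSample P) (hmodel : D.Model P β₀ γ₀)
    (horth : D.Orthogonal P) (hreg : D.RegularityCond P lam β₀ γ₀) (hs : s ∈ Set.Icc (0 : ℝ) 1)
    (d : Fin p → ℝ) :
    ∫ ω, scoreFn β₀ (D.intercept P γ₀) (D.meanX P) d s (D.XY 0 s ω) ^ 2 ∂P
      = ∑ k, ∑ l, d k * d l * ∫ ω, D.Xc P s ω k * D.Xc P s ω l * D.condVariance P s ω ∂P := by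
  have hi : ∀ k l, Integrable (fun ω => d k * d l *
      (D.Xc P s ω k * D.Xc P s ω l * D.resid P β₀ s ω ^ 2)) P := fun k l =>
    (integrable_Xc_mul_Xc_mul_resid_sq hD hreg hs k l).const_mul _
  have e : ∀ ω, ((∑ l, d l * D.Xc P s ω l) * D.resid P β₀ s ω) ^ 2
      = ∑ k, ∑ l, d k * d l * (D.Xc P s ω k * D.Xc P s ω l * D.resid P β₀ s ω ^ 2) := fun ω => by
    rw [mul_pow, sq (∑ l, _), Finset.sum_mul_sum, Finset.sum_mul]
    refine Finset.sum_congr rfl fun k _ => ?_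
    rw [Finset.sum_mul]
    exact Finset.sum_congr rfl fun l _ => by ring
  simp only [scoreFn_XY hD hmodel horth hs, e]
  rw [integral_finsetSum _ fun k _ => integrable_finsetSum _ fun l _ => hi k l]
  refine Finset.sum_congr rfl fun k _ => ?_
  rw [integral_finsetSum _ fun l _ => hi k l]
  refine Finset.sum_congr rfl fun l _ => ?_
  rw [integral_const_mul, integral_Xc_mul_Xc_mul_resid_sq hD hmodel horth hreg hs]

lemma abs_sum_mul_apply_le (d : Fin p → ℝ) (x : Vec p) :
    |∑ l, d l * x l| ≤ (∑ l, |d l|) * ‖x‖ := by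
  rw [Finset.sum_mul]
  refine (Finset.abs_sum_le_sum_abs _ _).trans (Finset.sum_le_sum fun l _ => ?_)
  rw [abs_mul]
  exact mul_le_mul_of_nonneg_left (abs_apply_le_norm x l) (abs_nonneg _)

lemma abs_scoreFn_XY_le (hD : D.IsIIDSample P) (hmodel : D.Model P β₀ γ₀)
    (horth : D.Orthogonal P) (hs : s ∈ Set.Icc (0 : ℝ) 1) (d : Fin p → ℝ) (ω : Ω) :
    |scoreFn β₀ (D.intercept P γ₀) (D.meanX P) d s (D.XY 0 s ω)|
      ≤ (∑ l, |d l|) * (‖D.Xc P s ω‖ * |D.resid P β₀ s ω|) := by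
  rw [scoreFn_XY hD hmodel horth hs, abs_mul, ← mul_assoc]
  exact mul_le_mul_of_nonneg_right (abs_sum_mul_apply_le d _) (abs_nonneg _)

lemma exists_lintegral_sq_scoreFn_le (hD : D.IsIIDSample P) (hmodel : D.Model P β₀ γ₀)
    (horth : D.Orthogonal P) (hreg : D.RegularityCond P lam β₀ γ₀) (d : Fin p → ℝ) :
    ∃ b : ℝ, 0 ≤ b ∧ ∀ s ∈ Set.Icc (0 : ℝ) 1, ∫⁻ ω, ENNReal.ofReal
      (scoreFn β₀ (D.intercept P γ₀) (D.meanX P) d s (D.XY 0 s ω) ^ 2) ∂P ≤ ENNReal.ofReal b := by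
  obtain ⟨C, hC0, hC⟩ := exists_lintegral_sq_le hreg
  refine ⟨(∑ l, |d l|) ^ 2 * C, by positivity, fun s hs => ?_⟩
  rw [ENNReal.ofReal_mul (by positivity)]
  refine le_trans ?_ (mul_le_mul_right (hC s hs) _)
  rw [← lintegral_const_mul' _ _ ENNReal.ofReal_ne_top]
  refine lintegral_mono fun ω => ?_
  rw [← ENNReal.ofReal_mul (by positivity), ← mul_pow, ← sq_abs]
  exact ENNReal.ofReal_le_ofReal
    (pow_le_pow_left₀ (abs_nonneg _) (abs_scoreFn_XY_le hD hmodel horth hs d ω) 2)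

lemma exists_lintegral_rpow_scoreFn_le (hD : D.IsIIDSample P) (hmodel : D.Model P β₀ γ₀)
    (horth : D.Orthogonal P) (hreg : D.RegularityCond P lam β₀ γ₀) (d : Fin p → ℝ) :
    ∃ r b : ℝ, 2 < r ∧ 0 ≤ b ∧ ∀ s ∈ Set.Icc (0 : ℝ) 1, ∫⁻ ω, ENNReal.ofReal
      (|scoreFn β₀ (D.intercept P γ₀) (D.meanX P) d s (D.XY 0 s ω)| ^ r) ∂P
        ≤ ENNReal.ofReal b := by
  obtain ⟨r, C, hr, hC⟩ := hreg.lyapunov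
  have hd : 0 ≤ ∑ l, |d l| := Finset.sum_nonneg fun _ _ => abs_nonneg _
  refine ⟨r, (∑ l, |d l|) ^ r * max C 0, hr, by positivity, fun s hs => ?_⟩
  rw [ENNReal.ofReal_mul (by positivity)]
  refine le_trans ?_ (mul_le_mul_right ((hC s hs).trans
    (ENNReal.ofReal_le_ofReal (le_max_left C 0))) _)
  rw [← lintegral_const_mul' _ _ ENNReal.ofReal_ne_top]
  refine lintegral_mono fun ω => ?_
  rw [← ENNReal.ofReal_mul (by positivity), ← Real.mul_rpow hd (by positivity)]
  exact ENNReal.ofReal_le_ofReal (Real.rpow_le_rpow (abs_nonneg _)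
    (abs_scoreFn_XY_le hD hmodel horth hs d ω) (by linarith))

lemma exists_lintegral_sq_resid_le (hmodel : D.Model P β₀ γ₀)
    (hreg : D.RegularityCond P lam β₀ γ₀) : ∃ b : ℝ, 0 ≤ b ∧ ∀ s ∈ Set.Icc (0 : ℝ) 1,
      ∫⁻ ω, ENNReal.ofReal (D.resid P β₀ s ω ^ 2) ∂P ≤ ENNReal.ofReal b := by
  obtain ⟨C, hC⟩ := hreg.bounded_resid
  refine ⟨max C 0, le_max_right _ _, fun s hs => ?_⟩
  rw [lintegral_ofReal_sq (memLp_resid hmodel hs).integrable_sq]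
  exact ENNReal.ofReal_le_ofReal ((hC s hs).trans (le_max_left _ _))

/-- The design splits into its mean, bounded over time, and its random part, and `(u + v)² ≤ 2 u² +
2 v²`. The first part calls for a bound of `E ε²`, the second for one of `E ‖X̃‖² ε²`. -/
lemma exists_lintegral_sq_design_mul_resid_le (hmodel : D.Model P β₀ γ₀)
    (hreg : D.RegularityCond P lam β₀ γ₀) (m : Vec p) (k : Unit ⊕ Fin p) :
    ∃ b : ℝ, 0 ≤ b ∧ ∀ s ∈ Set.Icc (0 : ℝ) 1,
      ∫⁻ ω, ENNReal.ofReal ((design m (D.X 0 s ω) k * D.resid P β₀ s ω) ^ 2) ∂P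
        ≤ ENNReal.ofReal b := by
  obtain ⟨C, hC0, hC⟩ := exists_lintegral_sq_le hreg
  obtain ⟨C', hC'0, hC'⟩ := exists_lintegral_sq_resid_le hmodel hreg
  obtain ⟨A, hA⟩ := isCompact_Icc.exists_bound_of_continuousOn (continuousOn_design_meanX hreg m k)
  refine ⟨2 * A ^ 2 * C' + 2 * C, by positivity, fun s hs => ?_⟩
  have hc : ∀ ω, |D.designXc P s ω k| ≤ ‖D.Xc P s ω‖ := fun ω => by
    rcases k with _ | l
    · simp [designXc]
    · exact abs_apply_le_norm _ _
  have hpt : ∀ ω, (design m (D.X 0 s ω) k * D.resid P β₀ s ω) ^ 2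
      ≤ 2 * A ^ 2 * D.resid P β₀ s ω ^ 2 + 2 * (‖D.Xc P s ω‖ * |D.resid P β₀ s ω|) ^ 2 :=
    fun ω => by
    have h1 : design m (D.meanX P s) k ^ 2 ≤ A ^ 2 := sq_le_sq.2 ((hA s hs).trans (le_abs_self A))
    have h2 : D.designXc P s ω k ^ 2 ≤ ‖D.Xc P s ω‖ ^ 2 :=
      sq_le_sq.2 ((hc ω).trans (le_abs_self _))
    rw [mul_pow, mul_pow, sq_abs, design_X (P := P), ← mul_assoc 2, ← add_mul]
    refine mul_le_mul_of_nonneg_right ?_ (sq_nonneg _)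
    nlinarith [sq_nonneg (design m (D.meanX P s) k - D.designXc P s ω k)]
  have hmeas : AEMeasurable (fun ω => ENNReal.ofReal (D.resid P β₀ s ω ^ 2)) P :=
    ((memLp_resid hmodel hs).aemeasurable.pow_const 2).ennreal_ofReal
  refine (lintegral_mono (g := fun ω => ENNReal.ofReal (2 * A ^ 2) *
    ENNReal.ofReal (D.resid P β₀ s ω ^ 2) + ENNReal.ofReal 2 *
    ENNReal.ofReal ((‖D.Xc P s ω‖ * |D.resid P β₀ s ω|) ^ 2)) fun ω => ?_).trans ?_
  · beta_reduce
    rw [← ENNReal.ofReal_mul (by positivity), ← ENNReal.ofReal_mul (by positivity),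
      ← ENNReal.ofReal_add (by positivity) (by positivity)]
    exact ENNReal.ofReal_le_ofReal (hpt ω)
  · rw [lintegral_add_left' (hmeas.const_mul _),
      lintegral_const_mul' _ _ ENNReal.ofReal_ne_top,
      lintegral_const_mul' _ _ ENNReal.ofReal_ne_top,
      ENNReal.ofReal_add (by positivity) (by positivity),
      ENNReal.ofReal_mul (by positivity : 0 ≤ 2 * A ^ 2),
      (ENNReal.ofReal_mul zero_le_two : ENNReal.ofReal (2 * C) = _)]
    exact add_le_add (mul_le_mul_right (hC' s hs) _) (mul_le_mul_right (hC s hs) _)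

/-- The second moment of the drift vanishes at `t`. -/
lemma exists_lintegral_sq_driftFn_le (hD : D.IsIIDSample P) (hmodel : D.Model P β₀ γ₀)
    (horth : D.Orthogonal P) (hreg : D.RegularityCond P lam β₀ γ₀) (ht : t ∈ Set.Ioo (0 : ℝ) 1)
    (d : Fin p → ℝ) :
    (∃ b : ℝ, 0 ≤ b ∧ ∀ s ∈ Set.Icc (0 : ℝ) 1, ∫⁻ ω, ENNReal.ofReal
      (driftFn β₀ (D.intercept P γ₀) (D.meanX P) d t s (D.XY 0 s ω) ^ 2) ∂P ≤ ENNReal.ofReal b) ∧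
    Tendsto (fun s => ∫⁻ ω, ENNReal.ofReal
      (driftFn β₀ (D.intercept P γ₀) (D.meanX P) d t s (D.XY 0 s ω) ^ 2) ∂P) (𝓝 t) (𝓝 0) := by
  obtain ⟨C, hC0, hC⟩ := exists_lintegral_sq_resid_le hmodel hreg
  have hc : ContinuousOn (fun s => ∑ l, d l * (D.meanX P s l - D.meanX P t l)) (Set.Icc 0 1) :=
    continuousOn_finsetSum _ fun l _ => continuousOn_const.mul
      (((EuclideanSpace.proj l : Vec p →L[ℝ] ℝ).continuous.comp_continuousOn
        hreg.continuous_mean).sub continuousOn_const)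
  obtain ⟨A, hA⟩ := isCompact_Icc.exists_bound_of_continuousOn hc
  have hle : ∀ s ∈ Set.Icc (0 : ℝ) 1, ∫⁻ ω, ENNReal.ofReal
      (driftFn β₀ (D.intercept P γ₀) (D.meanX P) d t s (D.XY 0 s ω) ^ 2) ∂P
      ≤ ENNReal.ofReal ((∑ l, d l * (D.meanX P s l - D.meanX P t l)) ^ 2 * C) := fun s hs => by
    simp only [driftFn_XY hD hmodel horth hs, mul_pow]
    rw [ENNReal.ofReal_mul (sq_nonneg _)]
    refine le_trans ?_ (mul_le_mul_right (hC s hs) _)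
    rw [← lintegral_const_mul' _ _ ENNReal.ofReal_ne_top]
    refine lintegral_mono fun ω => ?_
    rw [← ENNReal.ofReal_mul (sq_nonneg _)]
  refine ⟨⟨A ^ 2 * C, by positivity, fun s hs => (hle s hs).trans
    (ENNReal.ofReal_le_ofReal (mul_le_mul_of_nonneg_right
      (sq_le_sq.2 ((hA s hs).trans (le_abs_self A))) hC0))⟩, ?_⟩
  have hnhds : Set.Icc (0 : ℝ) 1 ∈ 𝓝 t := Icc_mem_nhds ht.1 ht.2
  have hlim := ENNReal.tendsto_ofReal (((hc.continuousAt hnhds).tendsto.pow 2).mul_const C)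
  have e : (∑ l, d l * (D.meanX P t l - D.meanX P t l)) ^ 2 * C = 0 := by simp
  rw [e, ENNReal.ofReal_zero] at hlim
  refine tendsto_of_tendsto_of_tendsto_of_le_of_le' tendsto_const_nhds hlim
    (Eventually.of_forall fun _ => zero_le) ?_
  filter_upwards [hnhds] with s hs using hle s hs

end Study

/-! ### Kernel moments, bandwidths and the limit of the Gram matrix. -/

namespace KernelCond

variable {K : ℝ → ℝ}

lemma integrable_mul_pow (hK : KernelCond K) {j : ℕ} (hj : j ≤ 2) :
    Integrable fun z => K z * z ^ j := by
  have h2 : Integrable fun z => K z + z ^ 2 * K z := hK.integrable.add hK.second_moment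
  refine h2.mono (hK.measurable.mul (measurable_id.pow_const j)).aestronglyMeasurable
    (ae_of_all _ fun z => ?_)
  have h0 := hK.nonneg z
  have h1 : 0 ≤ K z + z ^ 2 * K z := by positivity
  rw [norm_mul, Real.norm_of_nonneg h0, Real.norm_of_nonneg h1, norm_pow, Real.norm_eq_abs,
    ← sq_abs z]
  have : |z| ^ j ≤ 1 + |z| ^ 2 := by
    interval_cases j
    · nlinarith [abs_nonneg z]
    · nlinarith [sq_nonneg (|z| - 1), abs_nonneg z]
    · linarith
  calc K z * |z| ^ j ≤ K z * (1 + |z| ^ 2) := mul_le_mul_of_nonneg_left this h0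
    _ = _ := by ring

lemma integrable_sq_mul_pow (hK : KernelCond K) (a : Fin 2) :
    Integrable fun z => (K z * z ^ (a : ℕ)) ^ 2 := by
  fin_cases a
  · simpa using hK.sq_integrable
  · refine hK.sq_second_moment.congr (ae_of_all _ fun z => ?_)
    simp; ring

lemma integrable_mul_abs_pow (hK : KernelCond K) (a : Fin 2) :
    Integrable fun z => K z * |z| ^ ((a : ℕ) + 2) := by
  fin_cases a
  · refine hK.second_moment.congr (ae_of_all _ fun z => ?_)
    simp; ring
  · refine hK.third_moment.congr (ae_of_all _ fun z => ?_)
    simp; ring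

/-- If this moment vanished, `K` would be zero almost everywhere, against `∫ K = 1`. -/
lemma integral_mul_sq_pos (hK : KernelCond K) : 0 < ∫ z, K z * z ^ 2 := by
  have hnn : ∀ z, 0 ≤ K z * z ^ 2 := fun z => mul_nonneg (hK.nonneg z) (sq_nonneg z)
  refine lt_of_le_of_ne (integral_nonneg hnn) fun h => ?_
  have h0 := (integral_eq_zero_iff_of_nonneg hnn (hK.integrable_mul_pow le_rfl)).1 h.symm
  have h1 : ∫ z, K z = 0 := by
    refine integral_eq_zero_of_ae ?_
    have hne : ∀ᵐ z : ℝ, z ≠ 0 := by simp [ae_iff]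
    filter_upwards [h0, hne] with z hz hz0
    simpa [hz0] using hz
  rw [hK.integral_eq_one] at h1
  exact one_ne_zero h1

end KernelCond

/-- Divide: `h⁴ = (n h⁵) / (n h)`. -/
lemma BandwidthCond.tendsto_zero_self {h : ℕ → ℝ} (hh : BandwidthCond h) :
    Tendsto h atTop (𝓝 0) := by
  have h4 : Tendsto (fun n => h n ^ 4) atTop (𝓝 0) := by
    have := hh.tendsto_zero.mul hh.tendsto_atTop.inv_tendsto_atTop
    rw [zero_mul] at this
    refine this.congr' ?_
    filter_upwards [eventually_gt_atTop 0] with n hn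
    have hn' : (n : ℝ) ≠ 0 := by positivity
    have hp := (hh.pos n).ne'
    simp only [Pi.inv_apply]
    field_simp
  have h1 := (h4.sqrt).sqrt
  simp only [Real.sqrt_zero] at h1
  refine h1.congr fun n => ?_
  rw [show h n ^ 4 = (h n ^ 2) ^ 2 by ring, Real.sqrt_sq (sq_nonneg _), Real.sqrt_sq (hh.pos n).le]

/-- The limit of the Gram matrix of the local linear design. -/
def limitMatrix {p : ℕ} (A : Matrix (Fin p) (Fin p) ℝ) (l : ℝ) (K : ℝ → ℝ) :
    Matrix ((Unit ⊕ Fin p) × Fin 2) ((Unit ⊕ Fin p) × Fin 2) ℝ :=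
  Matrix.kroneckerMap (· * ·) (Matrix.fromBlocks (Matrix.of fun _ _ => l) 0 0 A)
    (Matrix.of fun a b : Fin 2 => ∫ z, K z * z ^ ((a : ℕ) + (b : ℕ)))

/-- The determinant of a Kronecker product is a product of powers of the two determinants, here `λ
det A` and, as the first moment of `K` is zero, `∫ z² K`. -/
lemma isUnit_det_limitMatrix {p : ℕ} {A : Matrix (Fin p) (Fin p) ℝ} {l : ℝ} {K : ℝ → ℝ}
    (hK : KernelCond K) (hA : A.det ≠ 0) (hl : l ≠ 0) : IsUnit (limitMatrix A l K).det := by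
  have hB : (Matrix.of fun a b : Fin 2 => ∫ z, K z * z ^ ((a : ℕ) + (b : ℕ))).det ≠ 0 := by
    have h1 : ∫ z, K z * z = 0 := by
      rw [← hK.first_moment]
      exact integral_congr_ae (ae_of_all _ fun z => mul_comm _ _)
    rw [Matrix.det_fin_two]
    simpa [h1, hK.integral_eq_one] using hK.integral_mul_sq_pos.ne'
  rw [isUnit_iff_ne_zero, limitMatrix, Matrix.det_kronecker, Matrix.det_fromBlocks_zero₂₁]
  refine mul_ne_zero (pow_ne_zero _ (mul_ne_zero ?_ hA)) (pow_ne_zero _ hB)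
  simpa using hl

/-- Centring of the covariates separates slopes from intercepts, and the vanishing first moment of
`K` separates values from derivatives; only `A` remains in these rows. -/
lemma limitMatrix_mulVec {p : ℕ} {A : Matrix (Fin p) (Fin p) ℝ} {l : ℝ} {K : ℝ → ℝ}
    (hK : KernelCond K) (x : (Unit ⊕ Fin p) × Fin 2 → ℝ) (k : Fin p) :
    (limitMatrix A l K).mulVec x (Sum.inr k, 0) = A.mulVec (fun j => x (Sum.inr j, 0)) k := by
  have h1 : ∫ z, K z * z = 0 := by
    rw [← hK.first_moment]
    exact integral_congr_ae (ae_of_all _ fun z => mul_comm _ _)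
  simp [limitMatrix, Matrix.mulVec, dotProduct, Fintype.sum_prod_type, Fintype.sum_sum_type, h1,
    hK.integral_eq_one]

/-! ### The linear system solved by the estimator. -/

namespace Study

variable {Ω : Type*} {p q : ℕ}

/-- The Gram matrix of the local linear design. -/
def gram (D : Study Ω p q) (K : ℝ → ℝ) (h t : ℝ) (m : Vec p) (n : ℕ) (ω : Ω) :
    Matrix ((Unit ⊕ Fin p) × Fin 2) ((Unit ⊕ Fin p) × Fin 2) ℝ :=
  Matrix.of fun k l => (n : ℝ)⁻¹ * ∑ i ∈ Finset.range n,
    h⁻¹ * D.localSum h t (fun z => K z * z ^ ((k.2 : ℕ) + (l.2 : ℕ)))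
      (fun _ x => design m x.1 k.1 * design m x.1 l.1) i ω

/-- The normalized score vector. -/
def score (D : Study Ω p q) (β₀ : ℝ → Vec p) (α : ℝ → ℝ) (K : ℝ → ℝ) (h t : ℝ) (m : Vec p)
    (n : ℕ) (ω : Ω) (k : (Unit ⊕ Fin p) × Fin 2) : ℝ :=
  (√(n : ℝ))⁻¹ * ∑ i ∈ Finset.range n, (√h)⁻¹ * D.localSum h t (fun z => K z * z ^ (k.2 : ℕ))
    (fun s x => design m x.1 k.1 * residFn β₀ α s x) i ω

/-- Up to a constant, a bound for the normalized bias. -/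
def biasBound (D : Study Ω p q) (K : ℝ → ℝ) (h t : ℝ) (m : Vec p) (n : ℕ) (ω : Ω)
    (k : (Unit ⊕ Fin p) × Fin 2) : ℝ :=
  (√(n : ℝ))⁻¹ * ∑ i ∈ Finset.range n, (√h)⁻¹ * (h ^ 2 *
    D.localSum h t (fun z => K z * |z| ^ ((k.2 : ℕ) + 2))
      (fun _ x => |design m x.1 k.1| * (1 + ‖x.1‖)) i ω)

/-- The local linear estimator solves a linear system whose right-hand side is the score, up to
a bias of second order. -/
theorem exists_gram_mulVec_sub_score_le (D : Study Ω p q) {K : ℝ → ℝ} (hK0 : ∀ z, 0 ≤ K z)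
    {h t : ℝ} (hh : 0 < h) (m : Vec p) {n : ℕ} (hn : 0 < n) (ω : Ω)
    (hT : ∀ i < n, ∀ j < D.L i ω, D.T i j ω ∈ Set.Icc (0 : ℝ) 1)
    {β₀ : ℝ → Vec p} {α : ℝ → ℝ} {β' : Vec p} {α' C₀ : ℝ}
    (hrem : ∀ s ∈ Set.Icc (0 : ℝ) 1, ∀ x : Vec p,
      |α s + inner ℝ x (β₀ s) - fit ((α t, β₀ t), (α', β')) x (s - t)|
        ≤ C₀ * (s - t) ^ 2 * (1 + ‖x‖))
    {θ : (ℝ × Vec p) × (ℝ × Vec p)} (hmin : IsMinOn (D.criterion K h t n ω) Set.univ θ) :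
    ∃ x : (Unit ⊕ Fin p) × Fin 2 → ℝ,
      (∀ l, x (Sum.inr l, 0) = √(n * h) * (θ.1.2 - β₀ t) l) ∧
      ∀ k, |(D.gram K h t m n ω).mulVec x k - D.score β₀ α K h t m n ω k|
        ≤ C₀ * D.biasBound K h t m n ω k := by
  set S : Finset (Σ _ : ℕ, ℕ) := (Finset.range n).sigma fun i => Finset.range (D.L i ω) with hS
  set T : (Σ _ : ℕ, ℕ) → ℝ := fun j => D.T j.1 j.2 ω with hTdef
  set X : (Σ _ : ℕ, ℕ) → Vec p := fun j => D.X j.1 (T j) ω with hX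
  set Y : (Σ _ : ℕ, ℕ) → ℝ := fun j => D.Y j.1 (T j) ω with hY
  set u : (Σ _ : ℕ, ℕ) → ℝ := fun j => (T j - t) / h with hu
  have hhu : ∀ j, h * u j = T j - t := fun j => by rw [hu]; field_simp
  have hsum : ∀ (f : ℝ → ℝ) (F : ℝ → Vec p × ℝ → ℝ),
      ∑ i ∈ Finset.range n, D.localSum h t f F i ω
        = ∑ j ∈ S, f (u j) * F (T j) (X j, Y j) := fun f F => by
    rw [hS, Finset.sum_sigma]
    rfl
  have hTS : ∀ j ∈ S, T j ∈ Set.Icc (0 : ℝ) 1 := fun j hj => by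
    rw [hS, Finset.mem_sigma, Finset.mem_range, Finset.mem_range] at hj
    exact hT j.1 hj.1 j.2 hj.2
  have hcrit : D.criterion K h t n ω
      = fun θ => ∑ j ∈ S, K (u j) / h * (Y j - fit θ (X j) (h * u j)) ^ 2 := by
    ext θ
    rw [hS, Finset.sum_sigma]
    simp only [criterion, integralN, hhu, fit]
    refine Finset.sum_congr rfl fun i _ => Finset.sum_congr rfl fun j _ => ?_
    simp only [hu, hX, hY, hTdef]
    ring
  rw [hcrit] at hmin
  obtain ⟨δ, hδ, hne⟩ := exists_normal_equations S (fun j => K (u j) / h) Y u X hh.ne' m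
    ((α t, β₀ t), (α', β')) θ hmin
  have hnR : (0 : ℝ) < n := by exact_mod_cast hn
  have hsn : 0 < √(n : ℝ) := Real.sqrt_pos.2 hnR
  have hsh : 0 < √h := Real.sqrt_pos.2 hh
  have hnn : √(n : ℝ) * √(n : ℝ) = n := Real.mul_self_sqrt hnR.le
  have hhh : √h * √h = h := Real.mul_self_sqrt hh.le
  -- The unknowns are scaled by `√(nh)`. As the Gram matrix carries `1/(nh)`, the right-hand side is
  -- left with `1/√(nh)`, the normalization of the central limit theorem.
  refine ⟨fun k => √(n * h) * δ k, fun l => by beta_reduce; rw [hδ], fun k => ?_⟩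
  have hgram : (D.gram K h t m n ω).mulVec (fun k => √(n * h) * δ k) k
      = (√(n : ℝ))⁻¹ * (√h)⁻¹ * ∑ j ∈ S, K (u j) * u j ^ (k.2 : ℕ) * (design m (X j) k.1
          * (Y j - fit ((α t, β₀ t), (α', β')) (X j) (h * u j))) := by
    have h1 : ∀ l, D.gram K h t m n ω k l = (n : ℝ)⁻¹ * ∑ j ∈ S, K (u j) / h
        * u j ^ ((k.2 : ℕ) + (l.2 : ℕ)) * (design m (X j) k.1 * design m (X j) l.1) := fun l => by
      rw [gram, Matrix.of_apply, ← Finset.mul_sum, hsum, Finset.mul_sum]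
      congr 1
      refine Finset.sum_congr rfl fun j _ => ?_
      rw [div_eq_mul_inv]
      ring
    have h2 : (D.gram K h t m n ω).mulVec (fun k => √(n * h) * δ k) k
        = (n : ℝ)⁻¹ * √(n * h) * ∑ l, (∑ j ∈ S, K (u j) / h
        * u j ^ ((k.2 : ℕ) + (l.2 : ℕ)) * (design m (X j) k.1 * design m (X j) l.1)) * δ l := by
      rw [Matrix.mulVec, dotProduct, Finset.mul_sum]
      refine Finset.sum_congr rfl fun l _ => ?_
      rw [h1]
      ring
    rw [h2, hne k, Finset.mul_sum, Finset.mul_sum]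
    refine Finset.sum_congr rfl fun j _ => ?_
    have e : (n : ℝ)⁻¹ * √(n * h) * h⁻¹ = (√(n : ℝ))⁻¹ * (√h)⁻¹ := by
      rw [Real.sqrt_mul hnR.le]
      nth_rewrite 1 [← hnn]
      nth_rewrite 2 [← hhh]
      field_simp
    rw [← e, div_eq_mul_inv]
    ring
  have hscore : D.score β₀ α K h t m n ω k
      = (√(n : ℝ))⁻¹ * (√h)⁻¹ * ∑ j ∈ S, K (u j) * u j ^ (k.2 : ℕ) * (design m (X j) k.1
          * residFn β₀ α (T j) (X j, Y j)) := by
    rw [score, ← Finset.mul_sum, hsum, mul_assoc]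
  have hbias : D.biasBound K h t m n ω k = (√(n : ℝ))⁻¹ * (√h)⁻¹ * (h ^ 2 * ∑ j ∈ S,
      K (u j) * |u j| ^ ((k.2 : ℕ) + 2) * (|design m (X j) k.1| * (1 + ‖X j‖))) := by
    rw [biasBound, ← Finset.mul_sum, ← Finset.mul_sum, hsum, mul_assoc]
  rw [hgram, hscore, hbias, ← mul_sub, ← Finset.sum_sub_distrib, abs_mul,
    abs_of_pos (by positivity : 0 < (√(n : ℝ))⁻¹ * (√h)⁻¹), mul_left_comm]
  refine mul_le_mul_of_nonneg_left ?_ (by positivity)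
  rw [Finset.mul_sum, Finset.mul_sum]
  refine (Finset.abs_sum_le_sum_abs _ _).trans (Finset.sum_le_sum fun j hj => ?_)
  have hTj := hTS j hj
  -- At an observation time the response is the residual plus the regression function, and the
  -- latter differs from its linear expansion by the Taylor remainder.
  have e : Y j - fit ((α t, β₀ t), (α', β')) (X j) (h * u j)
      = residFn β₀ α (T j) (X j, Y j)
        + (α (T j) + inner ℝ (X j) (β₀ (T j)) - fit ((α t, β₀ t), (α', β')) (X j) (T j - t)) := by
    rw [residFn, Set.indicator_of_mem hTj, Set.indicator_of_mem hTj, hhu]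
    ring
  have e2 : K (u j) * u j ^ (k.2 : ℕ) * (design m (X j) k.1
        * (Y j - fit ((α t, β₀ t), (α', β')) (X j) (h * u j)))
      - K (u j) * u j ^ (k.2 : ℕ) * (design m (X j) k.1 * residFn β₀ α (T j) (X j, Y j))
      = K (u j) * u j ^ (k.2 : ℕ) * design m (X j) k.1
        * (α (T j) + inner ℝ (X j) (β₀ (T j)) - fit ((α t, β₀ t), (α', β')) (X j) (T j - t)) := by
    rw [e]; ring
  rw [e2, abs_mul, abs_mul, abs_mul, abs_of_nonneg (hK0 _), abs_pow]
  calc K (u j) * |u j| ^ (k.2 : ℕ) * |design m (X j) k.1| * _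
      ≤ K (u j) * |u j| ^ (k.2 : ℕ) * |design m (X j) k.1|
        * (C₀ * (T j - t) ^ 2 * (1 + ‖X j‖)) :=
        mul_le_mul_of_nonneg_left (hrem _ hTj _) (by have := hK0 (u j); positivity)
    _ = _ := by
        rw [← hhu, pow_add, sq_abs]
        ring

end Study

/-- Taylor expansion of the regression function about an interior point. -/
lemma exists_fit_remainder_le {p : ℕ} {β₀ : ℝ → Vec p} {α : ℝ → ℝ}
    (hβ : ContDiffOn ℝ 2 β₀ (Set.Icc 0 1)) (hα : ContDiffOn ℝ 2 α (Set.Icc 0 1)) {t : ℝ}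
    (ht : t ∈ Set.Icc (0 : ℝ) 1) :
    ∃ (α' : ℝ) (β' : Vec p) (C₀ : ℝ), 0 ≤ C₀ ∧ ∀ s ∈ Set.Icc (0 : ℝ) 1, ∀ x : Vec p,
      |α s + inner ℝ x (β₀ s) - fit ((α t, β₀ t), (α', β')) x (s - t)|
        ≤ C₀ * (s - t) ^ 2 * (1 + ‖x‖) := by
  obtain ⟨α', C, hC0, hC⟩ := exists_taylor_two_bound hα ht
  obtain ⟨β', C', hC'0, hC'⟩ := exists_taylor_two_bound hβ ht
  refine ⟨α', β', C + C', by positivity, fun s hs x => ?_⟩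
  have e : α s + inner ℝ x (β₀ s) - fit ((α t, β₀ t), (α', β')) x (s - t)
      = (α s - α t - (s - t) • α') + inner ℝ x (β₀ s - β₀ t - (s - t) • β') := by
    simp only [fit, inner_sub_right, inner_smul_right, smul_eq_mul]
    ring
  rw [e]
  have h1 := hC s hs
  have h2 := (abs_real_inner_le_norm x _).trans
    (mul_le_mul_of_nonneg_left (hC' s hs) (norm_nonneg x))
  rw [Real.norm_eq_abs] at h1
  refine (abs_add_le _ _).trans ((add_le_add h1 h2).trans ?_)
  have := norm_nonneg x
  have h3 : 0 ≤ C' * (s - t) ^ 2 := by positivity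
  have h4 : 0 ≤ C * (s - t) ^ 2 * ‖x‖ := by positivity
  nlinarith

/-! ### Limits of the Gram matrix, the score, the drift and the bias. -/

namespace Study

variable {Ω : Type*} {p q : ℕ} {D : Study Ω p q} {K : ℝ → ℝ}

lemma biasBound_nonneg (hK : KernelCond K) {h : ℝ} (hh : 0 < h) (t : ℝ) (m : Vec p) (n : ℕ) (ω : Ω)
    (k : (Unit ⊕ Fin p) × Fin 2) : 0 ≤ D.biasBound K h t m n ω k := by
  refine mul_nonneg (by positivity) (Finset.sum_nonneg fun i _ => mul_nonneg (by positivity)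
    (mul_nonneg (by positivity) (Finset.sum_nonneg fun j _ => ?_)))
  have := hK.nonneg ((D.T i j ω - t) / h)
  positivity

lemma sum_score_eq (β₀ : ℝ → Vec p) (α : ℝ → ℝ) (μ : ℝ → Vec p) (d : Fin p → ℝ) (h t : ℝ) (n : ℕ)
    (ω : Ω) :
    ∑ l, d l * D.score β₀ α K h t (μ t) n ω (Sum.inr l, 0)
      = (√(n : ℝ))⁻¹ * ∑ i ∈ Finset.range n, (√h)⁻¹ * D.localSum h t K (scoreFn β₀ α μ d) i ω
      + (√(n : ℝ))⁻¹ * ∑ i ∈ Finset.range n, (√h)⁻¹ *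
        D.localSum h t K (driftFn β₀ α μ d t) i ω := by
  rw [← mul_add, ← Finset.sum_add_distrib]
  simp only [score, ← mul_add, ← Finset.mul_sum]
  simp only [mul_left_comm (d _), ← Finset.mul_sum]
  congr 2
  simp only [Finset.mul_sum]
  rw [Finset.sum_comm]
  refine Finset.sum_congr rfl fun i _ => ?_
  simp only [localSum, Finset.mul_sum]
  rw [Finset.sum_comm, ← Finset.sum_add_distrib]
  refine Finset.sum_congr rfl fun j _ => ?_
  rw [← mul_add, ← sum_design_mul_residFn, Finset.mul_sum]
  refine Finset.sum_congr rfl fun l _ => ?_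
  simp
  ring

variable [MeasurableSpace Ω] {P : Measure Ω} {β₀ : ℝ → Vec p} {γ₀ : ℝ → Vec q} {lam : ℝ → ℝ}
  {h : ℕ → ℝ} {t : ℝ} {C : ℝ≥0} {Λ : ℝ}

/-- At time `t` the design evaluated at its own centre is `(1, 0, …, 0)`, so the mean product
contributes to the intercept block and the covariance to the slope block. -/
lemma fromBlocks_matA_apply (k l : Unit ⊕ Fin p) :
    Matrix.fromBlocks (Matrix.of fun _ _ => lam t) 0 0 (D.matA P lam t) k l
      = lam t * (design (D.meanX P t) (D.meanX P t) k * design (D.meanX P t) (D.meanX P t) l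
        + D.designCov P k l t t) := by
  rcases k with _ | k <;> rcases l with _ | l
  · simp [design, designCov, designXc]
  · simp [design, designCov, designXc]
  · simp [design, designCov, designXc]
  · simp [design, designCov, designXc, matA, mul_comm]

variable [IsProbabilityMeasure P]

/-- The Gram matrix converges in `L¹`. -/
lemma tendsto_integral_abs_gram_sub (hS : D.IsSampled P lam C Λ) (hmodel : D.Model P β₀ γ₀)
    (hreg : D.RegularityCond P lam β₀ γ₀) (hK : KernelCond K) (hh : BandwidthCond h)
    (ht : t ∈ Set.Ioo (0 : ℝ) 1) (k l : (Unit ⊕ Fin p) × Fin 2) :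
    (∀ n, Integrable (fun ω => D.gram K (h n) t (D.meanX P t) n ω k l) P) ∧
    Tendsto (fun n => ∫ ω, |D.gram K (h n) t (D.meanX P t) n ω k l
      - limitMatrix (D.matA P lam t) (lam t) K k l| ∂P) atTop (𝓝 0) := by
  set m := D.meanX P t with hm
  have hj : (k.2 : ℕ) + (l.2 : ℕ) ≤ 2 := by have := k.2.2; have := l.2.2; omega
  have hf : Measurable fun z => K z * z ^ ((k.2 : ℕ) + (l.2 : ℕ)) :=
    hK.measurable.mul (measurable_id.pow_const _)
  have hF : Measurable (Function.uncurry fun (_ : ℝ) (x : Vec p × ℝ) =>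
      design m x.1 k.1 * design m x.1 l.1) :=
    ((measurable_design m k.1).comp measurable_snd.fst).mul
      ((measurable_design m l.1).comp measurable_snd.fst)
  obtain ⟨B, hB0, hB⟩ := exists_lintegral_abs_design_mul_le hmodel hreg m
  refine ⟨fun n => ?_, ?_⟩
  · exact (integrable_finsetSum _ fun i _ => (hS.integral_abs_localSum_le (hh.pos n) t hf
      (hK.integrable_mul_pow hj) hF hB0 (hB k.1 l.1) i).1.const_mul _).const_mul _
  · have hlim := hS.tendsto_integral_abs_average_localSum_sub ht hh.pos hh.tendsto_zero_self
      hh.tendsto_atTop hf (hK.integrable_mul_pow hj) hF (continuousOn_integral_design hreg m k.1 l.1)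
      (fun s hs => integral_design_mul_design hmodel hs m k.1 l.1) hB0 (hB k.1 l.1)
      (tendsto_lintegral_design_mul_sub hmodel hreg ht m k.1 l.1)
    refine hlim.congr fun n => ?_
    refine integral_congr_ae (ae_of_all _ fun ω => ?_)
    have e : limitMatrix (D.matA P lam t) (lam t) K k l
        = (∫ z, K z * z ^ ((k.2 : ℕ) + (l.2 : ℕ))) * (lam t *
          (design m m k.1 * design m m l.1 + D.designCov P k.1 l.1 t t)) := by
      rw [hm, ← fromBlocks_matA_apply, mul_comm]
      rfl
    simp only [e, gram, Matrix.of_apply]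
    rfl

/-- The score is bounded in `L¹`. -/
lemma exists_integral_abs_score_le (hS : D.IsSampled P lam C Λ) (hmodel : D.Model P β₀ γ₀)
    (horth : D.Orthogonal P) (hreg : D.RegularityCond P lam β₀ γ₀) (hK : KernelCond K)
    (hh : BandwidthCond h) (t : ℝ) (m : Vec p) (k : (Unit ⊕ Fin p) × Fin 2) :
    (∀ n, Integrable (fun ω => D.score β₀ (D.intercept P γ₀) K (h n) t m n ω k) P) ∧
    ∃ B : ℝ, ∀ᶠ n in atTop,
      ∫ ω, |D.score β₀ (D.intercept P γ₀) K (h n) t m n ω k| ∂P ≤ B := by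
  set f : ℝ → ℝ := fun z => K z * z ^ (k.2 : ℕ) with hfdef
  have hf : Measurable f := hK.measurable.mul (measurable_id.pow_const _)
  have hfi : Integrable f := hK.integrable_mul_pow (by have := k.2.2; omega)
  have hf2 : Integrable fun z => f z ^ 2 := hK.integrable_sq_mul_pow k.2
  have hf20 : 0 ≤ ∫ z, f z ^ 2 := integral_nonneg fun _ => sq_nonneg _
  have hF : Measurable (Function.uncurry fun (s : ℝ) (x : Vec p × ℝ) =>
      design m x.1 k.1 * residFn β₀ (D.intercept P γ₀) s x) :=
    ((measurable_design m k.1).comp measurable_snd.fst).mul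
      (measurable_residFn hreg.contDiff_beta.continuousOn hreg.contDiff_intercept.continuousOn)
  obtain ⟨b, hb0, hb⟩ := exists_lintegral_sq_design_mul_resid_le hmodel hreg m k.1
  have heq : ∀ s ∈ Set.Icc (0 : ℝ) 1, ∀ ω, design m (D.XY 0 s ω).1 k.1
      * residFn β₀ (D.intercept P γ₀) s (D.XY 0 s ω)
      = design m (D.X 0 s ω) k.1 * D.resid P β₀ s ω := fun s hs ω => by
    rw [residFn_XY hS.iid hmodel horth hs]
    rfl
  have hb' : ∀ s ∈ Set.Icc (0 : ℝ) 1, ∫⁻ ω, ENNReal.ofReal ((design m (D.XY 0 s ω).1 k.1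
      * residFn β₀ (D.intercept P γ₀) s (D.XY 0 s ω)) ^ 2) ∂P ≤ ENNReal.ofReal b := fun s hs => by
    simp only [heq s hs]
    exact hb s hs
  have hA2 := fun n => hS.integral_sq_normalized_localSum_le (hh.pos n) t hf hfi hF
    (fun s hs => by
      simp only [heq s hs]
      exact integral_design_mul_resid hS.iid hmodel horth hs m k.1) hb0
    (c := (∫ z, f z ^ 2) * b) (by positivity) (by
      rw [ENNReal.ofReal_mul hf20, ← lintegral_ofReal_sq hf2]
      exact kernelAvg_le (by fun_prop) hb') hb' n
  refine ⟨fun n => (hA2 n).1.integrable one_le_two,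
    -- The factor `1` replaces `h n`, which is eventually at most `1`.
    √(Λ * ((∫ z, f z ^ 2) * b) + C * 1 * (∫ z, |f z|) ^ 2 * b), ?_⟩
  filter_upwards [hh.tendsto_zero_self.eventually_le_const one_pos] with n hn
  refine (integral_abs_le_sqrt_integral_sq (hA2 n).1).trans (Real.sqrt_le_sqrt ?_)
  refine (hA2 n).2.trans ?_
  gcongr

/-- The part of the score which is due to the change of the mean is negligible. -/
lemma tendsto_integral_abs_drift (hS : D.IsSampled P lam C Λ) (hmodel : D.Model P β₀ γ₀)
    (horth : D.Orthogonal P) (hreg : D.RegularityCond P lam β₀ γ₀) (hK : KernelCond K)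
    (hh : BandwidthCond h) (ht : t ∈ Set.Ioo (0 : ℝ) 1) (d : Fin p → ℝ) :
    (∀ n : ℕ, Integrable (fun ω => (√(n : ℝ))⁻¹ * ∑ i ∈ Finset.range n, (√(h n))⁻¹ *
      D.localSum (h n) t K (driftFn β₀ (D.intercept P γ₀) (D.meanX P) d t) i ω) P) ∧
    Tendsto (fun n : ℕ => ∫ ω, |(√(n : ℝ))⁻¹ * ∑ i ∈ Finset.range n, (√(h n))⁻¹ *
      D.localSum (h n) t K (driftFn β₀ (D.intercept P γ₀) (D.meanX P) d t) i ω| ∂P)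
      atTop (𝓝 0) := by
  have hF := measurable_driftFn hreg.contDiff_beta.continuousOn
    hreg.contDiff_intercept.continuousOn (μ := D.meanX P) hreg.continuous_mean d t
  obtain ⟨⟨b, hb0, hb⟩, hbt⟩ := exists_lintegral_sq_driftFn_le hS.iid hmodel horth hreg ht d
  set w : ℝ → ℝ≥0∞ := fun s => ∫⁻ ω, ENNReal.ofReal
    (driftFn β₀ (D.intercept P γ₀) (D.meanX P) d t s (D.XY 0 s ω) ^ 2) ∂P with hw
  have hφ : Measurable fun z => ENNReal.ofReal (K z ^ 2) :=
    (hK.measurable.pow_const 2).ennreal_ofReal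
  have hφi : ∫⁻ z, ENNReal.ofReal (K z ^ 2) ≠ ∞ := by
    rw [lintegral_ofReal_sq hK.sq_integrable]
    exact ENNReal.ofReal_ne_top
  -- The mean function is continuous at `t`, so the second moment of the drift vanishes there, and
  -- so does its average over the shrinking window.
  have hkA := tendsto_kernelAvg_zero hh.tendsto_zero_self hφ hφi (B := b.toNNReal) hb hbt
  have hfin : ∀ n, kernelAvg (h n) t (fun z => ENNReal.ofReal (K z ^ 2)) w ≠ ∞ := fun n =>
    ((kernelAvg_le hφ hb).trans_lt
      (ENNReal.mul_lt_top hφi.lt_top ENNReal.ofReal_lt_top)).ne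
  have hA2 := fun n => hS.integral_sq_normalized_localSum_le (hh.pos n) t hK.measurable
    hK.integrable hF (fun s hs => integral_driftFn hS.iid hmodel horth hs d t) hb0
    (c := (kernelAvg (h n) t (fun z => ENNReal.ofReal (K z ^ 2)) w).toReal) ENNReal.toReal_nonneg
    (ENNReal.ofReal_toReal (hfin n)).ge hb n
  refine ⟨fun n => (hA2 n).1.integrable one_le_two, ?_⟩
  have hc : Tendsto (fun n => (kernelAvg (h n) t (fun z => ENNReal.ofReal (K z ^ 2)) w).toReal)
      atTop (𝓝 0) := by
    simpa using! (ENNReal.tendsto_toReal ENNReal.zero_ne_top).comp hkA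
  have hlim : Tendsto (fun n => √(Λ * (kernelAvg (h n) t
      (fun z => ENNReal.ofReal (K z ^ 2)) w).toReal + C * h n * (∫ z, |K z|) ^ 2 * b))
      atTop (𝓝 0) := by
    have h1 := (hc.const_mul Λ).add (((hh.tendsto_zero_self.const_mul (C : ℝ)).mul_const
      ((∫ z, |K z|) ^ 2)).mul_const b)
    simpa using h1.sqrt
  exact squeeze_zero (fun n => integral_nonneg fun _ => abs_nonneg _)
    (fun n => (integral_abs_le_sqrt_integral_sq (hA2 n).1).trans (Real.sqrt_le_sqrt (hA2 n).2)) hlim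

/-- The bias is negligible. -/
lemma tendsto_integral_biasBound (hS : D.IsSampled P lam C Λ) (hmodel : D.Model P β₀ γ₀)
    (hreg : D.RegularityCond P lam β₀ γ₀) (hK : KernelCond K)
    (hh : BandwidthCond h) (t : ℝ) (m : Vec p) (k : (Unit ⊕ Fin p) × Fin 2) :
    (∀ n, Integrable (fun ω => D.biasBound K (h n) t m n ω k) P) ∧
    Tendsto (fun n => ∫ ω, D.biasBound K (h n) t m n ω k ∂P) atTop (𝓝 0) := by
  set f : ℝ → ℝ := fun z => K z * |z| ^ ((k.2 : ℕ) + 2) with hfdef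
  have hf : Measurable f := hK.measurable.mul (measurable_id.abs.pow_const _)
  have hfi : Integrable f := hK.integrable_mul_abs_pow k.2
  have hF : Measurable (Function.uncurry fun (_ : ℝ) (x : Vec p × ℝ) =>
      |design m x.1 k.1| * (1 + ‖x.1‖)) :=
    ((measurable_design m k.1).comp measurable_snd.fst).abs.mul
      (measurable_const.add measurable_snd.fst.norm)
  obtain ⟨B, hB0, hB⟩ := exists_lintegral_design_mul_norm_le hmodel hreg m
  have hL := fun n i => hS.integral_abs_localSum_le (hh.pos n) t hf hfi hF hB0 (hB k.1) i
  have hint : ∀ n i, Integrable (fun ω => (√(h n))⁻¹ * (h n ^ 2 * D.localSum (h n) t f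
      (fun _ x => |design m x.1 k.1| * (1 + ‖x.1‖)) i ω)) P := fun n i =>
    ((hL n i).1.const_mul _).const_mul _
  refine ⟨fun n => (integrable_finsetSum _ fun i _ => hint n i).const_mul _, ?_⟩
  set M : ℝ := Λ * ((∫ z, |f z|) * B) with hM
  -- There are `n` terms of mean `O(h)` each, multiplied by `h²` and divided by `√n √h`: in all
  -- `√(nh) h² = √(n h⁵)`.
  have hle : ∀ n : ℕ, ∫ ω, D.biasBound K (h n) t m n ω k ∂P ≤ √(n * h n ^ 5) * M := fun n => by
    have hhn := hh.pos n
    simp only [biasBound]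
    rw [integral_const_mul, integral_finsetSum _ fun i _ => hint n i]
    have h1 : ∀ i, ∫ ω, (√(h n))⁻¹ * (h n ^ 2 * D.localSum (h n) t f
        (fun _ x => |design m x.1 k.1| * (1 + ‖x.1‖)) i ω) ∂P
        ≤ (√(h n))⁻¹ * (h n ^ 2 * (Λ * h n * ((∫ z, |f z|) * B))) := fun i => by
      rw [integral_const_mul, integral_const_mul]
      refine mul_le_mul_of_nonneg_left (mul_le_mul_of_nonneg_left ?_ (by positivity))
        (by positivity)
      exact (le_abs_self _).trans ((abs_integral_le_integral_abs).trans (hL n i).2)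
    refine (mul_le_mul_of_nonneg_left (Finset.sum_le_sum fun i _ => h1 i)
      (by positivity)).trans (le_of_eq ?_)
    rw [Finset.sum_const, Finset.card_range, nsmul_eq_mul, hM,
      show (n : ℝ) * h n ^ 5 = n * h n * (h n ^ 2) ^ 2 by ring,
      Real.sqrt_mul (by positivity), Real.sqrt_sq (by positivity), Real.sqrt_mul (by positivity)]
    have e1 : (√(n : ℝ))⁻¹ * n = √n := by
      rw [mul_comm, ← div_eq_mul_inv, Real.div_sqrt]
    have e2 : (√(h n))⁻¹ * h n = √(h n) := by
      rw [mul_comm, ← div_eq_mul_inv, Real.div_sqrt]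
    calc _ = ((√(n : ℝ))⁻¹ * n) * ((√(h n))⁻¹ * h n) * h n ^ 2 * (Λ * ((∫ z, |f z|) * B)) := by
          ring
      _ = _ := by rw [e1, e2]
  have hlim : Tendsto (fun n : ℕ => √(n * h n ^ 5) * M) atTop (𝓝 0) := by
    simpa using (hh.tendsto_zero.sqrt).mul_const M
  exact squeeze_zero (fun n => integral_nonneg fun ω => biasBound_nonneg hK (hh.pos n) t m n ω k)
    hle hlim

end Study

/-! ### Asymptotic normality of the estimator. -/

namespace Study

variable {Ω : Type*} [MeasurableSpace Ω] {P : Measure Ω} {p q : ℕ}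
  {D : Study Ω p q} {β₀ : ℝ → Vec p} {γ₀ : ℝ → Vec q} {lam K : ℝ → ℝ} {h : ℕ → ℝ} {t : ℝ}
  {C : ℝ≥0} {Λ : ℝ}

/-- A diagonal entry of `A` is positive and equals `lam` times a second moment, which is
nonnegative. At least one covariate is needed for such an entry to exist. -/
lemma lam_pos (hreg : D.RegularityCond P lam β₀ γ₀) (hp : 0 < p) :
    ∀ s ∈ Set.Icc (0 : ℝ) 1, 0 < lam s := fun s hs => by
  have h1 := (hreg.posDef s hs).diag_pos (i := (⟨0, hp⟩ : Fin p))
  rw [matA, Matrix.of_apply] at h1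
  exact pos_of_mul_pos_right h1 (integral_nonneg fun ω => mul_self_nonneg _)

variable [IsProbabilityMeasure P]

lemma dotProduct_matS_mulVec (hD : D.IsIIDSample P) (hmodel : D.Model P β₀ γ₀)
    (horth : D.Orthogonal P) (hreg : D.RegularityCond P lam β₀ γ₀)
    (ht : t ∈ Set.Icc (0 : ℝ) 1) (d : Fin p → ℝ) :
    d ⬝ᵥ (D.matS P lam K t).mulVec d = (∫ z, K z ^ 2) * (lam t *
      ∫ ω, scoreFn β₀ (D.intercept P γ₀) (D.meanX P) d t (D.XY 0 t ω) ^ 2 ∂P) := by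
  rw [integral_sq_scoreFn hD hmodel horth hreg ht]
  simp only [dotProduct, Matrix.mulVec, matS, Matrix.of_apply, Finset.mul_sum]
  refine Finset.sum_congr rfl fun k _ => Finset.sum_congr rfl fun l _ => ?_
  ring

lemma posSemidef_matS (hD : D.IsIIDSample P) (hmodel : D.Model P β₀ γ₀)
    (horth : D.Orthogonal P) (hreg : D.RegularityCond P lam β₀ γ₀)
    (ht : t ∈ Set.Icc (0 : ℝ) 1) (hlam : 0 ≤ lam t) : (D.matS P lam K t).PosSemidef := by
  refine Matrix.PosSemidef.of_dotProduct_mulVec_nonneg ?_ fun x => ?_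
  · ext k l
    simp only [matS, Matrix.conjTranspose_apply, Matrix.of_apply, star_trivial]
    congr 2
    exact integral_congr_ae (ae_of_all _ fun ω => by ring)
  · rw [star_trivial, dotProduct_matS_mulVec hD hmodel horth hreg ht]
    exact mul_nonneg (integral_nonneg fun _ => sq_nonneg _)
      (mul_nonneg hlam (integral_nonneg fun _ => sq_nonneg _))

lemma posSemidef_sandwich (hD : D.IsIIDSample P) (hmodel : D.Model P β₀ γ₀)
    (horth : D.Orthogonal P) (hreg : D.RegularityCond P lam β₀ γ₀)
    (ht : t ∈ Set.Icc (0 : ℝ) 1) (hlam : 0 ≤ lam t) :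
    ((D.matA P lam t)⁻¹ * D.matS P lam K t * (D.matA P lam t)⁻¹).PosSemidef := by
  have h1 := (posSemidef_matS (K := K) hD hmodel horth hreg ht hlam).conjTranspose_mul_mul_same
    (D.matA P lam t)⁻¹
  rwa [(hreg.posDef t ht).isHermitian.inv.eq] at h1

/-- Characteristic function of the limit distribution of the local linear estimator. -/
theorem tendsto_integral_cexp_estimator (hS : D.IsSampled P lam C Λ) (hmodel : D.Model P β₀ γ₀)
    (horth : D.Orthogonal P) (hreg : D.RegularityCond P lam β₀ γ₀) (hK : KernelCond K)
    (hh : BandwidthCond h) (ht : t ∈ Set.Ioo (0 : ℝ) 1) (hlam : lam t ≠ 0)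
    {θ : ℕ → Ω → (ℝ × Vec p) × (ℝ × Vec p)}
    (hmeas : ∀ n, AEMeasurable (fun ω => (θ n ω).1.2) P)
    (hmin : ∀ n, ∀ᵐ ω ∂P, IsMinOn (D.criterion K (h n) t n ω) Set.univ (θ n ω)) (a : Vec p) :
    Tendsto (fun n : ℕ => ∫ ω, Complex.exp
        (((inner ℝ (√((n : ℝ) * h n) • ((θ n ω).1.2 - β₀ t)) a : ℝ) : ℂ) * Complex.I) ∂P) atTop
      (𝓝 (Complex.exp ((-(a.ofLp ⬝ᵥ ((D.matA P lam t)⁻¹ * D.matS P lam K t *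
        (D.matA P lam t)⁻¹).mulVec a.ofLp) / 2 : ℝ) : ℂ))) := by
  have htI : t ∈ Set.Icc (0 : ℝ) 1 := Set.Ioo_subset_Icc_self ht
  set A := D.matA P lam t with hA
  have hApd : A.PosDef := hreg.posDef t htI
  have hAdet : A.det ≠ 0 := hApd.det_pos.ne'
  have hAsymm : A.transpose = A := by simpa using hApd.isHermitian.eq
  -- As `A` is symmetric, pairing the slope error with `a` is the same as pairing `A` times it with
  -- `d`. This is the combination, with coefficients `d`, of the slope rows of the limiting system.
  set d : Fin p → ℝ := A⁻¹.mulVec a.ofLp with hd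
  have hAd : A.mulVec d = a.ofLp := by
    rw [hd, Matrix.mulVec_mulVec, Matrix.mul_nonsing_inv _ (isUnit_iff_ne_zero.2 hAdet),
      Matrix.one_mulVec]
  have hAd' : ∀ x : Fin p → ℝ, d ⬝ᵥ A.mulVec x = a.ofLp ⬝ᵥ x := fun x => by
    rw [Matrix.dotProduct_mulVec, ← Matrix.mulVec_transpose, hAsymm, hAd]
  set G := limitMatrix A (lam t) K with hG
  have hGdet : IsUnit G.det := isUnit_det_limitMatrix hK hAdet hlam
  set α := D.intercept P γ₀ with hα
  set m := D.meanX P t with hm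
  obtain ⟨α', β', C₀, hC0, hrem⟩ :=
    exists_fit_remainder_le hreg.contDiff_beta hreg.contDiff_intercept htI
  set κ := ∑ i, ∑ j, |G⁻¹ i j| with hκ
  have hκ0 : 0 ≤ κ := Finset.sum_nonneg fun _ _ => Finset.sum_nonneg fun _ _ => abs_nonneg _
  have hd0 : 0 ≤ ∑ l, |d l| := Finset.sum_nonneg fun _ _ => abs_nonneg _
  have hbias0 := fun n ω k => biasBound_nonneg (D := D) hK (hh.pos n) t m n ω k
  have hgram := tendsto_integral_abs_gram_sub hS hmodel hreg hK hh ht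
  have hscore := exists_integral_abs_score_le hS hmodel horth hreg hK hh t m
  choose Bs hBs using fun k => (hscore k).2
  obtain ⟨hdi, hdt⟩ := tendsto_integral_abs_drift hS hmodel horth hreg hK hh ht d
  have hbias := tendsto_integral_biasBound hS hmodel hreg hK hh t m
  have hFm := measurable_scoreFn hreg.contDiff_beta.continuousOn
    hreg.contDiff_intercept.continuousOn (μ := D.meanX P) hreg.continuous_mean d
  set Dr : ℕ → Ω → ℝ := fun n ω => (√(n : ℝ))⁻¹ * ∑ i ∈ Finset.range n, (√(h n))⁻¹ *
      D.localSum (h n) t K (driftFn β₀ α (D.meanX P) d t) i ω with hDr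
  set Mn : ℕ → Ω → ℝ := fun n ω => (√(n : ℝ))⁻¹ * ∑ i ∈ Finset.range n, (√(h n))⁻¹ *
      D.localSum (h n) t K (scoreFn β₀ α (D.meanX P) d) i ω with hMn
  -- Roles in the perturbation lemma: `g` is the error of the Gram matrix, small in mean; `σ` bounds
  -- the `ℓ¹` norm of the right-hand side and is bounded in mean; `w` collects bias and drift, small
  -- in mean.
  set g : ℕ → Ω → ℝ := fun n ω => ∑ k, ∑ l, |D.gram K (h n) t m n ω k l - G k l| with hg
  set σ : ℕ → Ω → ℝ := fun n ω => ∑ k, (|D.score β₀ α K (h n) t m n ω k|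
    + C₀ * D.biasBound K (h n) t m n ω k) with hσ
  set w : ℕ → Ω → ℝ := fun n ω => ∑ l, |d l| * (C₀ * D.biasBound K (h n) t m n ω (Sum.inr l, 0))
    + |Dr n ω| with hw
  have hgi : ∀ n k l, Integrable (fun ω => |D.gram K (h n) t m n ω k l - G k l|) P := fun n k l =>
    (((hgram k l).1 n).sub (integrable_const _)).abs
  have hσi : ∀ n k, Integrable (fun ω => |D.score β₀ α K (h n) t m n ω k|
    + C₀ * D.biasBound K (h n) t m n ω k) P := fun n k =>
    ((hscore k).1 n).abs.add (((hbias k).1 n).const_mul C₀)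
  have hwi : ∀ n, Integrable (fun ω =>
      ∑ l, |d l| * (C₀ * D.biasBound K (h n) t m n ω (Sum.inr l, 0))) P := fun n =>
    integrable_finsetSum _ fun l _ => ((((hbias _).1 n).const_mul C₀).const_mul _)
  obtain ⟨b, hb0, hb⟩ := exists_lintegral_sq_scoreFn_le hS.iid hmodel horth hreg d
  obtain ⟨r, b', hr, hb'0, hb'⟩ := exists_lintegral_rpow_scoreFn_le hS.iid hmodel horth hreg d
  have hclt := hS.tendsto_integral_cexp_localSum ht hh.pos hh.tendsto_zero_self hh.tendsto_atTop
    hK.measurable hK.integrable hK.sq_integrable hFm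
    (fun s hs => integral_scoreFn hS.iid hmodel horth hs d)
    (v := fun s => ∑ k, ∑ l, d k * d l *
      ∫ ω, D.Xc P s ω k * D.Xc P s ω l * D.condVariance P s ω ∂P)
    (continuousOn_finsetSum _ fun k _ => continuousOn_finsetSum _ fun l _ =>
      continuousOn_const.mul (hreg.continuous_var k l))
    (fun s hs => integral_sq_scoreFn hS.iid hmodel horth hreg hs d) hb0 hb'0 hb hr hb'
  -- The variance in the direction `d` is `dᵀ Σ d`, which for `d = A⁻¹ a` and symmetric `A` is the
  -- sandwich form at `a`.
  have hvar : (∫ z, K z ^ 2) * (lam t * ∑ k, ∑ l, d k * d l *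
      ∫ ω, D.Xc P t ω k * D.Xc P t ω l * D.condVariance P t ω ∂P)
      = a.ofLp ⬝ᵥ (A⁻¹ * D.matS P lam K t * A⁻¹).mulVec a.ofLp := by
    rw [← integral_sq_scoreFn hS.iid hmodel horth hreg htI,
      ← dotProduct_matS_mulVec hS.iid hmodel horth hreg htI, Matrix.mul_assoc,
      ← Matrix.mulVec_mulVec, ← hAd', Matrix.mulVec_mulVec _ A A⁻¹,
      Matrix.mul_nonsing_inv _ (isUnit_iff_ne_zero.2 hAdet), Matrix.one_mulVec,
      ← Matrix.mulVec_mulVec]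
  rw [hvar] at hclt
  refine tendsto_integral_cexp_of_abs_sub_le (y := Mn) (g := g) (σ := σ) (w := w)
    (B := ∑ k, (Bs k + 1)) (κ := κ) (c := (∑ l, |d l|) * (2 * κ)) (fun n => ?_) (fun n => ?_)
    (fun n => integrable_finsetSum _ fun k _ => integrable_finsetSum _ fun l _ => hgi n k l)
    (fun n => integrable_finsetSum _ fun k _ => hσi n k)
    (fun n => (hwi n).add (hdi n).abs)
    (fun n ω => Finset.sum_nonneg fun _ _ => Finset.sum_nonneg fun _ _ => abs_nonneg _)
    (fun n ω => Finset.sum_nonneg fun k _ => add_nonneg (abs_nonneg _)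
      (mul_nonneg hC0 (hbias0 n ω k)))
    (fun n ω => add_nonneg (Finset.sum_nonneg fun l _ => mul_nonneg (abs_nonneg _)
      (mul_nonneg hC0 (hbias0 n ω _))) (abs_nonneg _)) ?_ ?_ ?_ hκ0 (by positivity) ?_ hclt
  · have := ((hmeas n).sub_const (β₀ t)).const_smul (√((n : ℝ) * h n))
    exact this.inner aemeasurable_const
  · exact (Measurable.const_mul (Finset.measurable_sum _ fun i _ =>
      (hS.measurable_localSum (h n) t hK.measurable hFm i).const_mul _) _).aemeasurable
  · have h1 : Tendsto (fun n => ∑ k, ∑ l, ∫ ω, |D.gram K (h n) t m n ω k l - G k l| ∂P) atTop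
        (𝓝 (∑ _k : (Unit ⊕ Fin p) × Fin 2, ∑ _l : (Unit ⊕ Fin p) × Fin 2, (0 : ℝ))) :=
      tendsto_finsetSum _ fun k _ => tendsto_finsetSum _ fun l _ => (hgram k l).2
    simp only [Finset.sum_const_zero] at h1
    refine h1.congr fun n => ?_
    rw [integral_finsetSum _ fun k _ => integrable_finsetSum _ fun l _ => hgi n k l]
    exact Finset.sum_congr rfl fun k _ => (integral_finsetSum _ fun l _ => hgi n k l).symm
  · have h1 : ∀ᶠ n in atTop, ∀ k, C₀ * ∫ ω, D.biasBound K (h n) t m n ω k ∂P ≤ 1 :=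
      eventually_all.2 fun k => by
        have := (hbias k).2.const_mul C₀
        rw [mul_zero] at this
        exact this.eventually_le_const one_pos
    filter_upwards [h1, eventually_all.2 hBs] with n h1 h2
    rw [integral_finsetSum _ fun k _ => hσi n k]
    refine Finset.sum_le_sum fun k _ => ?_
    rw [integral_add ((hscore k).1 n).abs (((hbias k).1 n).const_mul C₀), integral_const_mul]
    exact add_le_add (h2 k) (h1 k)
  · have h1 : Tendsto (fun n => ∑ l, |d l| * (C₀ *
        ∫ ω, D.biasBound K (h n) t m n ω (Sum.inr l, 0) ∂P) + ∫ ω, |Dr n ω| ∂P) atTop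
        (𝓝 (∑ l, |d l| * (C₀ * 0) + 0)) :=
      (tendsto_finsetSum _ fun l _ => (((hbias _).2.const_mul C₀).const_mul _)).add hdt
    simp only [mul_zero, Finset.sum_const_zero, add_zero] at h1
    refine h1.congr fun n => ?_
    rw [integral_add (hwi n) (hdi n).abs, integral_finsetSum _ fun l _ =>
      (((hbias _).1 n).const_mul C₀).const_mul _]
    simp only [integral_const_mul]
    rfl
  · have hT : ∀ᵐ ω ∂P, ∀ i, ∀ j < D.L i ω, D.T i j ω ∈ Set.Icc (0 : ℝ) 1 :=
      ae_all_iff.2 hS.iid.times_mem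
    filter_upwards [eventually_gt_atTop 0] with n hn
    filter_upwards [hT, hmin n] with ω hT hmin hsmall
    obtain ⟨x, hx, hxs⟩ := D.exists_gram_mulVec_sub_score_le hK.nonneg (hh.pos n) m hn ω
      (fun i _ => hT i) hrem hmin
    set s' := (D.gram K (h n) t m n ω).mulVec x with hs'
    have hpert := fun k => abs_mulVec_sub_le hGdet hs'.symm hsmall k
    have hs'σ : ∑ k, |s' k| ≤ σ n ω := Finset.sum_le_sum fun k _ => by
      have h1 := hxs k
      have h2 := abs_sub_abs_le_abs_sub (s' k) (D.score β₀ α K (h n) t m n ω k)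
      linarith
    have hg0 : 0 ≤ g n ω :=
      Finset.sum_nonneg fun _ _ => Finset.sum_nonneg fun _ _ => abs_nonneg _
    have hinner : inner ℝ (√((n : ℝ) * h n) • ((θ n ω).1.2 - β₀ t)) a
        = ∑ k, d k * G.mulVec x (Sum.inr k, 0) := by
      have h1 : ∀ k, G.mulVec x (Sum.inr k, 0) = A.mulVec (fun j => x (Sum.inr j, 0)) k :=
        fun k => limitMatrix_mulVec hK x k
      simp only [h1]
      change _ = d ⬝ᵥ A.mulVec (fun j => x (Sum.inr j, 0))
      rw [hAd', inner_eq_sum, dotProduct]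
      refine Finset.sum_congr rfl fun l _ => ?_
      rw [hx l, mul_comm]
      rfl
    have hsc := sum_score_eq (D := D) (K := K) β₀ α (D.meanX P) d (h n) t n ω
    -- Three errors: the Gram matrix replaced by its limit, the bias of the right-hand side, and the
    -- drift in the score.
    have hdecomp : inner ℝ (√((n : ℝ) * h n) • ((θ n ω).1.2 - β₀ t)) a - Mn n ω
        = ∑ k, d k * (G.mulVec x (Sum.inr k, 0) - s' (Sum.inr k, 0))
          + (∑ k, d k * (s' (Sum.inr k, 0) - D.score β₀ α K (h n) t m n ω (Sum.inr k, 0))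
            + Dr n ω) := by
      simp only [mul_sub, Finset.sum_sub_distrib]
      rw [hsc, hinner]
      ring
    rw [hdecomp]
    refine (abs_add_le _ _).trans (add_le_add ?_ ((abs_add_le _ _).trans (add_le_add ?_ le_rfl)))
    · refine (Finset.abs_sum_le_sum_abs _ _).trans ?_
      rw [mul_assoc, Finset.sum_mul]
      refine Finset.sum_le_sum fun k _ => ?_
      rw [abs_mul]
      refine mul_le_mul_of_nonneg_left ((hpert _).trans ?_) (abs_nonneg _)
      exact mul_le_mul_of_nonneg_left (mul_le_mul_of_nonneg_left hs'σ hg0) (by positivity)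
    · refine (Finset.abs_sum_le_sum_abs _ _).trans (Finset.sum_le_sum fun k _ => ?_)
      rw [abs_mul]
      exact mul_le_mul_of_nonneg_left (hxs _) (abs_nonneg _)

end Study

/-- Convergence in distribution to a centered Gaussian vector, by characteristic functions. -/
lemma tendstoInDistribution_multivariateGaussian {Ω : Type*} [MeasurableSpace Ω] {P : Measure Ω}
    [IsProbabilityMeasure P] {p : ℕ} {V : Matrix (Fin p) (Fin p) ℝ} (hV : V.PosSemidef)
    {X : ℕ → Ω → Vec p} (hX : ∀ n, AEMeasurable (X n) P)
    (hlim : ∀ a : Vec p, Tendsto (fun n => ∫ ω, Complex.exp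
      (((inner ℝ (X n ω) a : ℝ) : ℂ) * Complex.I) ∂P) atTop
      (𝓝 (Complex.exp ((-(a.ofLp ⬝ᵥ V.mulVec a.ofLp) / 2 : ℝ) : ℂ)))) :
    TendstoInDistribution X atTop (id : Vec p → Vec p) (fun _ => P)
      (multivariateGaussian 0 V) where
  forall_aemeasurable := hX
  tendsto := by
    refine ProbabilityMeasure.tendsto_iff_tendsto_charFun.2 fun a => ?_
    have h1 : charFun ((multivariateGaussian 0 V).map (id : Vec p → Vec p)) a
        = Complex.exp ((-(a.ofLp ⬝ᵥ V.mulVec a.ofLp) / 2 : ℝ) : ℂ) := by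
      rw [Measure.map_id, charFun_multivariateGaussian hV, inner_zero_right]
      push_cast
      congr 1
      ring
    change Tendsto _ _ (𝓝 (charFun ((multivariateGaussian 0 V).map (id : Vec p → Vec p)) a))
    rw [h1]
    refine (hlim a).congr fun n => ?_
    change _ = charFun (P.map (X n)) a
    rw [charFun_apply, integral_map (hX n)]
    exact (Complex.continuous_exp.comp ((Complex.continuous_ofReal.comp
      (continuous_id.inner continuous_const)).mul continuous_const)).aestronglyMeasurable

end VaryingCoef

end

theorem theorem3 {Ω : Type*} [MeasurableSpace Ω] (P : Measure Ω) [IsProbabilityMeasure P]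
    {p q : ℕ} (D : VaryingCoef.Study Ω p q)
    (β₀ : ℝ → VaryingCoef.Vec p) (γ₀ : ℝ → VaryingCoef.Vec q) (lam K : ℝ → ℝ) (h : ℕ → ℝ)
    (hD : D.IsIIDSample P) (hmodel : D.Model P β₀ γ₀) (horth : D.Orthogonal P)
    (hobs : D.ObservationCond P lam) (hreg : D.RegularityCond P lam β₀ γ₀)
    (hK : VaryingCoef.KernelCond K) (hh : VaryingCoef.BandwidthCond h)
    (t : ℝ) (ht : t ∈ Set.Ioo (0 : ℝ) 1)
    (αhat αdothat : ℕ → Ω → ℝ) (βhat βdothat : ℕ → Ω → VaryingCoef.Vec p)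
    (hmeas : ∀ n, AEMeasurable (βhat n) P)
    (hmin : ∀ n, ∀ᵐ ω ∂P, IsMinOn (D.criterion K (h n) t n ω) Set.univ
      ((αhat n ω, βhat n ω), (αdothat n ω, βdothat n ω))) :
    ((D.matA P lam t)⁻¹ * D.matS P lam K t * (D.matA P lam t)⁻¹).PosSemidef ∧
    TendstoInDistribution (fun (n : ℕ) ω => Real.sqrt ((n : ℝ) * h n) • (βhat n ω - β₀ t)) atTop
      (id : VaryingCoef.Vec p → VaryingCoef.Vec p) (fun _ => P)
      (multivariateGaussian 0
        ((D.matA P lam t)⁻¹ * D.matS P lam K t * (D.matA P lam t)⁻¹)) := by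
  have htI : t ∈ Set.Icc (0 : ℝ) 1 := Set.Ioo_subset_Icc_self ht
  have hm : ∀ n : ℕ, AEMeasurable (fun ω => Real.sqrt ((n : ℝ) * h n) • (βhat n ω - β₀ t)) P :=
    fun n => ((hmeas n).sub_const (β₀ t)).const_smul (Real.sqrt ((n : ℝ) * h n))
  -- Without covariates positive definiteness of the empty matrix `A` says nothing about `lam`, but
  -- the estimator then takes values in a one-point space.
  rcases Nat.eq_zero_or_pos p with rfl | hp
  · have hV : ((D.matA P lam t)⁻¹ * D.matS P lam K t * (D.matA P lam t)⁻¹).PosSemidef := by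
      rw [Subsingleton.elim ((D.matA P lam t)⁻¹ * D.matS P lam K t * (D.matA P lam t)⁻¹) 0]
      exact Matrix.PosSemidef.zero
    refine ⟨hV, VaryingCoef.tendstoInDistribution_multivariateGaussian hV hm fun a => ?_⟩
    rw [Subsingleton.elim a 0]
    simp
  · have hl := VaryingCoef.Study.lam_pos hreg hp
    obtain ⟨C, Λ, hS⟩ := hD.exists_isSampled hobs fun s hs => (hl s hs).le
    have hV := VaryingCoef.Study.posSemidef_sandwich (K := K) hD hmodel horth hreg htI (hl t htI).le
    exact ⟨hV, VaryingCoef.tendstoInDistribution_multivariateGaussian hV hm fun a =>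
      VaryingCoef.Study.tendsto_integral_cexp_estimator hS hmodel horth hreg hK hh ht
        (hl t htI).ne' (θ := fun n ω => ((αhat n ω, βhat n ω), (αdothat n ω, βdothat n ω)))
        hmeas hmin a⟩
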